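/- Model of computation: the deterministic word RAM with words of $O(\log n)$ bits and unit-cost word operations. For a problem whose instances consist of integers, with size parameter $n$, "can be solved in time $O(T(n))$" means: for every constant $c$ there is a program that, for a function $t = O(T)$, decides every instance whose numbers all lie in $\{-n^c,\dots,n^c\}$ within $t(n)$ steps (the program, the constant in the word length and the constant in the $O$ may depend on $c$). 3-SUM: given sets $A_1,A_2,A_3$ of $n$ integers each, are there $a_1\in A_1$, $a_2\in A_2$, $a_3\in A_3$ with $a_1+a_2+a_3=0$? $\mathsf{FOP}_{\mathbb Z}(\forall\exists\exists)$: a problem $P$ of this class is given by fixed $d_1,d_2,d_3,l\in\mathbb N$ and a fixed quantifier-free formula $\psi$ of linear integer arithmetic (a Boolean combination of linear inequalities with integer coefficients) in the coordinates of vectors $x_1,x_2,x_3$ of dimensions $d_1,d_2,d_3$ and in free variables $t_1,\dots,t_l$. An instance consists of finite sets $A_i\subseteq\mathbb Z^{d_i}$ $(i=1,2,3)$ and integers $\hat t_1,\dots,\hat t_l$; its size is $n=\max_i|A_i|$. The question is whether for all $x_1\in A_1$ there are $x_2\in A_2$ and $x_3\in A_3$ such that $\psi$ holds for $x_1,x_2,x_3$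 and $(t_1,\dots,t_l)=(\hat t_1,\dots,\hat t_l)$. Lemma. If 3-SUM can be solved in time $O(n^{2-\epsilon})$ for some $\epsilon>0$, then for every problem $P$ in $\mathsf{FOP}_{\mathbb Z}(\forall\exists\exists)$ there is an $\epsilon_P>0$ such that $P$ can be solved in time $O(n^{2-\epsilon_P})$. -/

import Mathlib

namespace WordRAM

/-- Binary word operations, each of unit cost. -/
inductive BinOp
  | add | sub | mul | div | mod | land | lor | xor | shl | shr

def BinOp.eval : BinOp → ℤ → ℤ → ℤ
  | .add, x, y => x + y
  | .sub, x, y => x - y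
  | .mul, x, y => x * y
  | .div, x, y => x / y
  | .mod, x, y => x % y
  | .land, x, y => Int.land x y
  | .lor, x, y => Int.lor x y
  | .xor, x, y => Int.xor x y
  | .shl, x, y => x <<< y.toNat
  | .shr, x, y => x >>> y.toNat

/-- A state: registers `reg r`, and arrays whose cell number `z` is `mem m z`. A program mentions
only finitely many registers and arrays. -/
structure State where
  reg : ℕ → ℤ
  mem : ℕ → ℤ → ℤ

def State.setReg (s : State) (r : ℕ) (v : ℤ) : State :=
  ⟨Function.update s.reg r v, s.mem⟩

def State.setMem (s : State) (m : ℕ) (z v : ℤ) : State :=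
  ⟨s.reg, Function.update s.mem m (Function.update (s.mem m) z v)⟩

/-- Deterministic programs of the word RAM. -/
inductive Cmd
  | skip
  /-- `reg r := k` -/
  | const (r : ℕ) (k : ℤ)
  /-- `reg r := o (reg a) (reg b)` -/
  | op (o : BinOp) (r a b : ℕ)
  /-- `reg r := mem m (reg a)` -/
  | load (r m a : ℕ)
  /-- `mem m (reg a) := reg b` -/
  | store (m a b : ℕ)
  | seq (p q : Cmd)
  /-- if `reg a < reg b` then `p` else `q` -/
  | ite (a b : ℕ) (p q : Cmd)
  /-- while `reg a < reg b` do `p` -/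
  | loop (a b : ℕ) (p : Cmd)

/-- `Exec W p s τ s'`: started in the state `s`, the program `p` halts in the state `s'` after
exactly `τ` steps, and every value computed on the way is a word, that is, an integer of absolute
value at most `W`. (A program that computes a larger value is stuck: it has no execution.) -/
inductive Exec (W : ℕ) : Cmd → State → ℕ → State → Prop
  | skip (s : State) : Exec W .skip s 1 s
  | const (s : State) (r : ℕ) (k : ℤ) (h : |k| ≤ (W : ℤ)) :
      Exec W (.const r k) s 1 (s.setReg r k)
  | op (s : State) (o : BinOp) (r a b : ℕ) (h : |o.eval (s.reg a) (s.reg b)| ≤ (W : ℤ)) :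
      Exec W (.op o r a b) s 1 (s.setReg r (o.eval (s.reg a) (s.reg b)))
  | load (s : State) (r m a : ℕ) :
      Exec W (.load r m a) s 1 (s.setReg r (s.mem m (s.reg a)))
  | store (s : State) (m a b : ℕ) :
      Exec W (.store m a b) s 1 (s.setMem m (s.reg a) (s.reg b))
  | seq {p q : Cmd} {s s' s'' : State} {τ τ' : ℕ}
      (hp : Exec W p s τ s') (hq : Exec W q s' τ' s'') :
      Exec W (.seq p q) s (τ + τ') s''
  | ite_true {a b : ℕ} {p q : Cmd} {s s' : State} {τ : ℕ}
      (h : s.reg a < s.reg b) (hp : Exec W p s τ s') :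
      Exec W (.ite a b p q) s (τ + 1) s'
  | ite_false {a b : ℕ} {p q : Cmd} {s s' : State} {τ : ℕ}
      (h : ¬ s.reg a < s.reg b) (hq : Exec W q s τ s') :
      Exec W (.ite a b p q) s (τ + 1) s'
  | loop_done {a b : ℕ} {p : Cmd} {s : State}
      (h : ¬ s.reg a < s.reg b) :
      Exec W (.loop a b p) s 1 s
  | loop_step {a b : ℕ} {p : Cmd} {s s' s'' : State} {τ τ' : ℕ}
      (h : s.reg a < s.reg b) (hp : Exec W p s τ s')
      (hl : Exec W (.loop a b p) s' τ' s'') :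
      Exec W (.loop a b p) s (τ + τ' + 1) s''

/-- The array that holds the list `l` in its cells `0, 1, …`, and `0` in all other cells. -/
def arrayOf (l : List ℤ) (z : ℤ) : ℤ :=
  if 0 ≤ z then l.getD z.toNat 0 else 0

/-- The initial state: register `r` holds the `r`-th entry of `counts`, array `m` holds the `m`-th
list of `arrays`; everything else is `0`. -/
def inputState (counts : List ℕ) (arrays : List (List ℤ)) : State where
  reg r := (counts.getD r 0 : ℕ)
  mem m := arrayOf (arrays.getD m [])

end WordRAM

/-- A decision problem whose instances consist of integers. -/
structure DecisionProblem where
  Instance : Type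
  /-- the size parameter `n` in which running times are measured -/
  size : Instance → ℕ
  /-- the lengths that are given to the machine in its registers -/
  counts : Instance → List ℕ
  /-- the input numbers, as they are given to the machine in its arrays -/
  arrays : Instance → List (List ℤ)
  answer : Instance → Prop

namespace DecisionProblem

/-- All input numbers of the instance lie in `{-U, …, U}`. -/
def InUniverse (P : DecisionProblem) (I : P.Instance) (U : ℕ) : Prop :=
  ∀ l ∈ P.arrays I, ∀ x ∈ l, |x| ≤ (U : ℤ)

/-- `P` can be solved in (deterministic) time `O(T(n))` on the word RAM with words of `O(log n)`
bits, the input numbers coming from a universe of polynomial size: for every exponent `c` there is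
a program that decides all instances whose numbers lie in `{-n ^ c, …, n ^ c}`, where `n` is the
size of the instance, in at most `t n` steps with `t = O(T)`. The program accepts by halting with
the value `1` in register `0`. -/
def SolvableInTime (P : DecisionProblem) (T : ℕ → ℝ) : Prop :=
  ∀ c : ℕ, ∃ (p : WordRAM.Cmd) (C : ℕ) (t : ℕ → ℕ),
    ((fun n => (t n : ℝ)) =O[Filter.atTop] T) ∧
    ∀ I : P.Instance, P.InUniverse I (P.size I ^ c) →
      ∃ (τ : ℕ) (s : WordRAM.State),
        WordRAM.Exec ((P.size I + 2) ^ C) p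
          (WordRAM.inputState (P.counts I) (P.arrays I)) τ s ∧
        τ ≤ t (P.size I) ∧
        (s.reg 0 = 1 ↔ P.answer I)

end DecisionProblem

/-- An instance of 3-SUM: three sets of `n` integers each, listed in an arbitrary order. -/
structure ThreeSumInstance where
  n : ℕ
  A : Fin 3 → List ℤ
  nodup : ∀ i, (A i).Nodup
  length_eq : ∀ i, (A i).length = n

/-- 3-SUM: are there `a ∈ A₁`, `b ∈ A₂`, `c ∈ A₃` with `a + b + c = 0`? -/
def threeSum : DecisionProblem where
  Instance := ThreeSumInstance
  size I := I.n
  counts I := [I.n]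
  arrays I := [I.A 0, I.A 1, I.A 2]
  answer I := ∃ a ∈ I.A 0, ∃ b ∈ I.A 1, ∃ c ∈ I.A 2, a + b + c = 0

/-- Quantifier-free formulas of linear integer arithmetic over the variables in `X`: Boolean
combinations of linear inequalities `∑ x, coeff x * x ≤ b` with integer coefficients. (Over the
integers, `<` and `=` are Boolean combinations of these.) -/
inductive LinFormula (X : Type) where
  | le (coeff : X → ℤ) (b : ℤ)
  | not (φ : LinFormula X)
  | and (φ χ : LinFormula X)
  | or (φ χ : LinFormula X)

def LinFormula.Holds {X : Type} [Fintype X] (v : X → ℤ) : LinFormula X → Prop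
  | .le coeff b => ∑ x, coeff x * v x ≤ b
  | .not φ => ¬ φ.Holds v
  | .and φ χ => φ.Holds v ∧ χ.Holds v
  | .or φ χ => φ.Holds v ∨ χ.Holds v

/-- The data of a formula `Q₁ x₁ Q₂ x₂ Q₃ x₃ : ψ` apart from the quantifiers: the dimensions of
the quantified vectors `x₁, x₂, x₃`, the number `l` of free variables, and the quantifier-free
linear arithmetic formula `ψ` in the coordinates of `x₁, x₂, x₃` and the free variables. -/
structure FOPFormula where
  d₁ : ℕ
  d₂ : ℕ
  d₃ : ℕ
  l : ℕ
  ψ : LinFormula (Fin d₁ ⊕ Fin d₂ ⊕ Fin d₃ ⊕ Fin l)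

namespace FOPFormula

/-- `ψ` holds for the vectors `x₁, x₂, x₃` and the values `t` of the free variables. -/
def Holds (φ : FOPFormula) (x₁ : Fin φ.d₁ → ℤ) (x₂ : Fin φ.d₂ → ℤ) (x₃ : Fin φ.d₃ → ℤ)
    (t : Fin φ.l → ℤ) : Prop :=
  φ.ψ.Holds (Sum.elim x₁ (Sum.elim x₂ (Sum.elim x₃ t)))

/-- An input: finite sets `A₁, A₂, A₃` of integer vectors, each listed in an arbitrary order, and
the values of the free variables. -/
structure Input (φ : FOPFormula) where
  A₁ : List (Fin φ.d₁ → ℤ)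
  A₂ : List (Fin φ.d₂ → ℤ)
  A₃ : List (Fin φ.d₃ → ℤ)
  t : Fin φ.l → ℤ
  nodup₁ : A₁.Nodup
  nodup₂ : A₂.Nodup
  nodup₃ : A₃.Nodup

/-- A list of vectors as one array: coordinate `q` of vector number `p` is in cell `p * d + q`. -/
def flatten {d : ℕ} (A : List (Fin d → ℤ)) : List ℤ :=
  A.flatMap List.ofFn

/-- The model-checking problem of the formula `∀ x₁ ∃ x₂ ∃ x₃ : ψ`. These problems form the class
`FOP_ℤ(∀∃∃)`. -/
def forallExistsExists (φ : FOPFormula) : DecisionProblem where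
  Instance := φ.Input
  size I := max I.A₁.length (max I.A₂.length I.A₃.length)
  counts I := [I.A₁.length, I.A₂.length, I.A₃.length]
  arrays I := [flatten I.A₁, flatten I.A₂, flatten I.A₃, List.ofFn I.t]
  answer I := ∀ x₁ ∈ I.A₁, ∃ x₂ ∈ I.A₂, ∃ x₃ ∈ I.A₃, φ.Holds x₁ x₂ x₃ I.t

end FOPFormula

/-! Let N be the size of the instance plus 2. The proof turns the search for x₂ and x₃ into sums of
three integers, and then finds, with few small calls of 3-SUM, all first summands that take part in
a solution.

Encoding. Each atom splits as u(x₁) + v(x₂) + w(x₃) ≤ 0. A sum of three L-bit numbers is positive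
iff for some n < L their prefixes, the shifts by n, sum to 1, 2 or 3 (`Int.sum_pos_iff_prefix`).
Applied to the atom or to its negation, this expresses the truth value of the atom by 6L possible
equations (`exists_prefixDigit_iff`). Since L = O(log N) and the number k of atoms is fixed, there
are only polylogarithmically many ways i to guess one equation for each atom. The equations, a check
that the guessed truth values satisfy ψ, and a check that all three summands use the same i are
packed as digits of one integer in a large base. Thus ψ holds iff for some i three codes add up to a
fixed target T (`Coding.Good.code_sum_iff`, `Coding.Good.holds_iff`).

Blocks. 3-SUM gives a single bit, but the answer is needed for each x₁. The lists of codes are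
sorted and cut into g blocks of size S. A triple of blocks matters only if T lies between the sum of
the minima and the sum of the maxima. No two such triples increase strictly in all three
coordinates, so there are O(g²) of them (`card_rel_le`). For each of them the 3-SUM program is
called on the blocks, with the elements of the first block that are already marked replaced by
dummies. On a positive answer all S² pairs from the other two blocks are tried and the numbers that
complete them are marked; this marks a new element, so it happens at most gS times (`wp_handle`,
`wp_core`). For S ≈ N^(2/5) and g ≈ N^(3/5), up to polylogarithmic factors, the cost is g³ + g²
S^(2-ε) + (gS) S², that is N^(9/5) + N^(2-2ε/5) + N^(9/5) (`growsLike_runningTime`).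

Machine. Programs are verified in the calculus `wp`, a weakest precondition that counts steps and
keeps all values polynomially bounded. A call of the 3-SUM program uses only the cells of one
residue class modulo g³, a new one for each triple, so it finds zeros there without any cleaning
(`wp_call`). Its instances have size S but numbers polynomial in N; since S^5 ≥ N², these are
polynomial in S, with an exponent that depends on the formula and on the given universe exponent
only. -/

namespace WordRAM

/-! ### Expressions and their compilation -/

/-- Integer expressions over registers and arrays. -/
inductive Ex
  | const (k : ℤ)
  | reg (r : ℕ)
  | load (m : ℕ) (e : Ex)
  | op (o : BinOp) (a b : Ex)

namespace Ex

instance : Add Ex := ⟨.op .add⟩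
instance : Sub Ex := ⟨.op .sub⟩
instance : Mul Ex := ⟨.op .mul⟩
instance : Div Ex := ⟨.op .div⟩
instance : Mod Ex := ⟨.op .mod⟩

@[simp] theorem op_add (a b : Ex) : Ex.op .add a b = a + b := rfl
@[simp] theorem op_sub (a b : Ex) : Ex.op .sub a b = a - b := rfl
@[simp] theorem op_mul (a b : Ex) : Ex.op .mul a b = a * b := rfl
@[simp] theorem op_div (a b : Ex) : Ex.op .div a b = a / b := rfl
@[simp] theorem op_mod (a b : Ex) : Ex.op .mod a b = a % b := rfl

/-- The value of an expression in a state. -/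
def eval (s : State) : Ex → ℤ
  | const k => k
  | reg r => s.reg r
  | load m e => s.mem m (e.eval s)
  | op o a b => o.eval (a.eval s) (b.eval s)

/-- The number of steps that the evaluation of an expression takes. -/
def cost : Ex → ℕ
  | const _ => 1
  | reg _ => 2
  | load _ e => e.cost + 1
  | op _ a b => a.cost + b.cost + 1

/-- If all registers and cells are at most `B` in absolute value, then no value that occurs in the
evaluation of `e` exceeds `B ^ e.deg`. -/
def deg : Ex → ℕ
  | const k => k.natAbs
  | reg _ => 1
  | load _ e => e.deg + 1
  | op _ a b => a.deg + b.deg + 1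

/-- The operations of which the absolute value grows at most polynomially. -/
def _root_.WordRAM.BinOp.Tame : BinOp → Prop
  | .add | .sub | .mul | .div | .mod | .shr => True
  | _ => False

/-- The expression uses program variables and tame operations only. -/
def Wf : Ex → Prop
  | const _ => True
  | reg r => r < 100
  | load m e => m < 100 ∧ e.Wf
  | op o a b => o.Tame ∧ a.Wf ∧ b.Wf

section simp_lemmas
variable (s : State) (k : ℤ) (r m : ℕ) (a b e : Ex)
@[simp] theorem eval_const : (const k).eval s = k := rfl
@[simp] theorem eval_reg : (reg r).eval s = s.reg r := rfl
@[simp] theorem eval_load : (load m e).eval s = s.mem m (e.eval s) := rfl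
@[simp] theorem eval_add : (a + b).eval s = a.eval s + b.eval s := rfl
@[simp] theorem eval_sub : (a - b).eval s = a.eval s - b.eval s := rfl
@[simp] theorem eval_mul : (a * b).eval s = a.eval s * b.eval s := rfl
@[simp] theorem eval_div : (a / b).eval s = a.eval s / b.eval s := rfl
@[simp] theorem eval_mod : (a % b).eval s = a.eval s % b.eval s := rfl
@[simp] theorem eval_shr : (op .shr a b).eval s = a.eval s >>> (b.eval s).toNat := rfl
@[simp] theorem cost_const : (const k).cost = 1 := rfl
@[simp] theorem cost_reg : (reg r).cost = 2 := rfl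
@[simp] theorem cost_load : (load m e).cost = e.cost + 1 := rfl
@[simp] theorem cost_add : (a + b).cost = a.cost + b.cost + 1 := rfl
@[simp] theorem cost_sub : (a - b).cost = a.cost + b.cost + 1 := rfl
@[simp] theorem cost_mul : (a * b).cost = a.cost + b.cost + 1 := rfl
@[simp] theorem cost_div : (a / b).cost = a.cost + b.cost + 1 := rfl
@[simp] theorem cost_mod : (a % b).cost = a.cost + b.cost + 1 := rfl
@[simp] theorem cost_shr : (op .shr a b).cost = a.cost + b.cost + 1 := rfl
@[simp] theorem deg_const : (const k).deg = k.natAbs := rfl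
@[simp] theorem deg_reg : (reg r).deg = 1 := rfl
@[simp] theorem deg_load : (load m e).deg = e.deg + 1 := rfl
@[simp] theorem deg_add : (a + b).deg = a.deg + b.deg + 1 := rfl
@[simp] theorem deg_sub : (a - b).deg = a.deg + b.deg + 1 := rfl
@[simp] theorem deg_mul : (a * b).deg = a.deg + b.deg + 1 := rfl
@[simp] theorem deg_div : (a / b).deg = a.deg + b.deg + 1 := rfl
@[simp] theorem deg_mod : (a % b).deg = a.deg + b.deg + 1 := rfl
@[simp] theorem deg_shr : (op .shr a b).deg = a.deg + b.deg + 1 := rfl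
@[simp] theorem wf_const : (const k).Wf := trivial
@[simp] theorem wf_reg : (reg r).Wf ↔ r < 100 := Iff.rfl
@[simp] theorem wf_load : (load m e).Wf ↔ m < 100 ∧ e.Wf := Iff.rfl
@[simp] theorem wf_add : (a + b).Wf ↔ a.Wf ∧ b.Wf := iff_of_eq (true_and _)
@[simp] theorem wf_sub : (a - b).Wf ↔ a.Wf ∧ b.Wf := iff_of_eq (true_and _)
@[simp] theorem wf_mul : (a * b).Wf ↔ a.Wf ∧ b.Wf := iff_of_eq (true_and _)
@[simp] theorem wf_div : (a / b).Wf ↔ a.Wf ∧ b.Wf := iff_of_eq (true_and _)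
@[simp] theorem wf_mod : (a % b).Wf ↔ a.Wf ∧ b.Wf := iff_of_eq (true_and _)
@[simp] theorem wf_shr : (op .shr a b).Wf ↔ a.Wf ∧ b.Wf := iff_of_eq (true_and _)
end simp_lemmas

/-- The program that puts the value of `e` into register `d`, with scratch registers above `d`. -/
def compile : Ex → ℕ → Cmd
  | const k, d => .const d k
  -- There is no move instruction; a register is copied by adding it to zero.
  | reg r, d => .seq (.const d 0) (.op .add d d r)
  | load m e, d => .seq (e.compile d) (.load d m d)
  | op o a b, d => .seq (a.compile d) (.seq (b.compile (d + 1)) (.op o d d (d + 1)))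

end Ex

/-- Sums and differences are at most twice the product of the two bounds, and the spare factor B ≥ 2
pays for the two. Quotients, remainders and right shifts do not exceed the bounds of their operands.
-/
theorem BinOp.Tame.abs_eval_le {o : BinOp} (h : o.Tame) {x y B : ℤ} {m n : ℕ} (hB : 2 ≤ B)
    (hx : |x| ≤ B ^ m) (hy : |y| ≤ B ^ n) : |o.eval x y| ≤ B ^ (m + n + 1) := by
  have hm : 1 ≤ B ^ m := one_le_pow₀ (by omega)
  have hn : 1 ≤ B ^ n := one_le_pow₀ (by omega)
  have e : B ^ (m + n + 1) = B ^ m * B ^ n * B := by ring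
  have h1 : B ^ m ≤ B ^ m * B ^ n := by nlinarith
  have h2 : B ^ n ≤ B ^ m * B ^ n := by nlinarith
  have h3 : 2 * (B ^ m * B ^ n) ≤ B ^ (m + n + 1) := by rw [e]; nlinarith
  cases o <;> simp only [BinOp.Tame] at h <;> simp only [BinOp.eval]
  · exact (abs_add_le x y).trans (by linarith)
  · exact (abs_sub x y).trans (by linarith)
  · rw [abs_mul]
    have : |x| * |y| ≤ B ^ m * B ^ n := mul_le_mul hx hy (abs_nonneg _) (by linarith)
    linarith
  · have : |x / y| ≤ |x| := Int.abs_ediv_le_abs x y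
    linarith
  -- A remainder modulo 0 is x itself, so this case uses the bound on x and the other one the bound
  -- on y.
  · by_cases h0 : y = 0
    · subst h0; rw [Int.emod_zero]; linarith
    · have h4 := Int.emod_nonneg x h0
      have h5 := Int.emod_lt_abs x h0
      rw [abs_of_nonneg h4]; linarith
  · rw [Int.shiftRight_eq_div_pow]
    have := Int.abs_ediv_le_abs x ((2 ^ y.toNat : ℕ) : ℤ)
    push_cast at this ⊢
    linarith

/-! ### States up to scratch registers -/

/-- The bounds under which programs run: words are bounded by `W`, the registers below `100` and
the arrays below `100` hold values bounded by `B`, and expressions have degree at most `D`. -/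
structure Bounds where
  W : ℕ
  B : ℕ
  D : ℕ
  two_le : 2 ≤ B
  pow_le : B ^ D ≤ W
  forty_le : 40 ≤ D

/-- The allowance of 40 covers the fixed expressions of the algorithm, whose degree conditions are
then settled by computation. Only expressions that depend on the formula need a separate argument.
-/
theorem Bounds.le_D (M : Bounds) {n : ℕ} (h : n ≤ 40) : n ≤ M.D := h.trans M.forty_le

theorem Bounds.B_pow_le (M : Bounds) {n : ℕ} (h : n ≤ M.D) : (M.B : ℤ) ^ n ≤ M.W := by
  have := (Nat.pow_le_pow_right (by have := M.two_le; omega) h).trans M.pow_le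
  exact_mod_cast this

theorem Bounds.B_le (M : Bounds) : (M.B : ℤ) ≤ M.W := by
  simpa using M.B_pow_le (M.le_D (show 1 ≤ 40 by norm_num))

/-- The states agree on the arrays and on the registers below `100`. -/
def State.Agree (s t : State) : Prop := (∀ r < 100, s.reg r = t.reg r) ∧ s.mem = t.mem

theorem State.Agree.refl (s : State) : s.Agree s := ⟨fun _ _ => rfl, rfl⟩

def Bounds.Bdd (M : Bounds) (s : State) : Prop :=
  (∀ r < 100, |s.reg r| ≤ (M.B : ℤ)) ∧ ∀ m < 100, ∀ z, |s.mem m z| ≤ (M.B : ℤ)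

/-- A constant satisfies |k| ≤ B ^ |k|, which explains its degree; a loaded value is at most B
whatever its address is. -/
theorem Ex.abs_eval_le {M : Bounds} {s : State} (h : M.Bdd s) {e : Ex} (he : e.Wf) :
    |e.eval s| ≤ (M.B : ℤ) ^ e.deg := by
  have hB : (2 : ℤ) ≤ M.B := by exact_mod_cast M.two_le
  induction e with
  | const k =>
    simp only [Ex.eval_const, Ex.deg_const, Int.abs_eq_natAbs]
    have h1 : k.natAbs ≤ M.B ^ k.natAbs := (Nat.lt_pow_self M.two_le).le
    exact_mod_cast h1
  | reg r => simpa using h.1 r he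
  | load m e ih =>
    refine (h.2 m he.1 _).trans ?_
    simpa using pow_le_pow_right₀ (by linarith : (1 : ℤ) ≤ M.B) (Nat.le_add_left 1 e.deg)
  | op o a b iha ihb => exact he.1.abs_eval_le hB (iha he.2.1) (ihb he.2.2)

/-- The scratch registers work as a stack: the second operand is evaluated from `d + 1` on, so the
first value waits unharmed in register `d`. No variable changes meanwhile, so every subexpression
sees the same `s` up to agreement. -/
theorem Ex.exec_compile {M : Bounds} {s s₀ : State} (h : M.Bdd s) {e : Ex} (he : e.Wf)
    (hd : e.deg ≤ M.D) (d : ℕ) (h100 : 100 ≤ d) (ha : s₀.Agree s) :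
    ∃ s', Exec M.W (e.compile d) s₀ e.cost s' ∧ s'.Agree s ∧ s'.reg d = e.eval s ∧
      ∀ r < d, s'.reg r = s₀.reg r := by
  have hb : |e.eval s| ≤ (M.W : ℤ) := (Ex.abs_eval_le h he).trans (M.B_pow_le hd)
  induction e generalizing d s₀ with
  | const k =>
    refine ⟨_, Exec.const _ _ _ hb, ?_, ?_, ?_⟩
    · refine ⟨fun r hr => ?_, ha.2⟩
      simp [State.setReg, show r ≠ d by omega, ha.1 r hr]
    · simp [State.setReg]
    · intro r hr; simp [State.setReg, hr.ne]
  | reg r =>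
    simp only [wf_reg] at he
    have hv : (s₀.setReg d 0).reg r = s.reg r := by
      simp [State.setReg, show r ≠ d by omega, ha.1 r he]
    have e0 : BinOp.add.eval ((s₀.setReg d 0).reg d) ((s₀.setReg d 0).reg r) = s.reg r := by
      rw [hv]; simp [BinOp.eval, State.setReg]
    refine ⟨_, Exec.seq (Exec.const _ _ _ (by simp)) (Exec.op _ _ _ _ _ ?_), ?_, ?_, ?_⟩
    · rw [e0]; exact hb
    · refine ⟨fun r' hr => ?_, ha.2⟩
      simp [State.setReg, show r' ≠ d by omega, ha.1 r' hr]
    · rw [e0]; simp [State.setReg]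
    · intro r hr; simp [State.setReg, hr.ne]
  | load m e ih =>
    simp only [wf_load] at he
    simp only [deg_load] at hd
    obtain ⟨s', h1, h2, h3, h4⟩ := ih he.2 (by omega) d h100 ha
      ((Ex.abs_eval_le h he.2).trans (M.B_pow_le (by omega)))
    refine ⟨_, Exec.seq h1 (Exec.load _ _ _ _), ?_, ?_, ?_⟩
    · refine ⟨fun r' hr => ?_, h2.2⟩
      simp [State.setReg, show r' ≠ d by omega, h2.1 r' hr]
    · simp [State.setReg, h3, h2.2]
    · intro r hr; simp [State.setReg, hr.ne, h4 r hr]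
  | op o a b iha ihb =>
    obtain ⟨ho, hwa, hwb⟩ := he
    simp only [deg] at hd
    obtain ⟨s', h1, h2, h3, h4⟩ := iha hwa (by omega) d h100 ha
      ((Ex.abs_eval_le h hwa).trans (M.B_pow_le (by omega)))
    obtain ⟨s'', h1', h2', h3', h4'⟩ := ihb hwb (by omega) (d + 1) (by omega) h2
      ((Ex.abs_eval_le h hwb).trans (M.B_pow_le (by omega)))
    have e0 : o.eval (s''.reg d) (s''.reg (d + 1)) = (Ex.op o a b).eval s := by
      rw [h3', h4' d (by omega), h3]; rfl
    refine ⟨s''.setReg d ((Ex.op o a b).eval s), ?_, ?_, ?_, ?_⟩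
    · have := Exec.seq h1 (Exec.seq h1' (Exec.op s'' o d d (d + 1) (W := M.W) (by rw [e0]; exact hb)))
      rw [e0] at this
      simpa [cost, compile, add_assoc] using this
    · refine ⟨fun r' hr => ?_, h2'.2⟩
      simp [State.setReg, show r' ≠ d by omega, h2'.1 r' hr]
    · simp [State.setReg]
    · intro r hr; simp [State.setReg, hr.ne, h4' r (by omega), h4 r hr]

/-! ### Frames -/

/-- `c` does not write register `r`. -/
def Cmd.Keeps (r : ℕ) : Cmd → Prop
  | .skip => True
  | .const r' _ => r' ≠ r
  | .op _ r' _ _ => r' ≠ r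
  | .load r' _ _ => r' ≠ r
  | .store _ _ _ => True
  | .seq p q => p.Keeps r ∧ q.Keeps r
  | .ite _ _ p q => p.Keeps r ∧ q.Keeps r
  | .loop _ _ p => p.Keeps r

/-- `c` does not write array `m`. -/
def Cmd.KeepsMem (m : ℕ) : Cmd → Prop
  | .store m' _ _ => m' ≠ m
  | .seq p q => p.KeepsMem m ∧ q.KeepsMem m
  | .ite _ _ p q => p.KeepsMem m ∧ q.KeepsMem m
  | .loop _ _ p => p.KeepsMem m
  | _ => True

theorem Exec.reg_eq {W : ℕ} {c : Cmd} {s s' : State} {τ : ℕ} (h : Exec W c s τ s') {r : ℕ}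
    (hr : c.Keeps r) : s'.reg r = s.reg r := by
  induction h with
  | skip => rfl
  | const s r' k => exact Function.update_of_ne (Ne.symm hr) _ _
  | op s o r' a b => exact Function.update_of_ne (Ne.symm hr) _ _
  | load s r' => exact Function.update_of_ne (Ne.symm hr) _ _
  | store => rfl
  | seq _ _ ih1 ih2 => exact (ih2 hr.2).trans (ih1 hr.1)
  | ite_true _ _ ih => exact ih hr.1
  | ite_false _ _ ih => exact ih hr.2
  | loop_done => rfl
  | loop_step _ _ _ ih1 ih2 => exact (ih2 hr).trans (ih1 hr)

theorem Exec.mem_eq {W : ℕ} {c : Cmd} {s s' : State} {τ : ℕ} (h : Exec W c s τ s') {m : ℕ}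
    (hr : c.KeepsMem m) : s'.mem m = s.mem m := by
  induction h with
  | skip => rfl
  | const s r' k => rfl
  | op s o r' a b => rfl
  | load s r' => rfl
  | store s m' => exact Function.update_of_ne (Ne.symm hr) _ _
  | seq _ _ ih1 ih2 => exact (ih2 hr.2).trans (ih1 hr.1)
  | ite_true _ _ ih => exact ih hr.1
  | ite_false _ _ ih => exact ih hr.2
  | loop_done => rfl
  | loop_step _ _ _ ih1 ih2 => exact (ih2 hr).trans (ih1 hr)

/-- `t` differs from `s` only in what `c` may write. -/
structure Frame (c : Cmd) (s t : State) : Prop where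
  reg : ∀ r < 100, c.Keeps r → t.reg r = s.reg r
  mem : ∀ m, c.KeepsMem m → t.mem m = s.mem m

theorem Ex.keeps_compile (e : Ex) {d r : ℕ} (h : r < d) : (e.compile d).Keeps r := by
  induction e generalizing d with
  | const k => exact h.ne'
  | reg => exact ⟨h.ne', h.ne'⟩
  | load m e ih => exact ⟨ih h, h.ne'⟩
  | op o a b iha ihb => exact ⟨iha h, ihb (by omega), h.ne'⟩

theorem Ex.keepsMem_compile (e : Ex) {d m : ℕ} : (e.compile d).KeepsMem m := by
  induction e generalizing d with
  | const k => trivial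
  | reg => exact ⟨trivial, trivial⟩
  | load m e ih => exact ⟨ih, trivial⟩
  | op o a b iha ihb => exact ⟨iha, ihb, trivial⟩

/-! ### Programs built from expressions -/

infixr:60 " ;; " => Cmd.seq

namespace Cmd

/-- `reg r := e` -/
def assign (r : ℕ) (e : Ex) : Cmd :=
  e.compile 100 ;; const 101 0 ;; op .add r 100 101

/-- `mem m e₁ := e₂` -/
def put (m : ℕ) (e₁ e₂ : Ex) : Cmd :=
  e₁.compile 100 ;; e₂.compile 101 ;; store m 100 101

/-- if `e₁ < e₂` then `p` else `q` -/
def ifLt (e₁ e₂ : Ex) (p q : Cmd) : Cmd :=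
  e₁.compile 100 ;; e₂.compile 101 ;; ite 100 101 p q

/-- `for reg i := 0 to reg n - 1 do body` -/
def forLoop (i n : ℕ) (body : Cmd) : Cmd :=
  assign i (.const 0) ;; loop i n (body ;; assign i (.reg i + .const 1))

section keeps
variable {r m : ℕ} {i n m' : ℕ} {e e₁ e₂ : Ex} {p q : Cmd}

@[simp] theorem keeps_skip : skip.Keeps r := trivial
@[simp] theorem keepsMem_skip : skip.KeepsMem m := trivial
@[simp] theorem keeps_seq : (p ;; q).Keeps r ↔ p.Keeps r ∧ q.Keeps r := Iff.rfl
@[simp] theorem keepsMem_seq : (p ;; q).KeepsMem m ↔ p.KeepsMem m ∧ q.KeepsMem m := Iff.rfl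

@[simp] theorem keeps_assign (h : r < 100) : (assign i e).Keeps r ↔ i ≠ r :=
  ⟨fun h => h.2.2, fun h' => ⟨e.keeps_compile h, show 101 ≠ r by omega, h'⟩⟩

@[simp] theorem keepsMem_assign : (assign i e).KeepsMem m :=
  ⟨e.keepsMem_compile, trivial, trivial⟩

@[simp] theorem keeps_put (h : r < 100) : (put m' e₁ e₂).Keeps r :=
  ⟨e₁.keeps_compile h, e₂.keeps_compile (by omega), trivial⟩

@[simp] theorem keepsMem_put : (put m' e₁ e₂).KeepsMem m ↔ m' ≠ m :=
  ⟨fun h => h.2.2, fun h => ⟨e₁.keepsMem_compile, e₂.keepsMem_compile, h⟩⟩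

@[simp] theorem keeps_ifLt (h : r < 100) :
    (ifLt e₁ e₂ p q).Keeps r ↔ p.Keeps r ∧ q.Keeps r :=
  ⟨fun h => h.2.2, fun h' => ⟨e₁.keeps_compile h, e₂.keeps_compile (by omega), h'⟩⟩

@[simp] theorem keepsMem_ifLt :
    (ifLt e₁ e₂ p q).KeepsMem m ↔ p.KeepsMem m ∧ q.KeepsMem m :=
  ⟨fun h => h.2.2, fun h => ⟨e₁.keepsMem_compile, e₂.keepsMem_compile, h⟩⟩

@[simp] theorem keeps_forLoop (h : r < 100) :
    (forLoop i n p).Keeps r ↔ i ≠ r ∧ p.Keeps r := by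
  show (assign i _).Keeps r ∧ (p.Keeps r ∧ (assign i _).Keeps r) ↔ _
  rw [keeps_assign h, keeps_assign h]; tauto

@[simp] theorem keepsMem_forLoop : (forLoop i n p).KeepsMem m ↔ p.KeepsMem m := by
  show (assign i _).KeepsMem m ∧ (p.KeepsMem m ∧ (assign i _).KeepsMem m) ↔ _
  simp

end keeps

end Cmd

theorem Frame.refl (c : Cmd) (s : State) : Frame c s s := ⟨fun _ _ _ => rfl, fun _ _ => rfl⟩

theorem Frame.trans {c : Cmd} {s t u : State} (h : Frame c s t) (h' : Frame c t u) :
    Frame c s u :=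
  ⟨fun r hr hk => (h'.reg r hr hk).trans (h.reg r hr hk),
    fun m hk => (h'.mem m hk).trans (h.mem m hk)⟩

theorem Frame.mono {c c' : Cmd} {s t : State} (h : Frame c s t)
    (hr : ∀ r < 100, c'.Keeps r → c.Keeps r) (hm : ∀ m, c'.KeepsMem m → c.KeepsMem m) :
    Frame c' s t :=
  ⟨fun r h1 hk => h.reg r h1 (hr r h1 hk), fun m hk => h.mem m (hm m hk)⟩

@[simp] theorem State.reg_setReg (s : State) (r r' : ℕ) (v : ℤ) :
    (s.setReg r v).reg r' = if r' = r then v else s.reg r' := by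
  simp [State.setReg, Function.update_apply]

@[simp] theorem State.mem_setReg (s : State) (r : ℕ) (v : ℤ) : (s.setReg r v).mem = s.mem := rfl

@[simp] theorem State.reg_setMem (s : State) (m : ℕ) (z v : ℤ) :
    (s.setMem m z v).reg = s.reg := rfl

@[simp] theorem State.mem_setMem (s : State) (m m' : ℕ) (z v z' : ℤ) :
    (s.setMem m z v).mem m' z' = if m' = m ∧ z' = z then v else s.mem m' z' := by
  by_cases h : m' = m
  · subst h; simp [State.setMem, Function.update_apply]
  · simp [State.setMem, h]

theorem State.setReg_agree {s t : State} (h : s.Agree t) (r : ℕ) (v : ℤ) :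
    (s.setReg r v).Agree (t.setReg r v) :=
  ⟨fun r' hr => by simp only [State.reg_setReg, h.1 r' hr], h.2⟩

/-! ### Weakest preconditions with time -/

/-- Started at time `τ` in the state `s`, the program `c` ends at a time and in a state that
satisfy `Q`, keeping the bounds of `M` and the frame of `c`. Scratch registers are ignored. -/
def wp (M : Bounds) (c : Cmd) (τ : ℕ) (s : State) (Q : ℕ → State → Prop) : Prop :=
  M.Bdd s → ∀ s₀ : State, s₀.Agree s → ∃ τ' s' t, Exec M.W c s₀ τ' s' ∧ s'.Agree t ∧ M.Bdd t ∧
    Frame c s t ∧ Q (τ + τ') t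

variable {M : Bounds} {c p q body : Cmd} {τ : ℕ} {s : State} {Q R : ℕ → State → Prop}

/-- Boundedness of the start is a premise inside `wp`, so it may be used while proving the triple.
-/
theorem wp_bdd (h : M.Bdd s → wp M c τ s Q) : wp M c τ s Q := fun hb => h hb hb

theorem wp_mono (h : wp M c τ s R)
    (hQ : ∀ τ' t, M.Bdd t → Frame c s t → R τ' t → Q τ' t) : wp M c τ s Q := by
  intro hb s₀ ha
  obtain ⟨τ', s', t, h1, h2, h3, h4, h5⟩ := h hb s₀ ha
  exact ⟨τ', s', t, h1, h2, h3, h4, hQ _ _ h3 h4 h5⟩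

theorem wp_seq (h : wp M p τ s fun τ' t => wp M q τ' t Q) : wp M (p ;; q) τ s Q := by
  intro hb s₀ ha
  obtain ⟨τ', s', t, h1, h2, h3, h4, h5⟩ := h hb s₀ ha
  obtain ⟨τ'', s'', t', h1', h2', h3', h4', h5'⟩ := h5 h3 s' h2
  refine ⟨_, s'', t', Exec.seq h1 h1', h2', h3', ?_, by rwa [← add_assoc]⟩
  exact (h4.mono (fun r _ h => (Cmd.keeps_seq.1 h).1) fun m h => (Cmd.keepsMem_seq.1 h).1).trans
    (h4'.mono (fun r _ h => (Cmd.keeps_seq.1 h).2) fun m h => (Cmd.keepsMem_seq.1 h).2)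

theorem wp_seq_of (h : wp M p τ s R)
    (hq : ∀ τ' t, M.Bdd t → Frame p s t → R τ' t → wp M q τ' t Q) : wp M (p ;; q) τ s Q :=
  wp_seq (wp_mono h hq)

theorem wp_skip (h : Q (τ + 1) s) : wp M .skip τ s Q :=
  fun hb s₀ ha => ⟨1, s₀, s, .skip _, ha, hb, Frame.refl _ _, h⟩

/-- Only the stored value has to respect `B`. The intermediate values merely have to be words, and
the degree takes care of that. -/
theorem wp_assign {r : ℕ} {e : Ex} (he : e.Wf := by simp)
    (hd : e.deg ≤ M.D := by exact M.le_D (by simp)) (hv : M.Bdd s → |e.eval s| ≤ (M.B : ℤ))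
    (h : Q (τ + (e.cost + 2)) (s.setReg r (e.eval s))) : wp M (.assign r e) τ s Q := by
  intro hb s₀ ha
  obtain ⟨s', h1, h2, h3, h4⟩ := Ex.exec_compile hb he hd 100 le_rfl ha
  have e0 : BinOp.add.eval ((s'.setReg 101 0).reg 100) ((s'.setReg 101 0).reg 101) = e.eval s := by
    simp [BinOp.eval, h3]
  have hx : Exec M.W (.assign r e) s₀ (e.cost + 2) ((s'.setReg 101 0).setReg r (e.eval s)) := by
    have := Exec.seq h1 (Exec.seq (Exec.const s' 101 0 (by simp))
      (Exec.op _ .add r 100 101 (by rw [e0]; exact (hv hb).trans M.B_le)))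
    rwa [e0] at this
  refine ⟨_, _, _, hx, ?_, ?_, ?_, h⟩
  · apply State.setReg_agree
    refine ⟨fun r hr => ?_, h2.2⟩
    rw [State.reg_setReg, if_neg (by omega), h2.1 r hr]
  · refine ⟨fun r' hr' => ?_, hb.2⟩
    rw [State.reg_setReg]; split_ifs
    · exact hv hb
    · exact hb.1 r' hr'
  · refine ⟨fun r' hr' hk => ?_, fun _ _ => rfl⟩
    rw [Cmd.keeps_assign hr'] at hk
    rw [State.reg_setReg, if_neg (Ne.symm hk)]

/-- Arrays from number 100 on belong to the subroutine and are exempt from the bound `B`, so values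
written there need no separate bound. -/
theorem wp_put {m : ℕ} {e₁ e₂ : Ex} (he₁ : e₁.Wf := by simp) (he₂ : e₂.Wf := by simp)
    (hd₁ : e₁.deg ≤ M.D := by exact M.le_D (by simp))
    (hd₂ : e₂.deg ≤ M.D := by exact M.le_D (by simp))
    (hv : M.Bdd s → m < 100 → |e₂.eval s| ≤ (M.B : ℤ))
    (h : Q (τ + (e₁.cost + e₂.cost + 1)) (s.setMem m (e₁.eval s) (e₂.eval s))) :
    wp M (.put m e₁ e₂) τ s Q := by
  intro hb s₀ ha
  obtain ⟨s', h1, h2, h3, h4⟩ := Ex.exec_compile hb he₁ hd₁ 100 le_rfl ha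
  obtain ⟨s'', h1', h2', h3', h4'⟩ := Ex.exec_compile hb he₂ hd₂ 101 (by norm_num) h2
  have hx : Exec M.W (.put m e₁ e₂) s₀ (e₁.cost + e₂.cost + 1)
      (s''.setMem m (e₁.eval s) (e₂.eval s)) := by
    have := Exec.seq h1 (Exec.seq h1' (Exec.store s'' m 100 101))
    rwa [h3', h4' 100 (by norm_num), h3, ← add_assoc] at this
  refine ⟨_, _, _, hx, ?_, ?_, ?_, h⟩
  · refine ⟨fun r hr => h2'.1 r hr, ?_⟩
    funext m' z
    simp only [State.mem_setMem, h2'.2]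
  · refine ⟨hb.1, fun m' hm z => ?_⟩
    rw [State.mem_setMem]; split_ifs with h
    · exact hv hb (h.1 ▸ hm)
    · exact hb.2 m' hm z
  · refine ⟨fun _ _ _ => rfl, fun m' hk => ?_⟩
    rw [Cmd.keepsMem_put] at hk
    funext z
    rw [State.mem_setMem, if_neg (fun h => hk h.1.symm)]

theorem wp_ifLt {e₁ e₂ : Ex} (he₁ : e₁.Wf := by simp) (he₂ : e₂.Wf := by simp)
    (hd₁ : e₁.deg ≤ M.D := by exact M.le_D (by simp))
    (hd₂ : e₂.deg ≤ M.D := by exact M.le_D (by simp))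
    (hp : e₁.eval s < e₂.eval s → wp M p (τ + (e₁.cost + e₂.cost + 1)) s Q)
    (hq : ¬ e₁.eval s < e₂.eval s → wp M q (τ + (e₁.cost + e₂.cost + 1)) s Q) :
    wp M (.ifLt e₁ e₂ p q) τ s Q := by
  intro hb s₀ ha
  obtain ⟨s', h1, h2, h3, h4⟩ := Ex.exec_compile hb he₁ hd₁ 100 le_rfl ha
  obtain ⟨s'', h1', h2', h3', h4'⟩ := Ex.exec_compile hb he₂ hd₂ 101 (by norm_num) h2
  have e1 : s''.reg 100 = e₁.eval s := by rw [h4' 100 (by norm_num), h3]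
  by_cases hc : e₁.eval s < e₂.eval s
  · obtain ⟨τ', s', t, g1, g2, g3, g4, g5⟩ := hp hc hb s'' h2'
    refine ⟨_, s', t, Exec.seq h1 (Exec.seq h1' (Exec.ite_true (by rw [e1, h3']; exact hc) g1)),
      g2, g3, ?_, ?_⟩
    · exact g4.mono (fun r hr h => ((Cmd.keeps_ifLt hr).1 h).1)
        fun r h => (Cmd.keepsMem_ifLt.1 h).1
    · convert g5 using 1; omega
  · obtain ⟨τ', s', t, g1, g2, g3, g4, g5⟩ := hq hc hb s'' h2'
    refine ⟨_, s', t, Exec.seq h1 (Exec.seq h1' (Exec.ite_false (by rw [e1, h3']; exact hc) g1)),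
      g2, g3, ?_, ?_⟩
    · exact g4.mono (fun r hr h => ((Cmd.keeps_ifLt hr).1 h).2)
        fun r h => (Cmd.keepsMem_ifLt.1 h).2
    · convert g5 using 1; omega

theorem wp_loop_done {i n : ℕ} (hi : i < 100) (hn : n < 100) (h : ¬ s.reg i < s.reg n)
    (hQ : Q (τ + 1) s) : wp M (.loop i n body) τ s Q := by
  intro hb s₀ ha
  exact ⟨1, s₀, s, .loop_done (by rwa [ha.1 i hi, ha.1 n hn]), ha, hb, Frame.refl _ _, hQ⟩

theorem wp_loop_step {i n : ℕ} (hi : i < 100) (hn : n < 100) (h : s.reg i < s.reg n)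
    (hQ : wp M body (τ + 1) s fun τ' t => wp M (.loop i n body) τ' t Q) :
    wp M (.loop i n body) τ s Q := by
  intro hb s₀ ha
  obtain ⟨τ', s', t, h1, h2, h3, h4, h5⟩ := hQ hb s₀ ha
  obtain ⟨τ'', s'', t', h1', h2', h3', h4', h5'⟩ := h5 h3 s' h2
  refine ⟨_, s'', t', Exec.loop_step (by rwa [ha.1 i hi, ha.1 n hn]) h1 h1', h2', h3',
    Frame.trans (c := .loop i n body) (h4.mono (fun _ _ h => h) fun _ h => h) h4', ?_⟩
  convert h5' using 1; omega

/-- The rule for `for` loops: the invariant `I j τ t` holds at time `τ` and in the state `t` before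
round number `j`. -/
theorem wp_forLoop {i n : ℕ} (N : ℕ) (I : ℕ → ℕ → State → Prop) (hi : i < 100 := by norm_num)
    (hn : n < 100 := by norm_num) (hin : i ≠ n := by norm_num) (hki : body.Keeps i := by simp)
    (hkn : body.Keeps n := by simp) (hN : s.reg n = N)
    (h0 : I 0 (τ + 3) (s.setReg i 0))
    (hstep : ∀ j < N, ∀ τ' t, M.Bdd t → Frame (.forLoop i n body) s t → t.reg i = j →
      I j τ' t → wp M body (τ' + 1) t fun τ'' u => I (j + 1) (τ'' + 6) (u.setReg i (j + 1)))
    (hQ : ∀ τ' t, M.Bdd t → Frame (.forLoop i n body) s t → t.reg i = N → I N τ' t →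
      Q (τ' + 1) t) : wp M (.forLoop i n body) τ s Q := by
  apply wp_bdd; intro hbd
  -- The counter never exceeds the content of register `n`, which is bounded; so incrementing it is
  -- safe.
  have hNB : (N : ℤ) ≤ M.B := by have := hbd.1 n hn; rw [hN] at this; exact le_of_abs_le this
  apply wp_seq
  -- Initialisation costs 3 steps, each test 1 and each increment 6; these are the offsets in the
  -- hypotheses of the rule.
  refine wp_assign (by simp) (M.le_D (by simp)) (fun _ => by simp) ?_
  simp only [Ex.eval_const, Ex.cost_const]
  have hF0 : Frame (.forLoop i n body) s (s.setReg i 0) := by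
    refine ⟨fun r hr hk => ?_, fun _ _ => rfl⟩
    rw [Cmd.keeps_forLoop hr] at hk
    rw [State.reg_setReg, if_neg (Ne.symm hk.1)]
  -- Induction on the number k of rounds that remain.
  suffices H : ∀ k j : ℕ, j + k = N → ∀ τ' t, Frame (.forLoop i n body) s t → t.reg i = j →
      I j τ' t → wp M (.loop i n (body ;; .assign i (.reg i + .const 1))) τ' t Q from
    H N 0 (by omega) _ _ hF0 (by simp) h0
  intro k
  induction k with
  | zero =>
    intro j hj τ' t hF htj hI
    apply wp_bdd; intro hb
    have htn : t.reg n = N := by rw [hF.reg n hn ((Cmd.keeps_forLoop hn).2 ⟨hin, hkn⟩), hN]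
    have : j = N := by omega
    subst this
    exact wp_loop_done hi hn (by rw [htj, htn]; omega) (hQ _ _ hb hF htj hI)
  | succ k ih =>
    intro j hj τ' t hF htj hI
    apply wp_bdd; intro hb
    have htn : t.reg n = N := by rw [hF.reg n hn ((Cmd.keeps_forLoop hn).2 ⟨hin, hkn⟩), hN]
    refine wp_loop_step hi hn (by rw [htj, htn]; omega) (wp_seq ?_)
    refine wp_mono (hstep j (by omega) τ' t hb hF htj hI) fun τ'' u hbu hFu hIu => ?_
    have hui : u.reg i = j := by rw [hFu.reg i hi hki, htj]
    have hF1 : Frame (.forLoop i n body) s u := hF.trans (hFu.mono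
      (fun r hr h => ((Cmd.keeps_forLoop hr).1 h).2) fun m h => Cmd.keepsMem_forLoop.1 h)
    refine wp_assign (by simpa using hi) (M.le_D (by simp)) (fun _ => ?_) ?_
    · simp only [Ex.eval_add, Ex.eval_reg, hui, Ex.eval_const]
      rw [abs_of_nonneg (by omega)]; omega
    · simp only [Ex.eval_add, Ex.eval_reg, hui, Ex.eval_const, Ex.cost_add, Ex.cost_reg,
        Ex.cost_const]
      refine ih (j + 1) (by omega) _ _ (hF1.trans ?_) (by simp) hIu
      refine ⟨fun r hr hk => ?_, fun _ _ => rfl⟩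
      rw [Cmd.keeps_forLoop hr] at hk
      rw [State.reg_setReg, if_neg (Ne.symm hk.1)]

/-- The rule for `for` loops with a uniform bound `b` on the time of a round. -/
theorem wp_forLoop_uniform {i n : ℕ} (N b : ℕ) (I : ℕ → State → Prop)
    (hi : i < 100 := by norm_num)
    (hn : n < 100 := by norm_num) (hin : i ≠ n := by norm_num) (hki : body.Keeps i := by simp)
    (hkn : body.Keeps n := by simp) (hN : s.reg n = N)
    (h0 : I 0 (s.setReg i 0))
    (hstep : ∀ j < N, ∀ τ' t, M.Bdd t → Frame (.forLoop i n body) s t → t.reg i = j →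
      I j t → wp M body τ' t fun τ'' u => τ'' ≤ τ' + b ∧ I (j + 1) (u.setReg i (j + 1)))
    (hQ : ∀ τ' t, M.Bdd t → Frame (.forLoop i n body) s t → τ' ≤ τ + (N * (b + 7) + 4) →
      I N t → Q τ' t) :
    wp M (.forLoop i n body) τ s Q := by
  refine wp_forLoop N (fun j τ' t => τ' ≤ τ + 3 + j * (b + 7) ∧ I j t) hi hn hin hki hkn hN
    ⟨by omega, h0⟩ (fun j hj τ' t hb hF ht hI => ?_)
    (fun τ' t hb hF ht hI => hQ _ _ hb hF (by omega) hI.2)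
  refine wp_mono (hstep j hj _ t hb hF ht hI.2) fun τ'' u _ _ h => ⟨?_, h.2⟩
  have := h.1; have := hI.1
  rw [add_mul]; omega

end WordRAM

namespace WordRAM

/-! ### Running a program as a subroutine on fresh memory -/

namespace Cmd

/-- All registers that the program mentions are below `regBound`. -/
def regBound : Cmd → ℕ
  | skip => 0
  | const r _ => r + 1
  | op _ r a b => max (r + 1) (max (a + 1) (b + 1))
  | load r _ a => max (r + 1) (a + 1)
  | store _ a b => max (a + 1) (b + 1)
  | seq p q => max p.regBound q.regBound
  | ite a b p q => max (max (a + 1) (b + 1)) (max p.regBound q.regBound)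
  | loop a b p => max (max (a + 1) (b + 1)) p.regBound

/-- The program with registers moved up by `110`, arrays moved up by `100`, and cell number `z`
moved to `z * reg γ + reg κ`. -/
def relocate (γ κ : ℕ) : Cmd → Cmd
  | skip => skip
  | const r k => const (110 + r) k
  | op o r a b => op o (110 + r) (110 + a) (110 + b)
  | load r m a => op .mul 100 (110 + a) γ ;; op .add 100 100 κ ;; load (110 + r) (100 + m) 100
  | store m a b => op .mul 100 (110 + a) γ ;; op .add 100 100 κ ;; store (100 + m) 100 (110 + b)
  | seq p q => p.relocate γ κ ;; q.relocate γ κ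
  | ite a b p q => ite (110 + a) (110 + b) (p.relocate γ κ) (q.relocate γ κ)
  | loop a b p => loop (110 + a) (110 + b) (p.relocate γ κ)

theorem keeps_relocate (γ κ : ℕ) (p : Cmd) {r : ℕ} (h : r < 100) : (p.relocate γ κ).Keeps r := by
  induction p <;> simp_all [relocate, Keeps] <;> omega

theorem keepsMem_relocate (γ κ : ℕ) (p : Cmd) {m : ℕ} (h : m < 100) :
    (p.relocate γ κ).KeepsMem m := by
  induction p <;> simp_all [relocate, KeepsMem] ; omega

/-- Set the registers `110, …, 110 + n - 1` to `0`. -/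
def clear : ℕ → Cmd
  | 0 => skip
  | n + 1 => clear n ;; const (110 + n) 0

/-- Run `p` with register `v` as the contents of its register `0`, and its cell `z` being
`z * reg γ + reg κ`. The contents of its register `0` at the end go to `r`. -/
def call (γ κ : ℕ) (p : Cmd) (v r : ℕ) : Cmd :=
  clear (p.regBound + 1) ;; const 100 0 ;; op .add 110 v 100 ;; p.relocate γ κ ;; const 100 0 ;;
    op .add r 110 100

theorem keeps_clear (n : ℕ) {r : ℕ} (h : r < 100) : (clear n).Keeps r := by
  induction n with
  | zero => trivial
  | succ n ih => exact ⟨ih, show 110 + n ≠ r by omega⟩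

theorem keepsMem_clear (n : ℕ) {m : ℕ} : (clear n).KeepsMem m := by
  induction n with
  | zero => trivial
  | succ n ih => exact ⟨ih, trivial⟩

@[simp] theorem keeps_call {γ κ : ℕ} {p : Cmd} {v r r' : ℕ} (h : r' < 100) :
    (call γ κ p v r).Keeps r' ↔ r ≠ r' :=
  ⟨fun h => h.2.2.2.2.2, fun h' => ⟨keeps_clear _ h, show 100 ≠ r' by omega,
    show 110 ≠ r' by omega, keeps_relocate _ _ _ h, show 100 ≠ r' by omega, h'⟩⟩

theorem keepsMem_call {γ κ : ℕ} {p : Cmd} {v r m : ℕ} (h : m < 100) :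
    (call γ κ p v r).KeepsMem m :=
  ⟨keepsMem_clear _, trivial, trivial, keepsMem_relocate _ _ _ h, trivial, trivial⟩

end Cmd

/-- An earlier call leaves values in the registers of the subroutine, which are few and can be
reset. Its arrays are not reset; each call moves to another residue class instead. -/
theorem exec_clear (W n : ℕ) (s : State) : ∃ s', Exec W (.clear n) s (n + 1) s' ∧
    s'.mem = s.mem ∧ (∀ r < n, s'.reg (110 + r) = 0) ∧ ∀ r < 110, s'.reg r = s.reg r := by
  induction n with
  | zero => exact ⟨s, .skip _, rfl, by simp, fun _ _ => rfl⟩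
  | succ n ih =>
    obtain ⟨s', h1, h2, h3, h4⟩ := ih
    refine ⟨_, Exec.seq h1 (Exec.const _ _ _ (by simp)), h2, fun r hr => ?_, fun r hr => ?_⟩
    · rw [State.reg_setReg]; split_ifs with h
      · rfl
      · exact h3 r (by omega)
    · rw [State.reg_setReg, if_neg (by omega), h4 r hr]

/-- All values in the state are at most `V` in absolute value. -/
structure State.LeAbs (V : ℤ) (s : State) : Prop where
  reg : ∀ r, |s.reg r| ≤ V
  mem : ∀ m z, |s.mem m z| ≤ V

theorem State.LeAbs.setReg {V : ℤ} {s : State} (h : s.LeAbs V) {r : ℕ} {v : ℤ} (hv : |v| ≤ V) :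
    (s.setReg r v).LeAbs V :=
  ⟨fun r' => by rw [State.reg_setReg]; split_ifs; exacts [hv, h.reg r'], h.mem⟩

theorem State.LeAbs.setMem {V : ℤ} {s : State} (h : s.LeAbs V) {m : ℕ} {z v : ℤ} (hv : |v| ≤ V) :
    (s.setMem m z v).LeAbs V :=
  ⟨h.reg, fun m' z' => by rw [State.mem_setMem]; split_ifs; exacts [hv, h.mem m' z']⟩

/-- The state `s` contains the state `σ`, relocated. -/
structure Contains (γ κ R : ℕ) (s σ : State) : Prop where
  reg : ∀ r < R, s.reg (110 + r) = σ.reg r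
  mem : ∀ m z, s.mem (100 + m) (z * s.reg γ + s.reg κ) = σ.mem m z

/-- `t` differs from `s` only in scratch registers and in relocated memory. -/
structure OutsideEq (γ κ : ℕ) (s t : State) : Prop where
  reg : ∀ r < 100, t.reg r = s.reg r
  mem : ∀ m < 100, t.mem m = s.mem m
  cell : ∀ m z, z % s.reg γ ≠ s.reg κ → t.mem m z = s.mem m z

theorem OutsideEq.trans {γ κ : ℕ} (hγ : γ < 100) (hκ : κ < 100) {s t u : State}
    (h : OutsideEq γ κ s t) (h' : OutsideEq γ κ t u) : OutsideEq γ κ s u :=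
  ⟨fun r hr => (h'.reg r hr).trans (h.reg r hr), fun m hm => (h'.mem m hm).trans (h.mem m hm),
    fun m z hz => (h'.cell m z (by rwa [h.reg γ hγ, h.reg κ hκ])).trans (h.cell m z hz)⟩

theorem OutsideEq.setReg {γ κ : ℕ} (s : State) {r : ℕ} (hr : 100 ≤ r) (v : ℤ) :
    OutsideEq γ κ s (s.setReg r v) :=
  ⟨fun r' h => by rw [State.reg_setReg, if_neg (by omega)], fun _ _ => rfl, fun _ _ _ => rfl⟩

theorem Contains.setReg {γ κ R : ℕ} (hγ : γ < 100) (hκ : κ < 100) {s σ : State}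
    (h : Contains γ κ R s σ) (r : ℕ) (v : ℤ) :
    Contains γ κ R (s.setReg (110 + r) v) (σ.setReg r v) := by
  refine ⟨fun r' hr' => ?_, fun m z => ?_⟩
  · simp only [State.reg_setReg, h.reg r' hr', Nat.add_left_cancel_iff]
  · rw [State.reg_setReg, State.reg_setReg, if_neg (by omega), if_neg (by omega)]
    exact h.mem m z

theorem Contains.setReg_scratch {γ κ R : ℕ} (hγ : γ < 100) (hκ : κ < 100) {s σ : State}
    (h : Contains γ κ R s σ) {r : ℕ} (hr : 100 ≤ r) (hr' : r < 110) (v : ℤ) :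
    Contains γ κ R (s.setReg r v) σ := by
  refine ⟨fun r' h' => ?_, fun m z => ?_⟩
  · rw [State.reg_setReg, if_neg (by omega), h.reg r' h']
  · rw [State.reg_setReg, State.reg_setReg, if_neg (by omega), if_neg (by omega)]
    exact h.mem m z

/-- The address is built in the scratch register 100, which is invisible to the relocated program
because its registers start at 110. The hypothesis on `W` is the size of an address z * γ + κ with
|z| ≤ V. -/
theorem exec_address {W γ κ R a : ℕ} {V : ℤ} (hκ : κ < 100) {s σ : State}
    (h : Contains γ κ R s σ) (ha : a < R) (hV : σ.LeAbs V) (h0 : 0 ≤ s.reg κ)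
    (hκγ : s.reg κ < s.reg γ) (hW : V * s.reg γ + s.reg γ ≤ W) {p : Cmd} {τ : ℕ} {s' : State}
    (hp : Exec W p ((s.setReg 100 (σ.reg a * s.reg γ)).setReg 100 (σ.reg a * s.reg γ + s.reg κ))
      τ s') :
    Exec W (.op .mul 100 (110 + a) γ ;; .op .add 100 100 κ ;; p) s (τ + 2) s' := by
  have hg : |s.reg γ| = s.reg γ := abs_of_nonneg (by omega)
  have h1 : |σ.reg a * s.reg γ| ≤ V * s.reg γ := by
    rw [abs_mul, hg]; exact mul_le_mul_of_nonneg_right (hV.reg a) (by omega)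
  have e1 : BinOp.mul.eval (s.reg (110 + a)) (s.reg γ) = σ.reg a * s.reg γ := by
    rw [h.reg a ha]; rfl
  set s1 := s.setReg 100 (σ.reg a * s.reg γ) with hs1
  have e2 : BinOp.add.eval (s1.reg 100) (s1.reg κ) = σ.reg a * s.reg γ + s.reg κ := by
    simp [hs1, BinOp.eval, show κ ≠ 100 by omega]
  have x1 : Exec W (.op .mul 100 (110 + a) γ) s 1 s1 := by
    have := Exec.op (W := W) s .mul 100 (110 + a) γ (by rw [e1]; omega)
    rwa [e1] at this
  have x2 : Exec W (.op .add 100 100 κ) s1 1 (s1.setReg 100 (σ.reg a * s.reg γ + s.reg κ)) := by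
    have := Exec.op (W := W) s1 .add 100 100 κ (by
      rw [e2]
      refine (abs_add_le _ _).trans ?_
      rw [abs_of_nonneg h0]; omega)
    rwa [e2] at this
  have := Exec.seq x1 (Exec.seq x2 hp)
  rwa [show 1 + (1 + τ) = τ + 2 by omega] at this

/-- A simulation, by induction on the execution. The map z ↦ z * g + k is injective with values in
the residue class of k modulo g, so a store changes exactly the simulated cell and nothing outside
the class. A load or a store takes three steps instead of one. All values of the source program stay
below V, which keeps the addresses within the word range. -/
theorem exec_relocate {W W' γ κ R : ℕ} {V g k : ℤ} (hγ : γ < 100) (hκ : κ < 100)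
    (hWV : (W' : ℤ) ≤ V) (h0 : 0 ≤ k) (hkg : k < g) (hW : V * g + g ≤ W)
    {p : Cmd} {σ σ' : State} {τ : ℕ} (hx : Exec W' p σ τ σ') (hR : p.regBound ≤ R)
    {s : State} (hg : s.reg γ = g) (hk : s.reg κ = k) (hs : Contains γ κ R s σ)
    (hV : σ.LeAbs V) :
    ∃ τ' ≤ 3 * τ, ∃ s', Exec W (p.relocate γ κ) s τ' s' ∧ Contains γ κ R s' σ' ∧ σ'.LeAbs V ∧
      OutsideEq γ κ s s' := by
  have hVW : V ≤ W := by nlinarith [(abs_nonneg _).trans (hV.reg 0)]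
  induction hx generalizing s with
  | skip σ =>
    exact ⟨1, by omega, s, .skip _, hs, hV, fun _ _ => rfl, fun _ _ => rfl, fun _ _ _ => rfl⟩
  | const σ r v h =>
    exact ⟨1, by omega, _, .const _ _ _ (h.trans (by omega)), hs.setReg hγ hκ r v,
      hV.setReg (h.trans hWV), .setReg s (by omega) v⟩
  | op σ o r a b h =>
    simp only [Cmd.regBound, max_le_iff] at hR
    have e : o.eval (s.reg (110 + a)) (s.reg (110 + b)) = o.eval (σ.reg a) (σ.reg b) := by
      rw [hs.reg a (by omega), hs.reg b (by omega)]
    have x := Exec.op (W := W) s o (110 + r) (110 + a) (110 + b) (by rw [e]; omega)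
    rw [e] at x
    exact ⟨1, by omega, _, x, hs.setReg hγ hκ r _, hV.setReg (h.trans hWV),
      .setReg s (by omega) _⟩
  | load σ r m a =>
    simp only [Cmd.regBound, max_le_iff] at hR
    have hv : s.mem (100 + m) (σ.reg a * g + k) = σ.mem m (σ.reg a) := by
      rw [← hg, ← hk]; exact hs.mem m _
    have x := exec_address hκ hs (show a < R by omega) hV (by omega) (by omega)
      (by rw [hg]; exact hW) (Exec.load (W := W) _ (110 + r) (100 + m) 100)
    simp only [State.reg_setReg, State.mem_setReg, if_true, hg, hk, hv] at x
    refine ⟨_, by omega, _, x, ?_, hV.setReg (hV.mem m _), ?_⟩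
    · exact ((hs.setReg_scratch hγ hκ le_rfl (by omega) _).setReg_scratch hγ hκ le_rfl (by omega)
        _).setReg hγ hκ r _
    · exact ((OutsideEq.setReg s le_rfl _).trans hγ hκ (.setReg _ le_rfl _)).trans hγ hκ
        (.setReg _ (by omega) _)
  | store σ m a b =>
    simp only [Cmd.regBound, max_le_iff] at hR
    have x := exec_address hκ hs (show a < R by omega) hV (by omega) (by omega)
      (by rw [hg]; exact hW) (Exec.store (W := W) _ (100 + m) 100 (110 + b))
    simp only [State.reg_setReg, if_true, hg, hk] at x
    rw [if_neg (by omega), if_neg (by omega), hs.reg b (by omega)] at x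
    refine ⟨_, by omega, _, x, ⟨?_, ?_⟩, hV.setMem (hV.reg b), ⟨?_, ?_, ?_⟩⟩
    · intro r hr
      simp [show 110 + r ≠ 100 by omega, hs.reg r hr]
    · intro m' z
      have := hs.mem m' z
      rw [hg, hk] at this
      have hz : z * g + k = σ.reg a * g + k ↔ z = σ.reg a :=
        ⟨fun h => mul_right_cancel₀ (show g ≠ 0 by omega) (by linarith), fun h => by rw [h]⟩
      simp [show γ ≠ 100 by omega, show κ ≠ 100 by omega, hg, hk, hz, this]
    · intro r hr
      simp [show r ≠ 100 by omega]
    · intro m' hm'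
      funext z
      simp only [State.mem_setMem, State.mem_setReg]
      rw [if_neg (by omega)]
    · intro m' z hz
      simp only [State.mem_setMem, State.mem_setReg]
      rw [if_neg]
      rintro ⟨-, rfl⟩
      rw [hg, hk, add_comm, Int.add_mul_emod_self_right, Int.emod_eq_of_lt h0 hkg] at hz
      exact hz rfl
  | seq _ _ ih1 ih2 =>
    simp only [Cmd.regBound, max_le_iff] at hR
    obtain ⟨τ1, hτ1, s1, x1, c1, v1, o1⟩ := ih1 hR.1 hg hk hs hV
    obtain ⟨τ2, hτ2, s2, x2, c2, v2, o2⟩ := ih2 hR.2 (by rw [o1.reg γ hγ, hg])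
      (by rw [o1.reg κ hκ, hk]) c1 v1
    exact ⟨_, by omega, s2, Exec.seq x1 x2, c2, v2, o1.trans hγ hκ o2⟩
  | ite_true h _ ih =>
    simp only [Cmd.regBound, max_le_iff] at hR
    obtain ⟨τ1, hτ1, s1, x1, c1, v1, o1⟩ := ih hR.2.1 hg hk hs hV
    exact ⟨_, by omega, s1, Exec.ite_true
      (by rwa [hs.reg _ (by omega), hs.reg _ (by omega)]) x1, c1, v1, o1⟩
  | ite_false h _ ih =>
    simp only [Cmd.regBound, max_le_iff] at hR
    obtain ⟨τ1, hτ1, s1, x1, c1, v1, o1⟩ := ih hR.2.2 hg hk hs hV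
    exact ⟨_, by omega, s1, Exec.ite_false
      (by rwa [hs.reg _ (by omega), hs.reg _ (by omega)]) x1, c1, v1, o1⟩
  | loop_done h =>
    simp only [Cmd.regBound, max_le_iff] at hR
    exact ⟨1, by omega, s, .loop_done (by rwa [hs.reg _ (by omega), hs.reg _ (by omega)]), hs, hV,
      fun _ _ => rfl, fun _ _ => rfl, fun _ _ _ => rfl⟩
  | loop_step h _ _ ih1 ih2 =>
    have hR' := hR
    simp only [Cmd.regBound, max_le_iff] at hR
    obtain ⟨τ1, hτ1, s1, x1, c1, v1, o1⟩ := ih1 hR.2 hg hk hs hV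
    obtain ⟨τ2, hτ2, s2, x2, c2, v2, o2⟩ := ih2 hR' (by rw [o1.reg γ hγ, hg])
      (by rw [o1.reg κ hκ, hk]) c1 v1
    exact ⟨_, by omega, s2, Exec.loop_step
      (by rwa [hs.reg _ (by omega), hs.reg _ (by omega)]) x1 x2, c2, v2, o1.trans hγ hκ o2⟩

/-- The rule for subroutine calls. -/
theorem wp_call {M : Bounds} {W' γ κ v r n : ℕ} {V g k : ℤ} (hγ : γ < 100) (hκ : κ < 100)
    (hv100 : v < 100)
    (hWV : (W' : ℤ) ≤ V) (hVB : V ≤ M.B) (h0 : 0 ≤ k) (hkg : k < g) (hW : V * g + g ≤ M.W)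
    {p : Cmd} {arrays : List (List ℤ)} {σ' : State} {τ₀ : ℕ}
    (hx : Exec W' p (inputState [n] arrays) τ₀ σ')
    {s : State} (hg : s.reg γ = g) (hk : s.reg κ = k) (hn : s.reg v = n) (hnV : (n : ℤ) ≤ V)
    (hmem : ∀ m z, s.mem (100 + m) (z * g + k) = arrayOf (arrays.getD m []) z)
    (hV : ∀ l ∈ arrays, ∀ x ∈ l, |x| ≤ V) {τ : ℕ} {Q : ℕ → State → Prop}
    (hQ : ∀ τ' ≤ τ + (3 * τ₀ + p.regBound + 6), ∀ t : State, t.reg r = σ'.reg 0 →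
      (∀ m z, z % g ≠ k → t.mem m z = s.mem m z) → Frame (.call γ κ p v r) s t → Q τ' t) :
    wp M (.call γ κ p v r) τ s Q := by
  intro hb s₀ ha
  have hVn : 0 ≤ V := by omega
  have hVW : V ≤ M.W := hVB.trans M.B_le
  -- One register more than the bound, so that register 0, which carries the input length and the
  -- answer, is covered even if `p` mentions no register.
  obtain ⟨s1, x1, m1, z1, r1⟩ := exec_clear M.W (p.regBound + 1) s₀
  set s2 := (s1.setReg 100 0).setReg 110 n with hs2
  have e1 : BinOp.add.eval ((s1.setReg 100 0).reg v) ((s1.setReg 100 0).reg 100) = n := by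
    simp [BinOp.eval, show v ≠ 100 by omega, r1 v (by omega), ha.1 v hv100, hn]
  have x2 : Exec M.W (.op .add 110 v 100) (s1.setReg 100 0) 1 s2 := by
    have := Exec.op (W := M.W) (s1.setReg 100 0) .add 110 v 100 (by
      rw [e1, abs_of_nonneg (by omega)]; omega)
    rwa [e1] at this
  have hs2r : ∀ r < 100, s2.reg r = s.reg r := by
    intro r hr
    rw [← ha.1 r hr, ← r1 r (by omega)]
    simp [hs2, show r ≠ 110 by omega, show r ≠ 100 by omega]
  have hs2m : s2.mem = s.mem := m1.trans ha.2
  have hc : Contains γ κ (p.regBound + 1) s2 (inputState [n] arrays) := by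
    refine ⟨fun r hr => ?_, fun m z => ?_⟩
    · rcases r with _ | r
      · simp [hs2, inputState]
      · have := z1 _ hr
        rw [hs2, State.reg_setReg, if_neg (by omega), State.reg_setReg, if_neg (by omega), this]
        simp [inputState]
    · rw [hs2r γ hγ, hs2r κ hκ, hs2m, hg, hk, hmem]; rfl
  have hL : (inputState [n] arrays).LeAbs V := by
    refine ⟨fun r => ?_, fun m z => ?_⟩
    · rcases r with _ | r
      · simpa [inputState] using hnV
      · simpa [inputState] using hVn
    · simp only [inputState, arrayOf]
      split_ifs
      · by_cases hm : m < arrays.length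
        · rw [List.getD_eq_getElem _ _ hm]
          by_cases hz : z.toNat < arrays[m].length
          · rw [List.getD_eq_getElem _ _ hz]
            exact hV _ (List.getElem_mem _) _ (List.getElem_mem _)
          · rw [List.getD_eq_default _ _ (by omega)]; simpa using hVn
        · have : arrays.getD m [] = [] := List.getD_eq_default _ _ (by omega)
          rw [this]; simpa using hVn
      · simpa using hVn
  obtain ⟨τ3, hτ3, s3, x3, c3, l3, o3⟩ := exec_relocate hγ hκ hWV h0 hkg hW hx
    (Nat.le_succ _) (by rw [hs2r γ hγ, hg]) (by rw [hs2r κ hκ, hk]) hc hL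
  have e4 : BinOp.add.eval ((s3.setReg 100 0).reg 110) ((s3.setReg 100 0).reg 100) =
      σ'.reg 0 := by
    simpa [BinOp.eval] using c3.reg 0 (by omega)
  have x4 : Exec M.W (.op .add r 110 100) (s3.setReg 100 0) 1
      ((s3.setReg 100 0).setReg r (σ'.reg 0)) := by
    have := Exec.op (W := M.W) (s3.setReg 100 0) .add r 110 100 (by
      rw [e4]; exact (l3.reg 0).trans hVW)
    rwa [e4] at this
  have X : Exec M.W (.call γ κ p v r) s₀ _ _ :=
    Exec.seq x1 (Exec.seq (Exec.const s1 100 0 (by simp)) (Exec.seq x2 (Exec.seq x3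
      (Exec.seq (Exec.const s3 100 0 (by simp)) x4))))
  set t := (s3.setReg 100 0).setReg r (σ'.reg 0) with ht
  have hfr : Frame (.call γ κ p v r) s t := by
    refine ⟨fun r hr hk => ?_, fun m hm => ?_⟩
    · rw [X.reg_eq hk, ha.1 r hr]
    · rw [X.mem_eq hm, ha.2]
  refine ⟨_, _, t, X, State.Agree.refl _, ⟨fun r' hr' => ?_, fun m hm => ?_⟩, hfr,
    hQ _ (by omega) t (by simp [ht]) (fun m z hz => ?_) hfr⟩
  · by_cases h : r = r'
    · subst h
      simpa [ht] using (l3.reg 0).trans hVB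
    · rw [hfr.reg r' hr' ((Cmd.keeps_call hr').2 h)]; exact hb.1 r' hr'
  · rw [hfr.mem m (Cmd.keepsMem_call hm)]; exact hb.2 m hm
  · have := o3.cell m z (by rw [hs2r γ hγ, hs2r κ hκ, hg, hk]; exact hz)
    rw [← hs2m, ← this]; rfl

end WordRAM


/-! ### Binary radix sort of lists -/

/-- Binary digit number `b`. -/
def Int.bitAt (b : ℕ) (x : ℤ) : ℤ := (x >>> b) % 2

/-- Lets a comparison modulo 2 ^ (b + 1) be decided first by digit b and then by the residues modulo
2 ^ b. -/
theorem Int.emod_two_pow_succ (b : ℕ) (x : ℤ) :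
    x % 2 ^ (b + 1) = x % 2 ^ b + 2 ^ b * x.bitAt b := by
  have h : (0 : ℤ) < 2 ^ b := by positivity
  have e : x.bitAt b = x / 2 ^ b % 2 := by
    rw [Int.bitAt, Int.shiftRight_eq_div_pow]; norm_num
  have h1 := Int.emod_nonneg x h.ne'
  have h2 := Int.emod_lt_of_pos x h
  have h3 := Int.emod_nonneg (x / 2 ^ b) (two_ne_zero)
  have h4 := Int.emod_lt_of_pos (x / 2 ^ b) (two_pos)
  rw [e]
  have d1 := Int.emod_add_mul_ediv x (2 ^ b)
  have d2 := Int.emod_add_mul_ediv (x / 2 ^ b) 2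
  have hx : x = x % 2 ^ b + 2 ^ b * (x / 2 ^ b % 2) + 2 ^ (b + 1) * (x / 2 ^ b / 2) := by
    rw [pow_succ]
    calc x = x % 2 ^ b + 2 ^ b * (x / 2 ^ b) := d1.symm
      _ = x % 2 ^ b + 2 ^ b * (x / 2 ^ b % 2 + 2 * (x / 2 ^ b / 2)) := by rw [d2]
      _ = _ := by ring
  conv_lhs => rw [hx]
  rw [Int.add_mul_emod_self_left]
  apply Int.emod_eq_of_lt
  · positivity
  · rw [pow_succ]; nlinarith

/-- A stable partition by digit number `b`. -/
def radixPass (b : ℕ) (l : List ℤ) : List ℤ :=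
  l.filter (fun x => x.bitAt b = 0) ++ l.filter (fun x => x.bitAt b = 1)

/-- The list after the passes for the digits below `b`. -/
def radixIter (l : List ℤ) : ℕ → List ℤ
  | 0 => l
  | b + 1 => radixPass b (radixIter l b)

theorem Int.bitAt_eq_or (b : ℕ) (x : ℤ) : x.bitAt b = 0 ∨ x.bitAt b = 1 :=
  Int.emod_two_eq_zero_or_one _

theorem radixPass_perm (b : ℕ) (l : List ℤ) : (radixPass b l).Perm l := by
  have h := List.filter_append_perm (fun x : ℤ => decide (x.bitAt b = 0)) l
  have e : (fun x : ℤ => !decide (x.bitAt b = 0)) = fun x : ℤ => decide (x.bitAt b = 1) := by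
    funext x
    rcases Int.bitAt_eq_or b x with h | h <;> simp [h]
  rwa [e] at h

theorem radixIter_perm (l : List ℤ) (b : ℕ) : (radixIter l b).Perm l := by
  induction b with
  | zero => exact List.Perm.refl _
  | succ b ih => exact (radixPass_perm b _).trans ih

/-- Among elements with equal digit the stable pass preserves the order by the lower digits; between
the two parts the new digit decides. -/
theorem radixIter_pairwise (l : List ℤ) (b : ℕ) :
    (radixIter l b).Pairwise fun x y => x % 2 ^ b ≤ y % 2 ^ b := by
  induction b with
  | zero => simpa [Int.emod_one] using List.pairwise_of_forall (fun _ _ => trivial)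
  | succ b ih =>
    have key : ∀ v : ℤ, ((radixIter l b).filter fun x => x.bitAt b = v).Pairwise
        fun x y => x % 2 ^ (b + 1) ≤ y % 2 ^ (b + 1) := by
      intro v
      rw [List.pairwise_filter]
      refine ih.imp fun {x y} h hx hy => ?_
      simp only [decide_eq_true_eq] at hx hy
      rw [Int.emod_two_pow_succ, Int.emod_two_pow_succ, hx, hy]; linarith
    refine List.pairwise_append.2 ⟨key 0, key 1, fun x hx y hy => ?_⟩
    have hx' : x.bitAt b = 0 := by simpa using (List.mem_filter.1 hx).2
    have hy' : y.bitAt b = 1 := by simpa using (List.mem_filter.1 hy).2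
    have h : (0 : ℤ) < 2 ^ b := by positivity
    have h1 := Int.emod_lt_of_pos x h
    have h2 := Int.emod_nonneg y h.ne'
    rw [Int.emod_two_pow_succ, Int.emod_two_pow_succ, hx', hy']; linarith

/-- Numbers in [0, 2 ^ b) equal their residues, and the absence of duplicates makes the order
strict. -/
theorem radixIter_strict {l : List ℤ} {b : ℕ} (hl : l.Nodup)
    (hb : ∀ x ∈ l, 0 ≤ x ∧ x < 2 ^ b) : (radixIter l b).Pairwise (· < ·) := by
  have hn : (radixIter l b).Pairwise (· ≠ ·) := (radixIter_perm l b).nodup_iff.2 hl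
  refine ((radixIter_pairwise l b).and hn).imp_of_mem fun {x y} hx hy h => ?_
  have hx' := hb x ((radixIter_perm l b).mem_iff.1 hx)
  have hy' := hb y ((radixIter_perm l b).mem_iff.1 hy)
  have := h.1
  rw [Int.emod_eq_of_lt hx'.1 hx'.2, Int.emod_eq_of_lt hy'.1 hy'.2] at this
  exact lt_of_le_of_ne this h.2

/-! ### Lists in arrays -/

/-- The cells of `a` from number `z` on hold the list `l`. -/
def HoldsAt (a : ℤ → ℤ) (z : ℤ) (l : List ℤ) : Prop :=
  ∀ (j : ℕ) (h : j < l.length), a (z + j) = l[j]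

theorem HoldsAt.congr {a a' : ℤ → ℤ} {z : ℤ} {l : List ℤ} (h : HoldsAt a z l)
    (h' : ∀ j : ℕ, j < l.length → a' (z + j) = a (z + j)) : HoldsAt a' z l :=
  fun j hj => (h' j hj).trans (h j hj)

theorem HoldsAt.append {a : ℤ → ℤ} {z : ℤ} {l : List ℤ} (h : HoldsAt a z l) {v : ℤ}
    (hv : a (z + l.length) = v) : HoldsAt a z (l ++ [v]) := by
  intro j hj
  by_cases h' : j < l.length
  · rw [List.getElem_append_left h']; exact h j h'
  · have : j = l.length := by simp at hj; omega
    subst this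
    simpa using hv

theorem List.take_succ_filter {α : Type*} (p : α → Bool) (l : List α) (j : ℕ)
    (h : j < l.length) :
    (l.take (j + 1)).filter p = (l.take j).filter p ++ if p l[j] then [l[j]] else [] := by
  rw [← List.take_concat_get' l j h, List.filter_append, List.filter_singleton]
  cases p l[j] <;> rfl

/-! ### Chains of blocks -/

/-- A set of triples below `g` of which no two are comparable in all coordinates has at most
`4 * g ^ 2` elements. -/
theorem card_incomparable_le (g : ℕ) (S : Finset (ℕ × ℕ × ℕ))
    (hS : ∀ x ∈ S, x.1 < g ∧ x.2.1 < g ∧ x.2.2 < g)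
    (h : ∀ x ∈ S, ∀ y ∈ S, x.1 < y.1 → x.2.1 < y.2.1 → x.2.2 < y.2.2 → False) :
    S.card ≤ 4 * g ^ 2 := by
  have hc : ((Finset.range (2 * g)) ×ˢ (Finset.range (2 * g))).card = 4 * g ^ 2 := by
    simp; ring
  rw [← hc]
  -- Projection along the diagonal direction (1, 1, 1): distinct points with the same image would be
  -- comparable. Adding g keeps the subtraction of natural numbers from truncating.
  refine Finset.card_le_card_of_injOn (fun x => (x.1 + g - x.2.2, x.2.1 + g - x.2.2)) ?_ ?_
  · intro x hx
    have := hS x hx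
    simp only [Finset.coe_product, Set.mem_prod, Finset.coe_range, Set.mem_Iio]
    omega
  · rintro ⟨a, b, c⟩ hx ⟨a', b', c'⟩ hy hxy
    have h1 := hS _ hx
    have h2 := hS _ hy
    have h3 := h _ hx _ hy
    have h4 := h _ hy _ hx
    simp only [Prod.mk.injEq] at h1 h2 h3 h4 hxy ⊢
    rcases lt_trichotomy a a' with h5 | h5 | h5
    · exact (h3 h5 (by omega) (by omega)).elim
    · omega
    · exact (h4 h5 (by omega) (by omega)).elim

/-! ### Frames of compound programs -/

namespace WordRAM

section frames
variable {c p q body : Cmd} {s t : State}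

theorem Frame.seq_left (h : Frame p s t) : Frame (p ;; q) s t :=
  h.mono (fun _ _ h => (Cmd.keeps_seq.1 h).1) fun _ h => (Cmd.keepsMem_seq.1 h).1

theorem Frame.seq_right (h : Frame q s t) : Frame (p ;; q) s t :=
  h.mono (fun _ _ h => (Cmd.keeps_seq.1 h).2) fun _ h => (Cmd.keepsMem_seq.1 h).2

theorem Frame.assign (r : ℕ) (e : Ex) (v : ℤ) : Frame (.assign r e) s (s.setReg r v) := by
  refine ⟨fun r' hr' hk => ?_, fun _ _ => rfl⟩
  rw [Cmd.keeps_assign hr'] at hk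
  rw [State.reg_setReg, if_neg (Ne.symm hk)]

end frames

/-! ### The registers of the algorithm -/

notation "vN" => (3 : ℕ)
notation "vLg" => (4 : ℕ)
notation "vLam" => (6 : ℕ)
notation "vQ" => (7 : ℕ)
notation "vBase" => (8 : ℕ)
notation "vOff" => (9 : ℕ)
notation "vS" => (10 : ℕ)
notation "vG" => (11 : ℕ)
notation "vM" => (12 : ℕ)
notation "vV" => (13 : ℕ)
notation "vLL" => (14 : ℕ)
notation "vT" => (15 : ℕ)
notation "vDum" => (16 : ℕ)
notation "vRow" => (17 : ℕ)
notation "vGGG" => (18 : ℕ)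
notation "vTot" => (19 : ℕ)
notation "vZ" => (20 : ℕ)
notation "vX" => (21 : ℕ)
notation "vB" => (22 : ℕ)
notation "vPos" => (23 : ℕ)
notation "vCnt" => (24 : ℕ)
notation "vKap" => (25 : ℕ)
notation "vI" => (26 : ℕ)
notation "vJ" => (27 : ℕ)
notation "vK" => (28 : ℕ)
notation "vU" => (29 : ℕ)
notation "vW" => (30 : ℕ)
notation "vRes" => (31 : ℕ)
notation "vFlag" => (32 : ℕ)

/-! ### Generating a duplicate-free list -/

/-- Append `f` to list number `q` unless it is there already. -/
def genBody (q : ℕ) (f : Ex) : Cmd :=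
  .assign vX f ;;
  .ifLt (.load (20 + q) (.reg vX)) (.const 1)
    (.put (20 + q) (.reg vX) (.const 1) ;; .put (10 + q) (.reg vCnt) (.reg vX) ;;
      .assign vCnt (.reg vCnt + .const 1)) .skip

/-- Append dummies to list number `q`. -/
def padBody (q : ℕ) : Cmd :=
  .ifLt (.reg vCnt) (.reg vZ + .const 1) (.put (10 + q) (.reg vZ) (.reg vDum + .reg vZ)) .skip

/-- Generate list number `q`, the values of `f`, with dummies. -/
def gen (q : ℕ) (f : Ex) : Cmd :=
  .assign vCnt (.const 0) ;; .assign vTot (.reg vLam * .reg q) ;;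
  .forLoop vZ vTot (genBody q f) ;; .forLoop vZ vM (padBody q)

variable {M : Bounds} {τ : ℕ} {s : State}

/-- Array `20 + q` is a table of the values seen so far, addressed by the value itself. It starts as
zero, so it costs no initialisation, and a membership test takes constant time. Duplicates must go
because an instance of 3-SUM consists of sets. -/
theorem wp_genLoop {q : ℕ} (hq : q < 3) {f : Ex} (hfW : f.Wf) (hfD : f.deg ≤ M.D) {F : ℕ → ℤ}
    {tot : ℕ} (htot : s.reg vTot = tot) (hB : (tot : ℤ) ≤ M.B) (hc : s.reg vCnt = 0)
    (hseen : ∀ z, s.mem (20 + q) z = 0)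
    (hf : ∀ t, M.Bdd t → Frame (.forLoop vZ vTot (genBody q f)) s t →
      ∀ z : ℕ, z < tot → t.reg vZ = z → f.eval t = F z)
    (hFB : ∀ z < tot, |F z| ≤ (M.B : ℤ)) :
    wp M (.forLoop vZ vTot (genBody q f)) τ s fun τ' t =>
      τ' ≤ τ + (tot * (f.cost + 30 + 7) + 4) ∧ ∃ l : List ℤ, l.Nodup ∧ l.length ≤ tot ∧
        t.reg vCnt = l.length ∧ HoldsAt (t.mem (10 + q)) 0 l ∧ ∀ v, v ∈ l ↔ ∃ z < tot, F z = v := by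
  refine wp_forLoop_uniform tot (f.cost + 30) (fun j t => ∃ l : List ℤ, l.Nodup ∧
    l.length ≤ j ∧ t.reg vCnt = l.length ∧ HoldsAt (t.mem (10 + q)) 0 l ∧
    (∀ v, t.mem (20 + q) v = if v ∈ l then 1 else 0) ∧ ∀ v, v ∈ l ↔ ∃ z < j, F z = v)
    (hki := by simp [genBody]) (hkn := by simp [genBody]) (hN := htot) (h0 := ?_)
    (hstep := ?_) (hQ := ?_)
  · exact ⟨[], by simp, by simp, by simpa using hc, fun j hj => by simp at hj, by simpa using hseen,
      by simp⟩
  · rintro j hj τ' t hb hF htj ⟨l, hl, hlen, hcnt, hhold, hmark, hmem⟩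
    have e := hf t hb hF j hj htj
    refine wp_seq (wp_assign hfW hfD (fun _ => by rw [e]; exact hFB j hj) ?_)
    rw [e]
    have hm : ∀ v, v ∈ l ∨ v = F j ↔ ∃ z < j + 1, F z = v := by
      intro v
      rw [hmem v]
      constructor
      · rintro (⟨z, hz, h⟩ | rfl)
        exacts [⟨z, by omega, h⟩, ⟨j, by omega, rfl⟩]
      · rintro ⟨z, hz, h⟩
        rcases Nat.lt_succ_iff_lt_or_eq.1 hz with h' | rfl
        exacts [Or.inl ⟨z, h', h⟩, Or.inr h.symm]
    refine wp_ifLt (by simp; omega) (by simp) (M.le_D (by simp)) (M.le_D (by simp))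
      (fun hlt => ?_) fun hlt => wp_skip ?_
    · simp only [Ex.eval_load, Ex.eval_reg, State.reg_setReg, if_true, State.mem_setReg, hmark,
        Ex.eval_const] at hlt
      have hnot : F j ∉ l := by intro h; simp [h] at hlt
      refine wp_seq (wp_put (hv := fun _ _ => ?_) (h := ?_))
      · have := M.two_le; simp; omega
      refine wp_seq (wp_put (hv := fun _ _ => ?_) (h := ?_))
      · simpa using hFB j hj
      refine wp_assign (hv := fun _ => ?_) (h := ?_)
      · simp only [Ex.eval_add, Ex.eval_reg, Ex.eval_const, State.reg_setMem, State.reg_setReg]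
        norm_num [hcnt]
        rw [abs_of_nonneg (by omega)]; omega
      · refine ⟨by simp; omega, l ++ [F j], ?_, ?_, ?_, ?_, ?_, ?_⟩
        · simpa [List.nodup_append, hl] using fun a ha => ne_of_mem_of_not_mem ha hnot
        · simp; omega
        · simp [hcnt]
        · refine HoldsAt.append (hhold.congr fun i hi => ?_) ?_
          · simp [hcnt]; omega
          · simp [hcnt]
        · intro v
          simp only [Ex.eval_reg, Ex.eval_const, State.mem_setReg, State.mem_setMem]
          rw [if_neg (by omega)]
          simp [hmark]
          by_cases hv : v = F j <;> simp [hv]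
        · intro v; rw [← hm v]; simp
    · simp only [Ex.eval_load, Ex.eval_reg, State.reg_setReg, if_true, State.mem_setReg, hmark,
        Ex.eval_const] at hlt
      have hin : F j ∈ l := by by_contra h; simp [h] at hlt
      refine ⟨by simp; omega, l, hl, by omega, by simpa using hcnt, hhold, hmark, fun v => ?_⟩
      rw [← hm v]
      exact ⟨Or.inl, fun h => h.elim id fun h => h ▸ hin⟩
  · rintro τ' t hb hF h1 ⟨l, h2, h3, h4, h5, h6, h7⟩
    exact ⟨h1, l, h2, h3, h4, h5, h7⟩

/-- The dummy for cell z is dum + z: it differs from the other dummies by its position, and from the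
genuine values because these are below dum. -/
theorem wp_padLoop {q : ℕ} {m : ℕ} (hm : s.reg vM = m) {dum : ℤ} (hd : 0 ≤ dum)
    (hdum : s.reg vDum = dum) (hB : dum + m ≤ M.B) {l : List ℤ} (hl : l.length ≤ m)
    (hc : s.reg vCnt = l.length) (hhold : HoldsAt (s.mem (10 + q)) 0 l) (hnd : l.Nodup)
    (hlt : ∀ v ∈ l, v < dum) :
    wp M (.forLoop vZ vM (padBody q)) τ s fun τ' t =>
      τ' ≤ τ + (m * (20 + 7) + 4) ∧ ∃ l' : List ℤ, l'.Nodup ∧ l'.length = m ∧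
        HoldsAt (t.mem (10 + q)) 0 l' ∧ (∀ v ∈ l, v ∈ l') ∧
        ∀ v ∈ l', v ∈ l ∨ dum ≤ v ∧ v < dum + m := by
  -- Rounds with a number below the length of `l` change nothing, hence the maximum.
  refine wp_forLoop_uniform m 20 (fun j t => ∃ l' : List ℤ, l'.Nodup ∧
    l'.length = max j l.length ∧ HoldsAt (t.mem (10 + q)) 0 l' ∧ (∀ v ∈ l, v ∈ l') ∧
    ∀ v ∈ l', v ∈ l ∨ dum ≤ v ∧ v < dum + j)
    (hki := by simp [padBody]) (hkn := by simp [padBody]) (hN := hm) (h0 := ?_)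
    (hstep := ?_) (hQ := ?_)
  · exact ⟨l, hnd, by simp, hhold, fun v h => h, fun v h => Or.inl h⟩
  · rintro j hj τ' t hb hF htj ⟨l', hl', hlen, hh, hsub, hsup⟩
    have e1 : t.reg vCnt = l.length := by
      rw [hF.reg _ (by norm_num) (by simp [padBody]), hc]
    have e2 : t.reg vDum = dum := by
      rw [hF.reg _ (by norm_num) (by simp [padBody]), hdum]
    refine wp_ifLt (hp := fun hlt' => ?_) (hq := fun hlt' => wp_skip ?_)
    · simp only [Ex.eval_reg, Ex.eval_add, Ex.eval_const, e1, htj] at hlt'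
      have hlj : l'.length = j := by omega
      refine wp_put (hv := fun _ _ => ?_) (h := ?_)
      · simp only [Ex.eval_reg, Ex.eval_add, e2, htj]
        rw [abs_of_nonneg (by omega)]; omega
      · refine ⟨by simp, l' ++ [dum + j], ?_, ?_, ?_, ?_, ?_⟩
        · rw [List.nodup_append]
          refine ⟨hl', by simp, fun a ha b hb => ?_⟩
          simp only [List.mem_singleton] at hb
          subst hb
          rcases hsup a ha with h | h
          · exact (lt_of_lt_of_le (hlt a h) (by omega)).ne
          · exact h.2.ne
        · simp; omega
        · refine HoldsAt.append (hh.congr fun i hi => ?_) ?_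
          · simp [htj]; omega
          · simp [htj, hlj, e2]
        · intro v hv; simp [hsub v hv]
        · intro v hv
          simp only [List.mem_append, List.mem_singleton] at hv
          rcases hv with hv | rfl
          · rcases hsup v hv with h | h
            · exact Or.inl h
            · right; push_cast; omega
          · right; push_cast; omega
    · simp only [Ex.eval_reg, Ex.eval_add, Ex.eval_const, e1, htj] at hlt'
      refine ⟨by simp, l', hl', by omega, hh, hsub, fun v hv => ?_⟩
      rcases hsup v hv with h | h
      · exact Or.inl h
      · right; push_cast; omega
  · rintro τ' t hb hF h1 ⟨l', h2, h3, h4, h5, h6⟩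
    exact ⟨h1, l', h2, by omega, h4, h5, h6⟩

theorem wp_gen {q : ℕ} (hq : q < 3) {f : Ex} (hfW : f.Wf) (hfD : f.deg ≤ M.D) {F : ℕ → ℤ}
    {tot m : ℕ} (htot : s.reg vLam * s.reg q = tot) (hm : s.reg vM = m) (htm : tot ≤ m) {dum : ℤ}
    (hd : 0 ≤ dum) (hdum : s.reg vDum = dum) (hB : dum + m ≤ M.B)
    (hseen : ∀ z, s.mem (20 + q) z = 0)
    (hf : ∀ t, M.Bdd t → Frame (gen q f) s t →
      ∀ z : ℕ, z < tot → t.reg vZ = z → f.eval t = F z)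
    (hF0 : ∀ z < tot, 0 ≤ F z) (hFd : ∀ z < tot, F z < dum) :
    wp M (gen q f) τ s fun τ' t =>
      τ' ≤ τ + (tot * (f.cost + 37) + m * 27 + 30) ∧ ∃ l : List ℤ, l.Nodup ∧ l.length = m ∧
        HoldsAt (t.mem (10 + q)) 0 l ∧ (∀ z < tot, F z ∈ l) ∧
        ∀ v ∈ l, (∃ z < tot, F z = v) ∨ dum ≤ v ∧ v < dum + m := by
  refine wp_seq (wp_assign (hv := fun _ => by simp) (h := ?_))
  have e1 : (s.setReg vCnt 0).reg vLam * (s.setReg vCnt 0).reg q = tot := by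
    rw [← htot]; simp; omega
  refine wp_seq (wp_assign (he := by simp; omega) (hv := fun _ => ?_) (h := ?_))
  · simp only [Ex.eval_mul, Ex.eval_reg, Ex.eval_const, e1]
    rw [abs_of_nonneg (by omega)]; omega
  simp only [Ex.eval_mul, Ex.eval_reg, Ex.eval_const, e1]
  refine wp_seq_of (wp_genLoop hq hfW hfD (F := F) (tot := tot) (by simp) (by omega) (by simp)
    (by simpa using hseen) (fun t hb hF => hf t hb ?_) fun z hz => ?_) ?_
  · exact (Frame.seq_left (Frame.assign _ _ _)).trans (.seq_right ((Frame.seq_left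
      (Frame.assign _ _ _)).trans (.seq_right (.seq_left hF))))
  · have := hF0 z hz; have := hFd z hz
    rw [abs_of_nonneg (by omega)]; omega
  · rintro τ' t hb hF ⟨h1, l, h2, h3, h4, h5, h6⟩
    refine wp_mono (wp_padLoop (l := l) (dum := dum) (m := m) ?_ hd ?_ hB (by omega) h4 h5 h2 ?_)
      ?_
    · rw [hF.reg _ (by norm_num) (by simp [genBody])]; simpa using hm
    · rw [hF.reg _ (by norm_num) (by simp [genBody])]; simpa using hdum
    · intro v hv
      obtain ⟨z, hz, rfl⟩ := (h6 v).1 hv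
      exact hFd z hz
    · rintro τ'' u _ _ ⟨g1, l', g2, g3, g4, g5, g6⟩
      refine ⟨?_, l', g2, g3, g4, fun z hz => g5 _ ((h6 _).2 ⟨z, hz, rfl⟩), fun v hv => ?_⟩
      · simp only [Ex.cost_const, Ex.cost_mul, Ex.cost_reg] at h1
        linarith
      · exact (g6 v hv).imp_left (h6 v).1

/-! ### Sorting -/

/-- Append the elements of row `b` that have the digit `v` to row `b + 1`. -/
def scanBody (q : ℕ) (v : ℤ) : Cmd :=
  .assign vX (.load (10 + q) (.reg vB * .reg vM + .reg vZ)) ;;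
  -- Only strict comparison is available: two integers are equal iff the square of their difference
  -- is below 1.
  .ifLt ((.op .shr (.reg vX) (.reg vB) % .const 2 - .const v) *
      (.op .shr (.reg vX) (.reg vB) % .const 2 - .const v)) (.const 1)
    (.put (10 + q) ((.reg vB + .const 1) * .reg vM + .reg vPos) (.reg vX) ;;
      .assign vPos (.reg vPos + .const 1)) .skip

/-- Sort list number `q` by the digits below `reg vLL`; the result is in row `reg vLL`. -/
def sortList (q : ℕ) : Cmd :=
  .forLoop vB vLL (.assign vPos (.const 0) ;; .forLoop vZ vM (scanBody q 0) ;;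
    .forLoop vZ vM (scanBody q 1))

/-- Rows b and b + 1 are disjoint segments of one array, so appending to the target never destroys
input. The prefix `pre` is what an earlier scan of the same row, for the other digit, has already
written. -/
theorem wp_scan {q : ℕ} (hq : q < 3) {v : ℕ} (hv : v < 2) {b m : ℕ} (hb : s.reg vB = b)
    (hm : s.reg vM = m) (hB : 2 * (m : ℤ) ≤ M.B) {r pre : List ℤ} (hr : r.length = m)
    (hrow : HoldsAt (s.mem (10 + q)) (b * m) r)
    (hpre : HoldsAt (s.mem (10 + q)) ((b + 1) * m) pre) (hpm : pre.length ≤ m)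
    (hpos : s.reg vPos = pre.length) :
    wp M (.forLoop vZ vM (scanBody q v)) τ s fun τ' t =>
      τ' ≤ τ + (m * (70 + 7) + 4) ∧ HoldsAt (t.mem (10 + q)) (b * m) r ∧
      HoldsAt (t.mem (10 + q)) ((b + 1) * m) (pre ++ r.filter fun x => x.bitAt b = (v : ℤ)) ∧
      t.reg vPos = (pre ++ r.filter fun x => x.bitAt b = (v : ℤ)).length := by
  refine wp_forLoop_uniform m 70 (fun j t =>
    HoldsAt (t.mem (10 + q)) (b * m) r ∧
    HoldsAt (t.mem (10 + q)) ((b + 1) * m) (pre ++ (r.take j).filter fun x => x.bitAt b = (v : ℤ)) ∧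
    t.reg vPos = (pre ++ (r.take j).filter fun x => x.bitAt b = (v : ℤ)).length)
    (hki := by simp [scanBody]) (hkn := by simp [scanBody]) (hN := hm) (h0 := ?_)
    (hstep := ?_) (hQ := ?_)
  · exact ⟨hrow, by simpa using hpre, by simpa using hpos⟩
  · rintro j hj τ' t hbd hF htj ⟨h1, h2, h3⟩
    have e1 : t.reg vB = b := by rw [hF.reg _ (by norm_num) (by simp [scanBody]), hb]
    have e2 : t.reg vM = m := by rw [hF.reg _ (by norm_num) (by simp [scanBody]), hm]
    have ex := h1 j (by omega)
    have hlen : ((r.take j).filter fun x => x.bitAt b = (v : ℤ)).length ≤ j :=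
      (List.length_filter_le _ _).trans (by simp)
    have hlast : ∀ x : ℤ, (x >>> b) % 2 = x.bitAt b := fun x => rfl
    set pr := pre ++ (r.take j).filter fun x => x.bitAt b = (v : ℤ) with hpr
    -- This crude bound on the write position is the reason for assuming 2 * m ≤ B.
    have hprl : pr.length ≤ m + j := by rw [hpr, List.length_append]; omega
    refine wp_seq (wp_assign (he := by simp; omega) (hv := fun hb => ?_) (h := ?_))
    · exact hb.2 _ (by omega) _
    simp only [Ex.eval_load, Ex.eval_add, Ex.eval_mul, Ex.eval_reg, e1, e2, htj, ex]
    refine wp_ifLt (hd₁ := M.le_D (by simp; omega)) (hp := fun hlt => ?_)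
      (hq := fun hlt => wp_skip ?_)
    · have hbit : (r[j]).bitAt b = v := by
        simp [e1, hlast] at hlt
        rcases Int.bitAt_eq_or b r[j] with h | h <;> rw [h] at hlt ⊢ <;> interval_cases v <;>
          simp_all
      rw [List.take_succ_filter _ _ _ (by omega)]
      simp only [hbit, decide_true, if_true]
      rw [← List.append_assoc, ← hpr]
      refine wp_seq (wp_put (hv := fun hb _ => ?_) (h := ?_))
      · exact hb.1 _ (by norm_num)
      refine wp_assign (hv := fun hb => ?_) (h := ?_)
      · simp only [Ex.eval_add, Ex.eval_reg, Ex.eval_const, State.reg_setMem, State.reg_setReg]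
        norm_num [h3]
        rw [abs_of_nonneg (by omega)]; omega
      refine ⟨by simp, h1.congr fun i hi => ?_, HoldsAt.append (h2.congr fun i hi => ?_) ?_,
        ?_⟩
      · simp [e1, e2, h3]
        intro h
        exfalso
        rw [add_mul] at h; omega
      · simp [e1, e2, h3]; omega
      · simp [e1, e2, h3]
      · simp [h3]
    · have hbit : ¬ (r[j]).bitAt b = v := by
        simp [e1, hlast] at hlt
        intro h
        rw [h] at hlt; simp at hlt
      rw [List.take_succ_filter _ _ _ (by omega)]
      simp only [hbit, decide_false, Bool.false_eq_true, if_false, List.append_nil]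
      rw [← hpr]
      refine ⟨by simp, h1, h2, by simpa using h3⟩
  · rintro τ' t _ _ h1 ⟨h2, h3, h4⟩
    rw [← hr, List.take_length] at h3 h4
    rw [← hr] at h1 h2 ⊢
    exact ⟨h1, h2, h3, h4⟩

/-- Row b holds the list after b passes. Keeping all rows avoids copying back, and memory is free.
-/
theorem wp_sortList {q : ℕ} (hq : q < 3) {L m : ℕ} (hL : s.reg vLL = L) (hm : s.reg vM = m)
    (hB : 2 * (m : ℤ) ≤ M.B) {l : List ℤ} (hl : l.length = m)
    (hh : HoldsAt (s.mem (10 + q)) 0 l) :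
    wp M (sortList q) τ s fun τ' t =>
      τ' ≤ τ + (L * (m * 154 + 20 + 7) + 4) ∧
      HoldsAt (t.mem (10 + q)) (L * m) (radixIter l L) := by
  have hlen : ∀ b, (radixIter l b).length = m := fun b => by
    rw [(radixIter_perm l b).length_eq, hl]
  refine wp_forLoop_uniform L (m * 154 + 20)
    (fun b t => HoldsAt (t.mem (10 + q)) (b * m) (radixIter l b))
    (hki := by simp [scanBody]) (hkn := by simp [scanBody]) (hN := hL) (h0 := ?_)
    (hstep := ?_) (hQ := fun _ _ _ _ h h' => ⟨h, h'⟩)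
  · simpa [radixIter] using hh
  · intro b hb τ' t hbd hF htb hI
    have em : t.reg vM = m := by rw [hF.reg _ (by norm_num) (by simp [scanBody]), hm]
    refine wp_seq (wp_assign (hv := fun _ => by simp) (h := ?_))
    refine wp_seq_of (wp_scan hq (v := 0) (by norm_num) (b := b) (m := m) (pre := [])
      (by simpa using htb) (by simpa using em) hB (hlen b) (by simpa using hI)
      (fun j hj => by simp at hj) (by simp) (by simp)) ?_
    rintro τ1 t1 _ hF1 ⟨h1, h2, h3, h4⟩
    refine wp_mono (wp_scan hq (v := 1) (by norm_num) (b := b) (m := m) ?_ ?_ hB (hlen b) h2 h3 ?_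
      h4) ?_
    · rw [hF1.reg _ (by norm_num) (by simp [scanBody])]; simpa using htb
    · rw [hF1.reg _ (by norm_num) (by simp [scanBody])]; simpa using em
    · simpa using (List.length_filter_le _ _).trans (hlen b).le
    · rintro τ2 t2 _ _ ⟨g1, g2, g3, g4⟩
      refine ⟨?_, ?_⟩
      · simp only [Ex.cost_const] at h1
        linarith
      · push_cast
        simpa [radixIter, radixPass] using g3

end WordRAM

namespace WordRAM

/-! ### Block triples -/

/-- Write element number `vU` of the blocks at `vI`, `vJ`, `vK` to the memory of the subroutine;
elements of the first block that are marked are replaced by dummies. -/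
def buildBody : Cmd :=
  .assign vX (.load 10 (.reg vI + .reg vU)) ;;
  .ifLt (.load 30 (.reg vX)) (.const 1)
    (.put 100 (.reg vU * .reg vGGG + .reg vKap) (.reg vX))
    (.put 100 (.reg vU * .reg vGGG + .reg vKap) (.reg vV + .reg vU)) ;;
  .put 101 (.reg vU * .reg vGGG + .reg vKap) (.load 11 (.reg vJ + .reg vU)) ;;
  .put 102 (.reg vU * .reg vGGG + .reg vKap) (.load 12 (.reg vK + .reg vU) - .reg vT)

def markBody : Cmd :=
  .put 30 (.reg vT - .load 11 (.reg vJ + .reg vU) - .load 12 (.reg vK + .reg vW)) (.const 1)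

/-- Mark all numbers that the blocks at `vJ` and `vK` complete to a solution. -/
def markLoop : Cmd := .forLoop vU vS (.forLoop vW vS markBody)

/-- Handle a triple of blocks with the help of the program `p` for 3-SUM. -/
def handle (p : Cmd) : Cmd :=
  .forLoop vU vS buildBody ;; .call vGGG vKap p vS vRes ;;
  .ifLt (.reg vRes) (.const 2) (.ifLt (.const 0) (.reg vRes) markLoop .skip) .skip

variable {M : Bounds} {τ : ℕ} {s : State}

/-- The registers `vI`, `vJ`, `vK` point to blocks of size `S` with the elements `fa`, `fb`,
`fc`. -/
structure Blocks (s : State) (S : ℕ) (fa fb fc : ℕ → ℤ) : Prop where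
  size : s.reg vS = S
  fst : ∀ u < S, s.mem 10 (s.reg vI + u) = fa u
  snd : ∀ u < S, s.mem 11 (s.reg vJ + u) = fb u
  thd : ∀ u < S, s.mem 12 (s.reg vK + u) = fc u

theorem Blocks.congr {s t : State} {S : ℕ} {fa fb fc : ℕ → ℤ} (h : Blocks s S fa fb fc)
    (hr : ∀ r ∈ [vS, vI, vJ, vK], t.reg r = s.reg r)
    (hm : ∀ m ∈ [10, 11, 12], t.mem m = s.mem m) : Blocks t S fa fb fc := by
  simp only [List.mem_cons, List.not_mem_nil, or_false, forall_eq_or_imp, forall_eq] at hr hm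
  obtain ⟨h1, h2, h3, h4⟩ := h
  constructor <;> simpa only [hr, hm]

/-- Shifting the third block by T moves the target to 0. A marked element of the first block is
replaced by V + u, which is too large for any solution. The other cells of the residue class are
still zero, as an initial state of the subroutine demands. -/
theorem wp_build {S : ℕ} {fa fb fc : ℕ → ℤ} (hb : Blocks s S fa fb fc) {G κ V T : ℤ}
    (hG : s.reg vGGG = G) (hκ : s.reg vKap = κ) (hV : s.reg vV = V) (hT : s.reg vT = T)
    (h0 : 0 ≤ κ) (hκG : κ < G) (hmark : ∀ z, s.mem 30 z = 0 ∨ s.mem 30 z = 1)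
    (hfresh : ∀ m ≥ 100, ∀ z, s.mem m (z * G + κ) = 0) :
    wp M (.forLoop vU vS buildBody) τ s fun τ' t => τ' ≤ τ + (S * (70 + 7) + 4) ∧
      (∀ z : ℤ, t.mem 100 (z * G + κ) = if 0 ≤ z ∧ z < S then
        (if s.mem 30 (fa z.toNat) = 0 then fa z.toNat else V + z.toNat) else 0) ∧
      (∀ z : ℤ, t.mem 101 (z * G + κ) = if 0 ≤ z ∧ z < S then fb z.toNat else 0) ∧
      (∀ z : ℤ, t.mem 102 (z * G + κ) = if 0 ≤ z ∧ z < S then fc z.toNat - T else 0) ∧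
      ∀ m z, z % G ≠ κ → t.mem m z = s.mem m z := by
  have hmod : ∀ z : ℤ, (z * G + κ) % G = κ := fun z => by
    rw [add_comm, Int.add_mul_emod_self_right, Int.emod_eq_of_lt h0 hκG]
  have hinj : ∀ z z' : ℤ, z * G + κ = z' * G + κ ↔ z = z' := fun z z' =>
    ⟨fun h => mul_right_cancel₀ (show G ≠ 0 by omega) (by linarith), fun h => by rw [h]⟩
  have hupd : ∀ (j : ℕ) (f : ℕ → ℤ) (z : ℤ), (if z = j then f j else
      if 0 ≤ z ∧ z < j then f z.toNat else 0) =
      if 0 ≤ z ∧ z < (j + 1 : ℕ) then f z.toNat else 0 := by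
    intro j f z
    by_cases hz : z = j
    · subst hz; simp
    · rw [if_neg hz]
      exact if_congr (by push_cast; omega) rfl rfl
  refine wp_forLoop_uniform S 70 (fun j t =>
      (∀ z : ℤ, t.mem 100 (z * G + κ) = if 0 ≤ z ∧ z < j then
        (if s.mem 30 (fa z.toNat) = 0 then fa z.toNat else V + z.toNat) else 0) ∧
      (∀ z : ℤ, t.mem 101 (z * G + κ) = if 0 ≤ z ∧ z < j then fb z.toNat else 0) ∧
      (∀ z : ℤ, t.mem 102 (z * G + κ) = if 0 ≤ z ∧ z < j then fc z.toNat - T else 0) ∧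
      ∀ m z, z % G ≠ κ → t.mem m z = s.mem m z)
    (hki := by simp [buildBody]) (hkn := by simp [buildBody]) (hN := hb.size) (h0 := ?_)
    (hstep := ?_) (hQ := fun _ _ _ _ h h' => ⟨h, h'⟩)
  · refine ⟨fun z => ?_, fun z => ?_, fun z => ?_, fun _ _ _ => rfl⟩ <;>
      rw [if_neg (by omega)] <;> exact hfresh _ (by norm_num) z
  · rintro j hj τ' t hbd hF htj ⟨h1, h2, h3, h4⟩
    have eG : t.reg vGGG = G := by rw [hF.reg _ (by norm_num) (by simp [buildBody]), hG]
    have eκ : t.reg vKap = κ := by rw [hF.reg _ (by norm_num) (by simp [buildBody]), hκ]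
    have eV : t.reg vV = V := by rw [hF.reg _ (by norm_num) (by simp [buildBody]), hV]
    have eT : t.reg vT = T := by rw [hF.reg _ (by norm_num) (by simp [buildBody]), hT]
    have eh : t.mem 30 = s.mem 30 := hF.mem _ (by simp [buildBody])
    have hb' : Blocks t S fa fb fc := hb.congr
      (by simp only [List.mem_cons, List.not_mem_nil, or_false, forall_eq_or_imp, forall_eq]
          refine ⟨?_, ?_, ?_, ?_⟩ <;> exact hF.reg _ (by norm_num) (by simp [buildBody]))
      (by simp only [List.mem_cons, List.not_mem_nil, or_false, forall_eq_or_imp, forall_eq]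
          refine ⟨?_, ?_, ?_⟩ <;> exact hF.mem _ (by simp [buildBody]))
    refine wp_seq (wp_assign (hv := fun hb => hb.2 _ (by norm_num) _) (h := ?_))
    simp only [Ex.eval_load, Ex.eval_add, Ex.eval_reg, htj, hb'.fst j hj]
    refine wp_seq (wp_mono (R := fun τ'' u => τ'' ≤ τ' + 30 ∧
      u = (t.setReg vX (fa j)).setMem 100 (j * G + κ)
        (if s.mem 30 (fa j) = 0 then fa j else V + j)) ?_ ?_)
    · refine wp_ifLt (hp := fun hlt => ?_) (hq := fun hlt => ?_)
      · refine wp_put (hv := fun _ h => by omega) (h := ?_)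
        simp [eh] at hlt
        have := hmark (fa j)
        refine ⟨by simp, ?_⟩
        rw [if_pos (by omega)]
        simp [htj, eG, eκ]
      · refine wp_put (hv := fun _ h => by omega) (h := ?_)
        simp [eh] at hlt
        refine ⟨by simp, ?_⟩
        rw [if_neg (by omega)]
        simp [htj, eG, eκ, eV]
    · rintro τ'' u hbu - ⟨hτ, rfl⟩
      refine wp_seq (wp_put (hv := fun _ h => by omega) (h := ?_))
      refine wp_put (hv := fun _ h => by omega) (h := ?_)
      have e2 := hb'.snd j hj
      have e3 := hb'.thd j hj
      refine ⟨by simp; omega, fun z => ?_, fun z => ?_, fun z => ?_, fun m z hz => ?_⟩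
      · rw [← hupd j fun u => if s.mem 30 (fa u) = 0 then fa u else V + u]
        simp [htj, eG, eκ, hinj, h1]
      · rw [← hupd]
        simp [htj, eG, eκ, hinj, h2, e2]
      · rw [← hupd j fun u => fc u - T]
        simp [htj, eG, eκ, hinj, h3, e3, eT]
      · have hne : z ≠ j * G + κ := fun h => hz (by rw [h, hmod])
        simp [htj, eG, eκ, hne, h4 m z hz]

/-- Marks are addressed by value: a pair marks the one number that completes it to T, whether or not
this number occurs in the first list. So quadratic time suffices, and a mark always stems from an
actual pair. -/
theorem wp_markLoop {S : ℕ} {fa fb fc : ℕ → ℤ} (hb : Blocks s S fa fb fc) {T : ℤ}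
    (hT : s.reg vT = T) :
    wp M markLoop τ s fun τ' t => τ' ≤ τ + (S * (S * (30 + 7) + 4 + 7) + 4) ∧
      ∀ z, t.mem 30 z = if ∃ u < S, ∃ w < S, z = T - fb u - fc w then 1 else s.mem 30 z := by
  refine wp_forLoop_uniform S (S * (30 + 7) + 4) (fun j t =>
      ∀ z, t.mem 30 z = if ∃ u < j, ∃ w < S, z = T - fb u - fc w then 1 else s.mem 30 z)
    (hki := by simp [markBody]) (hkn := by simp [markBody]) (hN := hb.size) (h0 := ?_)
    (hstep := ?_) (hQ := fun _ _ _ _ h h' => ⟨h, h'⟩)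
  · intro z; simp
  · intro j hj τ' t hbd hF htj hI
    have hb' : Blocks t S fa fb fc := hb.congr
      (by simp only [List.mem_cons, List.not_mem_nil, or_false, forall_eq_or_imp, forall_eq]
          refine ⟨?_, ?_, ?_, ?_⟩ <;> exact hF.reg _ (by norm_num) (by simp [markBody]))
      (by simp only [List.mem_cons, List.not_mem_nil, or_false, forall_eq_or_imp, forall_eq]
          refine ⟨?_, ?_, ?_⟩ <;> exact hF.mem _ (by simp [markBody]))
    have eT : t.reg vT = T := by rw [hF.reg _ (by norm_num) (by simp [markBody]), hT]
    refine wp_forLoop_uniform S 30 (fun i u => ∀ z, u.mem 30 z =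
        if (∃ u < j, ∃ w < S, z = T - fb u - fc w) ∨ ∃ w < i, z = T - fb j - fc w then 1
        else s.mem 30 z)
      (hki := by simp [markBody]) (hkn := by simp [markBody]) (hN := hb'.size) (h0 := ?_)
      (hstep := ?_) (hQ := ?_)
    · intro z; simpa using hI z
    · intro i hi τ'' u _ hF' hui hI'
      have hb2 : Blocks u S fa fb fc := hb'.congr
        (by simp only [List.mem_cons, List.not_mem_nil, or_false, forall_eq_or_imp, forall_eq]
            refine ⟨?_, ?_, ?_, ?_⟩ <;> exact hF'.reg _ (by norm_num) (by simp [markBody]))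
        (by simp only [List.mem_cons, List.not_mem_nil, or_false, forall_eq_or_imp, forall_eq]
            refine ⟨?_, ?_, ?_⟩ <;> exact hF'.mem _ (by simp [markBody]))
      have eT' : u.reg vT = T := by rw [hF'.reg _ (by norm_num) (by simp [markBody]), eT]
      have euj : u.reg vU = j := by rw [hF'.reg _ (by norm_num) (by simp [markBody]), htj]
      have e2 := hb2.snd j hj
      have e3 := hb2.thd i hi
      refine wp_put (hv := fun _ _ => ?_) (h := ⟨by simp, fun z => ?_⟩)
      · have := M.two_le; simp; omega
      · simp only [Ex.eval_sub, Ex.eval_reg, Ex.eval_load, Ex.eval_add, eT', euj, e2, hui, e3,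
          State.mem_setReg, State.mem_setMem, true_and, Ex.eval_const, hI' z]
        by_cases hz : z = T - fb j - fc i
        · rw [if_pos hz, if_pos (Or.inr ⟨i, by omega, hz⟩)]
        · rw [if_neg hz]
          refine if_congr (or_congr_right ⟨?_, ?_⟩) rfl rfl
          · rintro ⟨w, hw, h⟩; exact ⟨w, by omega, h⟩
          · rintro ⟨w, hw, h⟩
            rcases Nat.lt_succ_iff_lt_or_eq.1 hw with h' | rfl
            exacts [⟨w, h', h⟩, (hz h).elim]
    · intro τ'' u _ _ hτ hI'
      refine ⟨hτ, fun z => ?_⟩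
      rw [State.mem_setReg, hI' z]
      refine if_congr ⟨?_, ?_⟩ rfl rfl
      · rintro (⟨v, hv, h⟩ | h)
        exacts [⟨v, by omega, h⟩, ⟨j, by omega, h⟩]
      · rintro ⟨v, hv, h⟩
        rcases Nat.lt_succ_iff_lt_or_eq.1 hv with h' | rfl
        exacts [Or.inl ⟨v, h', h⟩, Or.inr h]

theorem arrayOf_map_range (S : ℕ) (f : ℕ → ℤ) (z : ℤ) :
    arrayOf ((List.range S).map f) z = if 0 ≤ z ∧ z < S then f z.toNat else 0 := by
  unfold arrayOf
  by_cases h0 : 0 ≤ z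
  · by_cases h1 : z < S
    · rw [if_pos h0, if_pos ⟨h0, h1⟩, List.getD_eq_getElem _ _ (by simp; omega)]; simp
    · rw [if_pos h0, if_neg (by tauto), List.getD_eq_default _ _ (by simp; omega)]
  · rw [if_neg h0, if_neg (by tauto)]

/-- The program `p` solves the instances of 3-SUM of size `S` over the universe `U` in time `t₀`
with words bounded by `W'`. -/
def SolvesAt (p : Cmd) (W' S U t₀ : ℕ) : Prop :=
  ∀ I : ThreeSumInstance, I.n = S → threeSum.InUniverse I U →
    ∃ (τ : ℕ) (σ : State), Exec W' p (inputState [S] [I.A 0, I.A 1, I.A 2]) τ σ ∧ τ ≤ t₀ ∧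
      (σ.reg 0 = 1 ↔ threeSum.answer I)

/-- Because of the dummies, a positive answer means that some unmarked element of the first block
has a solution in these blocks. A negative answer means that all elements with such a solution are
marked already. The disjunction in the time bound prepares the amortisation: the quadratic search is
paid for by a newly marked element. -/
theorem wp_handle {p : Cmd} {W' S U t₀ : ℕ} (hp : SolvesAt p W' S U t₀) {V' : ℤ}
    (hW' : (W' : ℤ) ≤ V') (hUV : (U : ℤ) ≤ V') (hVB : V' ≤ M.B) {G κ V T : ℤ}
    (hW : V' * G + G ≤ M.W) {fa fb fc : ℕ → ℤ} (hb : Blocks s S fa fb fc)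
    (hG : s.reg vGGG = G) (hκ : s.reg vKap = κ) (hV : s.reg vV = V) (hT : s.reg vT = T)
    (h0 : 0 ≤ κ) (hκG : κ < G) (hmark : ∀ z, s.mem 30 z = 0 ∨ s.mem 30 z = 1)
    (hfresh : ∀ m ≥ 100, ∀ z, s.mem m (z * G + κ) = 0)
    (hTV : T < V) (hT0 : 0 ≤ T) (hVU : V + S ≤ U) (hTU : T + V ≤ U)
    (ha : ∀ u < S, 0 ≤ fa u ∧ fa u < V) (hbV : ∀ u < S, 0 ≤ fb u ∧ fb u < V)
    (hc : ∀ u < S, 0 ≤ fc u ∧ fc u < V)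
    (hai : ∀ u < S, ∀ u' < S, fa u = fa u' → u = u')
    (hbi : ∀ u < S, ∀ u' < S, fb u = fb u' → u = u')
    (hci : ∀ u < S, ∀ u' < S, fc u = fc u' → u = u') :
    wp M (handle p) τ s fun τ' t =>
      (∀ z, t.mem 30 z = 0 ∨ t.mem 30 z = 1) ∧ (∀ z, s.mem 30 z = 1 → t.mem 30 z = 1) ∧
      (∀ z, t.mem 30 z = 1 → s.mem 30 z = 1 ∨ ∃ u < S, ∃ w < S, z = T - fb u - fc w) ∧
      (∀ u < S, ∀ v < S, ∀ w < S, fa u + fb v + fc w = T → t.mem 30 (fa u) = 1) ∧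
      (τ' ≤ τ + (S * 77 + 3 * t₀ + p.regBound + 30) ∨
        τ' ≤ τ + (S * 77 + 3 * t₀ + p.regBound + 30) + (S * (S * 37 + 11) + 4) ∧
          ∃ u < S, s.mem 30 (fa u) = 0 ∧ t.mem 30 (fa u) = 1) ∧
      ∀ m ≥ 100, ∀ z, z % G ≠ κ → t.mem m z = s.mem m z := by
  have hmod : ∀ z : ℤ, (z * G + κ) % G = κ := fun z => by
    rw [add_comm, Int.add_mul_emod_self_right, Int.emod_eq_of_lt h0 hκG]
  set f0 : ℕ → ℤ := fun u => if s.mem 30 (fa u) = 0 then fa u else V + u with hf0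
  set f2 : ℕ → ℤ := fun u => fc u - T with hf2
  have nd : ∀ f : ℕ → ℤ, (∀ u < S, ∀ u' < S, f u = f u' → u = u') →
      ((List.range S).map f).Nodup := fun f hf =>
    List.Nodup.map_on (fun x hx y hy h => hf x (List.mem_range.1 hx) y (List.mem_range.1 hy) h)
      List.nodup_range
  -- Genuine elements lie below V, dummies do not, and dummies differ by position; so the modified
  -- block is still a set.
  have hf0i : ∀ u < S, ∀ u' < S, f0 u = f0 u' → u = u' := by
    intro u hu u' hu' h
    have h1 := ha u hu
    have h2 := ha u' hu'
    simp only [hf0] at h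
    split_ifs at h
    · exact hai u hu u' hu' h
    · omega
    · omega
    · omega
  let I : ThreeSumInstance :=
    { n := S
      A := ![(List.range S).map f0, (List.range S).map fb, (List.range S).map f2]
      nodup := by
        intro i
        fin_cases i
        · exact nd _ hf0i
        · exact nd _ hbi
        · exact nd _ fun u hu u' hu' h => hci u hu u' hu' (by simpa [hf2] using h)
      length_eq := by intro i; fin_cases i <;> simp }
  have hU : ∀ l ∈ [I.A 0, I.A 1, I.A 2], ∀ x ∈ l, |x| ≤ (U : ℤ) := by
    intro l hl x hx
    simp only [List.mem_cons, List.not_mem_nil, or_false] at hl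
    rcases hl with rfl | rfl | rfl
    · obtain ⟨u, hu, rfl⟩ := List.mem_map.1 hx
      have := List.mem_range.1 hu
      have := ha u this
      simp only [hf0]
      split_ifs <;> rw [abs_of_nonneg (by omega)] <;> omega
    · obtain ⟨u, hu, rfl⟩ := List.mem_map.1 hx
      have := List.mem_range.1 hu
      have := hbV u this
      rw [abs_of_nonneg (by omega)]; omega
    · obtain ⟨u, hu, rfl⟩ := List.mem_map.1 hx
      have := List.mem_range.1 hu
      have := hc u this
      simp only [hf2]
      rw [abs_le]; omega
  have hans : threeSum.answer I ↔ ∃ u < S, ∃ v < S, ∃ w < S, s.mem 30 (fa u) = 0 ∧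
      fa u + fb v + fc w = T := by
    show (∃ a ∈ (List.range S).map f0, ∃ b ∈ (List.range S).map fb,
      ∃ c ∈ (List.range S).map f2, a + b + c = 0) ↔ _
    simp only [List.mem_map, List.mem_range]
    constructor
    · rintro ⟨_, ⟨u, hu, rfl⟩, _, ⟨v, hv, rfl⟩, _, ⟨w, hw, rfl⟩, h⟩
      refine ⟨u, hu, v, hv, w, hw, ?_⟩
      simp only [hf0, hf2] at h
      have := hbV v hv
      have := hc w hw
      -- With a dummy in first place the sum is at least V - T > 0.
      split_ifs at h with h'
      · exact ⟨h', by omega⟩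
      · omega
    · rintro ⟨u, hu, v, hv, w, hw, h', h⟩
      exact ⟨_, ⟨u, hu, rfl⟩, _, ⟨v, hv, rfl⟩, _, ⟨w, hw, rfl⟩, by
        simp only [hf0, hf2, if_pos h']; omega⟩
  obtain ⟨τ₀, σ, hx, hτ₀, hσ⟩ := hp I rfl hU
  refine wp_seq_of (wp_build hb hG hκ hV hT h0 hκG hmark hfresh) ?_
  rintro τ1 t1 _ hF1 ⟨g1, g2, g3, g4, g5⟩
  have hm30 : t1.mem 30 = s.mem 30 := hF1.mem _ (by simp [buildBody])
  refine wp_seq (wp_call (by norm_num) (by norm_num) (by norm_num) hW' hVB h0 hκG hW hx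
    (by rw [hF1.reg _ (by norm_num) (by simp [buildBody]), hG])
    (by rw [hF1.reg _ (by norm_num) (by simp [buildBody]), hκ])
    (by rw [hF1.reg _ (by norm_num) (by simp [buildBody]), hb.size])
    (by omega) ?_ (fun l hl x hx => (hU l hl x hx).trans hUV) ?_)
  · intro m z
    rcases m with _ | _ | _ | m
    · rw [g2]; exact (arrayOf_map_range S f0 z).symm
    · rw [g3]; exact (arrayOf_map_range S fb z).symm
    · rw [g4]; exact (arrayOf_map_range S f2 z).symm
    · rw [hF1.mem _ (by simp [buildBody]; omega), hfresh _ (by omega)]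
      simp [arrayOf]
  intro τ2 hτ2 t2 hres hcell hF2
  have hm30' : t2.mem 30 = s.mem 30 := by
    rw [hF2.mem _ (Cmd.keepsMem_call (by norm_num)), hm30]
  have hcells : ∀ m, ∀ z, z % G ≠ κ → t2.mem m z = s.mem m z := fun m z hz => by
    rw [hcell m z hz, g5 m z hz]
  have hdone : t2.reg vRes ≠ 1 → ∀ u < S, ∀ v < S, ∀ w < S, fa u + fb v + fc w = T →
      t2.mem 30 (fa u) = 1 := by
    intro h u hu v hv w hw hsum
    rw [hm30']
    refine (hmark _).resolve_left fun h' => h ?_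
    rw [hres, hσ, hans]
    exact ⟨u, hu, v, hv, w, hw, h', hsum⟩
  -- Acceptance means the value 1 exactly, so two strict comparisons are needed; every other value
  -- is a rejection.
  refine wp_ifLt (hp := fun h2 => wp_ifLt (hp := fun h1 => ?_) (hq := fun h1 => wp_skip ?_))
    (hq := fun h2 => wp_skip ?_)
  · have hres1 : t2.reg vRes = 1 := by simp at h1 h2; omega
    have hb2 : Blocks t2 S fa fb fc := hb.congr
      (by simp only [List.mem_cons, List.not_mem_nil, or_false, forall_eq_or_imp, forall_eq]
          refine ⟨?_, ?_, ?_, ?_⟩ <;> rw [hF2.reg _ (by norm_num) (by simp)] <;>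
          exact hF1.reg _ (by norm_num) (by simp [buildBody]))
      (by simp only [List.mem_cons, List.not_mem_nil, or_false, forall_eq_or_imp, forall_eq]
          refine ⟨?_, ?_, ?_⟩ <;> rw [hF2.mem _ (Cmd.keepsMem_call (by norm_num))] <;>
          exact hF1.mem _ (by simp [buildBody]))
    refine wp_mono (wp_markLoop hb2 (T := T) ?_) ?_
    · rw [hF2.reg _ (by norm_num) (by simp), hF1.reg _ (by norm_num) (by simp [buildBody]), hT]
    · rintro τ3 t3 _ hF3 ⟨hτ3, h3⟩
      rw [hm30'] at h3
      have hfound : ∀ u < S, ∀ v < S, ∀ w < S, fa u + fb v + fc w = T → t3.mem 30 (fa u) = 1 := by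
        intro u hu v hv w hw hsum
        rw [h3, if_pos ⟨v, hv, w, hw, by omega⟩]
      refine ⟨fun z => ?_, fun z hz => ?_, fun z hz => ?_, hfound, Or.inr ⟨?_, ?_⟩,
        fun m hm z hz => ?_⟩
      · rw [h3]; split_ifs
        exacts [Or.inr rfl, hmark z]
      · rw [h3]; split_ifs
        exacts [rfl, hz]
      · rw [h3] at hz; split_ifs at hz with h
        exacts [Or.inr h, Or.inl hz]
      · simp only [Ex.cost_reg, Ex.cost_const] at hτ3
        have e : S * (S * (30 + 7) + 4 + 7) = S * (S * 37 + 11) := by ring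
        omega
      · obtain ⟨u, hu, v, hv, w, hw, h', hsum⟩ := hans.1 (hσ.1 (hres ▸ hres1))
        exact ⟨u, hu, h', hfound u hu v hv w hw hsum⟩
      · rw [hF3.mem _ (by simp [markLoop, markBody]; omega), hcells m z hz]
  · have hres1 : t2.reg vRes ≠ 1 := by simp at h1 h2; omega
    refine ⟨by rwa [hm30'], by rw [hm30']; exact fun _ h => h,
      by rw [hm30']; exact fun _ h => Or.inl h, hdone hres1, Or.inl ?_, fun m _ => hcells m⟩
    simp only [Ex.cost_reg, Ex.cost_const]; omega
  · have hres1 : t2.reg vRes ≠ 1 := by simp at h2; omega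
    refine ⟨by rwa [hm30'], by rw [hm30']; exact fun _ h => h,
      by rw [hm30']; exact fun _ h => Or.inl h, hdone hres1, Or.inl ?_, fun m _ => hcells m⟩
    simp only [Ex.cost_reg, Ex.cost_const]; omega

end WordRAM

namespace WordRAM

/-! ### All triples of blocks -/

/-- Handle the triple of blocks number `vKap` if the ranges of its blocks admit a solution. -/
def coreBody (p : Cmd) : Cmd :=
  .assign vI (.reg vRow + .reg vKap / (.reg vG * .reg vG) * .reg vS) ;;
  .assign vJ (.reg vRow + .reg vKap / .reg vG % .reg vG * .reg vS) ;;
  .assign vK (.reg vRow + .reg vKap % .reg vG * .reg vS) ;;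
  .ifLt (.load 10 (.reg vI) + .load 11 (.reg vJ) + .load 12 (.reg vK)) (.reg vT + .const 1)
    (.ifLt (.reg vT) (.load 10 (.reg vI + .reg vS - .const 1) +
        .load 11 (.reg vJ + .reg vS - .const 1) + .load 12 (.reg vK + .reg vS - .const 1) +
        .const 1) (handle p) .skip) .skip

def core (p : Cmd) : Cmd := .forLoop vKap vGGG (coreBody p)

/-- The ranges of the blocks of triple number `κ` admit a solution of `x + y + z = T`. -/
def Rel (S g : ℕ) (a b c : ℕ → ℤ) (T : ℤ) (κ : ℕ) : Prop :=
  a (κ / (g * g) * S) + b (κ / g % g * S) + c (κ % g * S) ≤ T ∧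
  T ≤ a (κ / (g * g) * S + (S - 1)) + b (κ / g % g * S + (S - 1)) + c (κ % g * S + (S - 1))

-- If one triple of blocks precedes another strictly in all three coordinates, the maxima of its
-- blocks are smaller than the corresponding minima of the other. Then T cannot lie in both ranges,
-- so the triples in question are pairwise incomparable and `card_incomparable_le` applies.
open Classical in
theorem card_rel_le {S g : ℕ} (hS : 1 ≤ S) {a b c : ℕ → ℤ} {T : ℤ}
    (ha : ∀ u v, u < v → v < g * S → a u < a v) (hb : ∀ u v, u < v → v < g * S → b u < b v)
    (hc : ∀ u v, u < v → v < g * S → c u < c v) :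
    ((Finset.range (g ^ 3)).filter (Rel S g a b c T)).card ≤ 4 * g ^ 2 := by
  rcases Nat.eq_zero_or_pos g with rfl | hg
  · simp
  set φ : ℕ → ℕ × ℕ × ℕ := fun κ => (κ / (g * g), κ / g % g, κ % g) with hφ
  -- The expansion of κ in base g; its three digits number the blocks.
  have hdec : ∀ κ, κ = κ / (g * g) * (g * g) + (κ / g % g) * g + κ % g := by
    intro κ
    have h1 := Nat.div_add_mod κ g
    have h2 := Nat.div_add_mod (κ / g) g
    rw [Nat.div_div_eq_div_mul] at h2
    calc κ = g * (κ / g) + κ % g := h1.symm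
      _ = g * (g * (κ / (g * g)) + κ / g % g) + κ % g := by rw [h2]
      _ = _ := by ring
  have hinj : Function.Injective φ := by
    intro κ κ' h
    simp only [hφ, Prod.mk.injEq] at h
    rw [hdec κ, hdec κ', h.1, h.2.1, h.2.2]
  rw [← Finset.card_image_of_injective _ hinj]
  have hlt : ∀ κ < g ^ 3, κ / (g * g) < g := by
    intro κ h
    rw [Nat.div_lt_iff_lt_mul (by positivity)]
    calc κ < g ^ 3 := h
      _ = _ := by ring
  have hstep : ∀ {i i' : ℕ}, i < i' → i * S + (S - 1) < i' * S := by
    intro i i' h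
    have : (i + 1) * S ≤ i' * S := Nat.mul_le_mul_right _ h
    rw [add_mul] at this; omega
  have hend : ∀ {i : ℕ}, i < g → i * S < g * S := fun h => Nat.mul_lt_mul_of_pos_right h hS
  refine card_incomparable_le g _ ?_ ?_
  · simp only [Finset.mem_image, Finset.mem_filter, Finset.mem_range]
    rintro x ⟨κ, ⟨h, -⟩, rfl⟩
    exact ⟨hlt κ h, Nat.mod_lt _ hg, Nat.mod_lt _ hg⟩
  · simp only [Finset.mem_image, Finset.mem_filter, Finset.mem_range]
    rintro x ⟨κ, ⟨h, hr⟩, rfl⟩ y ⟨κ', ⟨h', hr'⟩, rfl⟩ h1 h2 h3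
    simp only [hφ] at h1 h2 h3
    have e1 := ha _ _ (hstep h1) (hend (hlt κ' h'))
    have e2 := hb _ _ (hstep h2) (hend (Nat.mod_lt _ hg))
    have e3 := hc _ _ (hstep h3) (hend (Nat.mod_lt _ hg))
    have := hr.2
    have := hr'.1
    omega

variable {M : Bounds} {τ : ℕ} {s : State}

/-- The registers and arrays describe three strictly increasing lists `a`, `b`, `c` of `g * S`
numbers in `[0, V)`, in blocks of size `S`. -/
structure SortedInput (s : State) (S g : ℕ) (row V T : ℤ) (a b c : ℕ → ℤ) : Prop where
  size : s.reg vS = S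
  blocks : s.reg vG = g
  cube : s.reg vGGG = (g ^ 3 : ℕ)
  base : s.reg vRow = row
  bound : s.reg vV = V
  target : s.reg vT = T
  fst : ∀ u < g * S, s.mem 10 (row + u) = a u
  snd : ∀ u < g * S, s.mem 11 (row + u) = b u
  thd : ∀ u < g * S, s.mem 12 (row + u) = c u

theorem SortedInput.congr {s t : State} {S g : ℕ} {row V T : ℤ} {a b c : ℕ → ℤ}
    (h : SortedInput s S g row V T a b c)
    (hr : ∀ r ∈ [vS, vG, vGGG, vRow, vV, vT], t.reg r = s.reg r)
    (hm : ∀ m ∈ [10, 11, 12], t.mem m = s.mem m) : SortedInput t S g row V T a b c := by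
  simp only [List.mem_cons, List.not_mem_nil, or_false, forall_eq_or_imp, forall_eq] at hr hm
  obtain ⟨h1, h2, h3, h4, h5, h6, h7, h8, h9⟩ := h
  constructor <;> simpa only [hr, hm]

structure StrictBelow (n : ℕ) (V : ℤ) (a : ℕ → ℤ) : Prop where
  lt : ∀ u v, u < v → v < n → a u < a v
  nonneg : ∀ u < n, 0 ≤ a u
  below : ∀ u < n, a u < V

theorem StrictBelow.inj {n : ℕ} {V : ℤ} {a : ℕ → ℤ} (h : StrictBelow n V a) {u v : ℕ} (hu : u < n)
    (hv : v < n) (e : a u = a v) : u = v := by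
  rcases lt_trichotomy u v with h1 | h1 | h1
  · exact absurd e (h.lt _ _ h1 hv).ne
  · exact h1
  · exact absurd e (h.lt _ _ h1 hu).ne'

theorem StrictBelow.mono {n : ℕ} {V : ℤ} {a : ℕ → ℤ} (h : StrictBelow n V a) {u v : ℕ}
    (huv : u ≤ v) (hv : v < n) : a u ≤ a v := by
  rcases huv.lt_or_eq with h1 | rfl
  exacts [(h.lt _ _ h1 hv).le, le_rfl]

/-- The number of elements that are not marked. -/
def unmarked (n : ℕ) (a : ℕ → ℤ) (H : ℤ → ℤ) : ℕ :=
  ((Finset.range n).filter fun u => H (a u) = 0).card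

theorem unmarked_le {n : ℕ} {a : ℕ → ℤ} {H H' : ℤ → ℤ} (h0 : ∀ z, H z = 0 ∨ H z = 1)
    (h : ∀ z, H z = 1 → H' z = 1) : unmarked n a H' ≤ unmarked n a H := by
  refine Finset.card_le_card fun u hu => ?_
  simp only [Finset.mem_filter] at hu ⊢
  exact ⟨hu.1, (h0 _).resolve_right fun h1 => by rw [h _ h1] at hu; simp at hu⟩

/-- The number of unmarked elements serves as a potential; a new mark lowers it, so each quadratic
search is charged to a different element. -/
theorem unmarked_lt {n : ℕ} {a : ℕ → ℤ} {H H' : ℤ → ℤ} (h0 : ∀ z, H z = 0 ∨ H z = 1)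
    (h : ∀ z, H z = 1 → H' z = 1) {u : ℕ} (hu : u < n) (h1 : H (a u) = 0) (h2 : H' (a u) = 1) :
    unmarked n a H' + 1 ≤ unmarked n a H := by
  refine Finset.card_lt_card ⟨fun u hu => ?_, fun hsub => ?_⟩
  · simp only [Finset.mem_filter] at hu ⊢
    exact ⟨hu.1, (h0 _).resolve_right fun h1 => by rw [h _ h1] at hu; simp at hu⟩
  · have := hsub (Finset.mem_filter.2 ⟨Finset.mem_range.2 hu, h1⟩)
    rw [Finset.mem_filter, h2] at this
    simp at this

-- Completeness: the triple of blocks that contains a solution has T in its range, so it is handled,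
-- and afterwards its first element is marked. Soundness: every mark has the form T - b - c. The
-- time bound is amortised over the marks.
open Classical in
theorem wp_core {p : Cmd} {W' S U t₀ g : ℕ} (hp : SolvesAt p W' S U t₀) (hS : 1 ≤ S) {V' : ℤ}
    (hW' : (W' : ℤ) ≤ V') (hUV : (U : ℤ) ≤ V') (hVB : V' ≤ M.B) {row V T : ℤ}
    (hW : V' * (g ^ 3 : ℕ) + (g ^ 3 : ℕ) ≤ M.W) {a b c : ℕ → ℤ}
    (hs : SortedInput s S g row V T a b c)
    (hmark : ∀ z, s.mem 30 z = 0) (hfresh : ∀ m ≥ 100, ∀ z, s.mem m z = 0)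
    (hTV : T < V) (hT0 : 0 ≤ T) (hVU : V + S ≤ U) (hTU : T + V ≤ U) (hrow : 0 ≤ row)
    (hrowB : row + (g * S : ℕ) ≤ M.B)
    (ha : StrictBelow (g * S) V a) (hb : StrictBelow (g * S) V b) (hc : StrictBelow (g * S) V c) :
    wp M (core p) τ s fun τ' t =>
      τ' ≤ τ + (g ^ 3 * 150 + 4 * g ^ 2 * (S * 77 + 3 * t₀ + p.regBound + 30) +
        g * S * (S * (S * 37 + 11) + 4) + 4) ∧
      ∀ u < g * S, (0 < t.mem 30 (a u) ↔
        ∃ v < g * S, ∃ w < g * S, a u + b v + c w = T) := by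
  set c2 := S * 77 + 3 * t₀ + p.regBound + 30 with hc2
  set c3 := S * (S * 37 + 11) + 4 with hc3
  set R : ℕ → ℕ := fun κ => ((Finset.range κ).filter (Rel S g a b c T)).card with hR
  have hRs : ∀ κ, R (κ + 1) = R κ + if Rel S g a b c T κ then 1 else 0 := by
    intro κ
    simp only [hR, Finset.range_add_one, Finset.filter_insert]
    split_ifs
    · rw [Finset.card_insert_of_notMem (by simp)]
    · rfl
  have hend : ∀ {i : ℕ}, i < g → ∀ {u : ℕ}, u < S → i * S + u < g * S := by
    intro i h u hu
    have : (i + 1) * S ≤ g * S := Nat.mul_le_mul_right _ h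
    rw [add_mul] at this; omega
  -- The time plus `c3` times the number of unmarked elements grows by at most 150 per triple and by
  -- a further `c2` per admissible triple, since a quadratic search costs at most `c3` and lowers
  -- the potential. The last clause says that the residue classes of the rounds to come are
  -- untouched.
  refine wp_forLoop (g ^ 3) (fun κ τ' t =>
    τ' + c3 * unmarked (g * S) a (t.mem 30) ≤ τ + 3 + κ * 150 + R κ * c2 + g * S * c3 ∧
    (∀ z, t.mem 30 z = 0 ∨ t.mem 30 z = 1) ∧
    (∀ z, t.mem 30 z = 1 → ∃ v < g * S, ∃ w < g * S, z = T - b v - c w) ∧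
    (∀ κ' < κ, ∀ u < S, ∀ v < S, ∀ w < S,
      a (κ' / (g * g) * S + u) + b (κ' / g % g * S + v) + c (κ' % g * S + w) = T →
      t.mem 30 (a (κ' / (g * g) * S + u)) = 1) ∧
    ∀ m ≥ 100, ∀ κ' : ℕ, κ ≤ κ' → κ' < g ^ 3 → ∀ z : ℤ, t.mem m (z * (g ^ 3 : ℕ) + κ') = 0)
    (hki := by simp [coreBody, handle, buildBody, markLoop, markBody])
    (hkn := by simp [coreBody, handle, buildBody, markLoop, markBody])
    (hN := hs.cube) (h0 := ?_) (hstep := ?_) (hQ := ?_)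
  · refine ⟨?_, fun z => Or.inl (hmark z), fun z hz => ?_, fun κ' h => by omega,
      fun m hm κ' _ _ z => hfresh m hm _⟩
    · have : unmarked (g * S) a (s.mem 30) ≤ g * S :=
        (Finset.card_filter_le _ _).trans (by simp)
      have := Nat.mul_le_mul_left c3 this
      simp only [State.mem_setReg]
      rw [mul_comm c3 (g * S)] at this
      omega
    · simp only [State.mem_setReg, hmark] at hz; omega
  · rintro κ hκ τ' t hbd hF htκ ⟨h1, h2, h3, h4, h5⟩
    have hg : 0 < g := by
      rcases Nat.eq_zero_or_pos g with rfl | h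
      · simp at hκ
      · exact h
    have hi : κ / (g * g) < g := by
      rw [Nat.div_lt_iff_lt_mul (by positivity)]
      calc κ < g ^ 3 := hκ
        _ = _ := by ring
    have hj : κ / g % g < g := Nat.mod_lt _ hg
    have hk : κ % g < g := Nat.mod_lt _ hg
    set i := κ / (g * g) with hidef
    set j := κ / g % g with hjdef
    set k := κ % g with hkdef
    have ht : SortedInput t S g row V T a b c := hs.congr
      (by simp only [List.mem_cons, List.not_mem_nil, or_false, forall_eq_or_imp, forall_eq]
          refine ⟨?_, ?_, ?_, ?_, ?_, ?_⟩ <;> exact hF.reg _ (by norm_num)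
            (by simp [coreBody, handle, buildBody, markLoop, markBody]))
      (by simp only [List.mem_cons, List.not_mem_nil, or_false, forall_eq_or_imp, forall_eq]
          refine ⟨?_, ?_, ?_⟩ <;> exact hF.mem _
            (by simp [coreBody, handle, buildBody, markLoop, markBody, Cmd.keepsMem_call]))
    have hbnd : ∀ {x : ℕ}, x < g → |row + (x : ℤ) * S| ≤ (M.B : ℤ) := by
      intro x hx
      have := hend hx hS
      rw [abs_of_nonneg (by positivity)]
      have : ((x * S + 0 : ℕ) : ℤ) ≤ (g * S : ℕ) := by exact_mod_cast this.le
      push_cast at this hrowB ⊢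
      linarith
    have ei : (t.reg vKap / (t.reg vG * t.reg vG) : ℤ) = (i : ℕ) := by
      rw [htκ, ht.blocks, hidef]; push_cast; rfl
    have ej : (t.reg vKap / t.reg vG % t.reg vG : ℤ) = (j : ℕ) := by
      rw [htκ, ht.blocks, hjdef]; push_cast; rfl
    have ek : (t.reg vKap % t.reg vG : ℤ) = (k : ℕ) := by
      rw [htκ, ht.blocks, hkdef]; push_cast; rfl
    refine wp_seq (wp_assign (hv := fun _ => ?_) (h := ?_))
    · simpa [ei, ht.size, ht.base] using hbnd hi
    simp only [Ex.eval_add, Ex.eval_mul, Ex.eval_div, Ex.eval_reg, ei, ht.base, ht.size]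
    refine wp_seq (wp_assign (hv := fun _ => ?_) (h := ?_))
    · simpa [ej, ht.size, ht.base] using hbnd hj
    simp only [Ex.eval_add, Ex.eval_mul, Ex.eval_div, Ex.eval_mod, Ex.eval_reg, State.reg_setReg]
    norm_num only [if_false]
    rw [ej, ht.base, ht.size]
    refine wp_seq (wp_assign (hv := fun _ => ?_) (h := ?_))
    · simpa [ek, ht.size, ht.base] using hbnd hk
    simp only [Ex.eval_add, Ex.eval_mul, Ex.eval_mod, Ex.eval_reg, State.reg_setReg]
    norm_num only [if_false]
    rw [ek, ht.base, ht.size]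
    set t' := ((t.setReg vI (row + (i : ℤ) * S)).setReg vJ (row + (j : ℤ) * S)).setReg vK
      (row + (k : ℤ) * S) with ht'
    have cell : ∀ (x u : ℕ), row + (x : ℤ) * S + u = row + ((x * S + u : ℕ) : ℤ) := by
      intro x u; push_cast; ring
    have hB : Blocks t' S (fun u => a (i * S + u)) (fun u => b (j * S + u))
        (fun u => c (k * S + u)) := by
      refine ⟨by simp [ht', ht.size], fun u hu => ?_, fun u hu => ?_, fun u hu => ?_⟩
      · rw [← ht.fst _ (hend hi hu), ← cell]; simp [ht']
      · rw [← ht.snd _ (hend hj hu), ← cell]; simp [ht']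
      · rw [← ht.thd _ (hend hk hu), ← cell]; simp [ht']
    have lo1 : t'.mem 10 (t'.reg vI) = a (i * S) := by simpa using hB.fst 0 hS
    have lo2 : t'.mem 11 (t'.reg vJ) = b (j * S) := by simpa using hB.snd 0 hS
    have lo3 : t'.mem 12 (t'.reg vK) = c (k * S) := by simpa using hB.thd 0 hS
    have eS : t'.reg vS = S := hB.size
    have last : ∀ x : ℤ, x + S - 1 = x + ((S - 1 : ℕ) : ℤ) := by
      intro x; push_cast [Nat.cast_sub hS]; ring
    have hi1 : t'.mem 10 (t'.reg vI + t'.reg vS - 1) = a (i * S + (S - 1)) := by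
      rw [eS, last]; exact hB.fst (S - 1) (by omega)
    have hi2 : t'.mem 11 (t'.reg vJ + t'.reg vS - 1) = b (j * S + (S - 1)) := by
      rw [eS, last]; exact hB.snd (S - 1) (by omega)
    have hi3 : t'.mem 12 (t'.reg vK + t'.reg vS - 1) = c (k * S + (S - 1)) := by
      rw [eS, last]; exact hB.thd (S - 1) (by omega)
    have eT : t'.reg vT = T := by simp [ht', ht.target]
    -- A triple whose ranges exclude T contains no solution, by monotonicity within the blocks, so
    -- skipping it preserves the invariant.
    have keep : ¬ Rel S g a b c T κ → ∀ τ'', τ'' ≤ τ' + 120 →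
        τ'' + 6 + c3 * unmarked (g * S) a (t'.mem 30) ≤
          τ + 3 + (κ + 1) * 150 + R (κ + 1) * c2 + g * S * c3 ∧
        (∀ z, t'.mem 30 z = 0 ∨ t'.mem 30 z = 1) ∧
        (∀ z, t'.mem 30 z = 1 → ∃ v < g * S, ∃ w < g * S, z = T - b v - c w) ∧
        (∀ κ' < κ + 1, ∀ u < S, ∀ v < S, ∀ w < S,
          a (κ' / (g * g) * S + u) + b (κ' / g % g * S + v) + c (κ' % g * S + w) = T →
          t'.mem 30 (a (κ' / (g * g) * S + u)) = 1) ∧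
        ∀ m ≥ 100, ∀ κ' : ℕ, κ + 1 ≤ κ' → κ' < g ^ 3 → ∀ z : ℤ,
          t'.mem m (z * (g ^ 3 : ℕ) + κ') = 0 := by
      intro hnr τ'' hτ''
      refine ⟨?_, h2, h3, fun κ' hκ' u hu v hv w hw hsum => ?_, fun m hm κ' hκ' => h5 m hm κ' (by omega)⟩
      · rw [hRs, if_neg hnr, add_zero]
        show τ'' + 6 + c3 * unmarked (g * S) a (t.mem 30) ≤ _
        omega
      · rcases Nat.lt_succ_iff_lt_or_eq.1 hκ' with h | rfl
        · exact h4 κ' h u hu v hv w hw hsum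
        · refine (hnr ⟨?_, ?_⟩).elim
          · have := ha.mono (Nat.le_add_right (i * S) u) (hend hi hu)
            have := hb.mono (Nat.le_add_right (j * S) v) (hend hj hv)
            have := hc.mono (Nat.le_add_right (k * S) w) (hend hk hw)
            linarith
          · have := ha.mono (show i * S + u ≤ i * S + (S - 1) by omega) (hend hi (by omega))
            have := hb.mono (show j * S + v ≤ j * S + (S - 1) by omega) (hend hj (by omega))
            have := hc.mono (show k * S + w ≤ k * S + (S - 1) by omega) (hend hk (by omega))
            linarith
    have hrel : Rel S g a b c T κ ↔ a (i * S) + b (j * S) + c (k * S) ≤ T ∧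
      T ≤ a (i * S + (S - 1)) + b (j * S + (S - 1)) + c (k * S + (S - 1)) := Iff.rfl
    refine wp_ifLt (hp := fun hlt => wp_ifLt (hp := fun hlt' => ?_) (hq := fun hlt' => wp_skip ?_))
      (hq := fun hlt => wp_skip ?_)
    · simp only [Ex.eval_add, Ex.eval_load, Ex.eval_reg, Ex.eval_const, Ex.eval_sub, lo1, lo2, lo3,
        hi1, hi2, hi3, eT] at hlt hlt'
      have hr : Rel S g a b c T κ := hrel.2 ⟨by omega, by omega⟩
      refine wp_mono (wp_handle hp hW' hUV hVB (G := (g ^ 3 : ℕ)) (κ := κ) (V := V) (T := T) hW hB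
        (by simp [ht', ht.cube]) (by simp [ht', htκ]) (by simp [ht', ht.bound]) eT (by omega)
        (by exact_mod_cast hκ) h2 (fun m hm z => h5 m hm κ le_rfl hκ z) hTV hT0 hVU hTU
        (fun u hu => ⟨ha.nonneg _ (hend hi hu), ha.below _ (hend hi hu)⟩)
        (fun u hu => ⟨hb.nonneg _ (hend hj hu), hb.below _ (hend hj hu)⟩)
        (fun u hu => ⟨hc.nonneg _ (hend hk hu), hc.below _ (hend hk hu)⟩)
        (fun u hu v hv h => by have := ha.inj (hend hi hu) (hend hi hv) h; omega)
        (fun u hu v hv h => by have := hb.inj (hend hj hu) (hend hj hv) h; omega)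
        (fun u hu v hv h => by have := hc.inj (hend hk hu) (hend hk hv) h; omega)) ?_
      rintro τ'' t2 _ _ ⟨g1, g2, g3, g4, g5, g6⟩
      refine ⟨?_, g1, fun z hz => ?_, fun κ' hκ' u hu v hv w hw hsum => ?_,
        fun m hm κ' hκ' hκ'' z => ?_⟩
      · rw [hRs, if_pos hr]
        simp only [State.mem_setReg]
        have e : (R κ + 1) * c2 = R κ * c2 + c2 := by ring
        rw [e]
        simp only [Ex.cost_add, Ex.cost_mul, Ex.cost_div, Ex.cost_mod, Ex.cost_reg, Ex.cost_const,
          Ex.cost_sub, Ex.cost_load] at g5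
        rcases g5 with g5 | ⟨g5, u, hu, hu0, hu1⟩
        · have : c3 * unmarked (g * S) a (t2.mem 30) ≤ c3 * unmarked (g * S) a (t.mem 30) :=
            Nat.mul_le_mul_left c3 (unmarked_le (n := g * S) (a := a) h2 g2)
          omega
        · have : c3 * (unmarked (g * S) a (t2.mem 30) + 1) ≤ c3 * unmarked (g * S) a (t.mem 30) :=
            Nat.mul_le_mul_left c3 (unmarked_lt (n := g * S) (a := a) h2 g2 (hend hi hu) hu0 hu1)
          rw [mul_add, mul_one] at this
          omega
      · rcases g3 z hz with h | ⟨v, hv, w, hw, h⟩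
        · exact h3 z h
        · exact ⟨_, hend hj hv, _, hend hk hw, h⟩
      · rcases Nat.lt_succ_iff_lt_or_eq.1 hκ' with h | rfl
        · exact g2 _ (h4 κ' h u hu v hv w hw hsum)
        · exact g4 u hu v hv w hw hsum
      · rw [State.mem_setReg, g6 m hm]
        · exact h5 m hm κ' (by omega) hκ'' z
        -- The cell belongs to a later round, hence to another residue class modulo g³.
        · rw [add_comm, Int.add_mul_emod_self_right, Int.emod_eq_of_lt (by omega)
            (by exact_mod_cast hκ'')]
          omega
    · simp only [Ex.eval_add, Ex.eval_load, Ex.eval_reg, Ex.eval_const, Ex.eval_sub, lo1, lo2, lo3,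
        hi1, hi2, hi3, eT] at hlt hlt'
      exact keep (fun h => by have := hrel.1 h; omega) _ (by simp)
    · simp only [Ex.eval_add, Ex.eval_load, Ex.eval_reg, Ex.eval_const, lo1, lo2, lo3, eT] at hlt
      exact keep (fun h => by have := hrel.1 h; omega) _ (by simp)
  · rintro τ' t _ _ _ ⟨h1, h2, h3, h4, -⟩
    refine ⟨?_, fun u hu => ⟨fun h => ?_, ?_⟩⟩
    · have := Nat.mul_le_mul_right c2 (card_rel_le (T := T) hS ha.lt hb.lt hc.lt)
      simp only [hR] at h1
      omega
    · obtain ⟨v, hv, w, hw, h⟩ := h3 _ ((h2 (a u)).resolve_left h.ne')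
      exact ⟨v, hv, w, hw, by omega⟩
    · rintro ⟨v, hv, w, hw, hsum⟩
      have hg : 0 < g := by
        rcases Nat.eq_zero_or_pos g with rfl | h
        · simp at hu
        · exact h
      have lt : ∀ {x}, x < g * S → x / S < g := fun h => by
        rwa [Nat.div_lt_iff_lt_mul hS]
      have e : ∀ x, x / S * S + x % S = x := fun x => by rw [mul_comm]; exact Nat.div_add_mod x S
      -- The number of the triple of blocks that contains the positions u, v, w.
      set κ' := (u / S * g + v / S) * g + w / S with hκ'
      have d1 : κ' / g = u / S * g + v / S := by
        rw [hκ', mul_comm, Nat.mul_add_div hg, Nat.div_eq_of_lt (lt hw), add_zero]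
      have d2 : κ' % g = w / S := by
        rw [hκ', mul_comm, Nat.mul_add_mod, Nat.mod_eq_of_lt (lt hw)]
      have d3 : κ' / g % g = v / S := by
        rw [d1, mul_comm, Nat.mul_add_mod, Nat.mod_eq_of_lt (lt hv)]
      have d4 : κ' / (g * g) = u / S := by
        rw [← Nat.div_div_eq_div_mul, d1, mul_comm, Nat.mul_add_div hg, Nat.div_eq_of_lt (lt hv),
          add_zero]
      have hlt : κ' < g ^ 3 := by
        have l1 := lt hu
        have l2 := lt hv
        have l3 := lt hw
        have : u / S * g + v / S + 1 ≤ g * g := by nlinarith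
        have := Nat.mul_le_mul_right g this
        have e3 : g ^ 3 = g * g * g := by ring
        rw [add_mul, one_mul] at this
        omega
      have := h4 κ' hlt (u % S) (Nat.mod_lt _ hS) (v % S) (Nat.mod_lt _ hS) (w % S)
        (Nat.mod_lt _ hS)
      rw [d2, d3, d4, e, e, e] at this
      rw [this hsum]; norm_num

end WordRAM


/-! ### Linear inequalities as equations between prefixes -/

theorem Int.abs_shiftRight_le (x : ℤ) (n : ℕ) : |x >>> n| ≤ |x| := by
  rw [Int.shiftRight_eq_div_pow]
  exact Int.abs_ediv_le_abs _ _

theorem Int.shiftRight_succ_bounds (x : ℤ) (n : ℕ) :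
    2 * (x >>> (n + 1)) ≤ x >>> n ∧ x >>> n ≤ 2 * (x >>> (n + 1)) + 1 := by
  have h : x >>> (n + 1) = (x >>> n) / 2 := by
    rw [Int.shiftRight_add, Int.shiftRight_eq_div_pow (x >>> n)]; norm_num
  rw [h]; omega

theorem Int.shiftRight_mul_le (x : ℤ) (n : ℕ) : 2 ^ n * (x >>> n) ≤ x := by
  rw [Int.shiftRight_eq_div_pow]
  push_cast
  rw [mul_comm]
  exact Int.ediv_mul_le _ (by positivity)

theorem Int.shiftRight_nonpos_of_lt {x : ℤ} {n : ℕ} (h : x < 2 ^ n) : x >>> n ≤ 0 := by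
  have h1 := Int.shiftRight_mul_le x n
  have h2 : (0 : ℤ) < 2 ^ n := by positivity
  by_contra! h3
  nlinarith

/-- A sum of three numbers is positive iff the sum of some prefixes is `1`, `2` or `3`. -/
theorem Int.sum_pos_iff_prefix {x y z : ℤ} {L : ℕ} (hx : x < 2 ^ L) (hy : y < 2 ^ L)
    (hz : z < 2 ^ L) :
    0 < x + y + z ↔ ∃ n < L, 1 ≤ x >>> n + y >>> n + z >>> n ∧ x >>> n + y >>> n + z >>> n ≤ 3 := by
  constructor
  · intro h
    have hL : x >>> L + y >>> L + z >>> L ≤ 0 := by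
      have := Int.shiftRight_nonpos_of_lt hx
      have := Int.shiftRight_nonpos_of_lt hy
      have := Int.shiftRight_nonpos_of_lt hz
      omega
    classical
    have hex : ∃ n : ℕ, x >>> n + y >>> n + z >>> n ≤ 0 := ⟨L, hL⟩
    have h1 := Nat.find_spec hex
    have h2 := Nat.find_min' hex hL
    -- At the first length whose prefix sum is nonpositive, look one bit back: passing from n + 1 to
    -- n doubles the sum and adds at most one for each of the three numbers. So the sum is positive
    -- there and at most 3.
    rcases hn : Nat.find hex with _ | n
    · rw [hn] at h1; simp at h1; omega
    · have h3 : ¬ (x >>> n + y >>> n + z >>> n ≤ 0) := Nat.find_min hex (by omega)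
      rw [hn] at h1
      have := (Int.shiftRight_succ_bounds x n).2
      have := (Int.shiftRight_succ_bounds y n).2
      have := (Int.shiftRight_succ_bounds z n).2
      exact ⟨n, by omega, by omega, by omega⟩
  -- Prefixes round down, so 2 ^ n times their sum is a lower bound for the full sum.
  · rintro ⟨n, -, h1, -⟩
    have := Int.shiftRight_mul_le x n
    have := Int.shiftRight_mul_le y n
    have := Int.shiftRight_mul_le z n
    have : (0 : ℤ) < 2 ^ n := by positivity
    nlinarith

/-- A digit `d` stands for a sign `d % 2`, a number `d / 2 % 3 + 1` and a prefix length `d / 6`. -/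
def prefixDigit (d : ℕ) (x : ℤ) : ℤ := ((1 - 2 * ((d : ℤ) % 2)) * x) >>> (d / 6)

/-- The third summand carries both constants. For sign 1 the condition u + v + w ≤ 0 becomes -u - v
- w + 1 > 0, whence the added sign; and subtracting the guessed prefix sum makes the right-hand side
of the equation zero. -/
def prefixDigit' (d : ℕ) (x : ℤ) : ℤ :=
  ((1 - 2 * ((d : ℤ) % 2)) * x + (d : ℤ) % 2) >>> (d / 6) - ((d : ℤ) / 2 % 3 + 1)

theorem abs_sign_mul (d : ℕ) (x : ℤ) : |(1 - 2 * ((d : ℤ) % 2)) * x| = |x| := by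
  rcases Int.emod_two_eq_zero_or_one d with h | h <;> rw [h] <;> norm_num

theorem abs_prefixDigit_le (d : ℕ) (x : ℤ) : |prefixDigit d x| ≤ |x| :=
  (Int.abs_shiftRight_le _ _).trans (abs_sign_mul d x).le

theorem abs_prefixDigit'_le (d : ℕ) (x : ℤ) : |prefixDigit' d x| ≤ |x| + 4 := by
  refine (abs_sub _ _).trans ?_
  have h1 := Int.abs_shiftRight_le ((1 - 2 * ((d : ℤ) % 2)) * x + (d : ℤ) % 2) (d / 6)
  have h2 := abs_add_le ((1 - 2 * ((d : ℤ) % 2)) * x) ((d : ℤ) % 2)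
  rw [abs_sign_mul] at h2
  have h3 : |(d : ℤ) % 2| ≤ 1 := by rw [abs_le]; omega
  have h4 : |(d : ℤ) / 2 % 3 + 1| ≤ 3 := by rw [abs_le]; omega
  linarith

/-- Two signs, three prefix sums and L lengths give 6 * L digits. Only the correct truth value σ of
the atom admits a digit that solves the equation, so a guess cannot misstate an atom. -/
theorem exists_prefixDigit_iff {u v w : ℤ} {L : ℕ} (hu : |u| < 2 ^ L) (hv : |v| < 2 ^ L)
    (hw : |w| + 1 < 2 ^ L) (σ : ℕ) (hσ : σ < 2) :
    (∃ d < 6 * L, d % 2 = σ ∧ prefixDigit d u + prefixDigit d v + prefixDigit' d w = 0) ↔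
      (σ = 1 ↔ u + v + w ≤ 0) := by
  rw [abs_lt] at hu hv
  have hw' := abs_lt.1 (show |w| < 2 ^ L - 1 by linarith)
  have key : (σ = 1 ↔ u + v + w ≤ 0) ↔
      0 < (1 - 2 * (σ : ℤ)) * u + (1 - 2 * (σ : ℤ)) * v + ((1 - 2 * (σ : ℤ)) * w + σ) := by
    interval_cases σ <;> norm_num; omega
  rw [key, Int.sum_pos_iff_prefix (L := L) (by interval_cases σ <;> norm_num <;> linarith)
    (by interval_cases σ <;> norm_num <;> linarith)
    (by interval_cases σ <;> norm_num <;> linarith)]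
  constructor
  · rintro ⟨d, hd, h1, h2⟩
    have e : (d : ℤ) % 2 = σ := by omega
    simp only [prefixDigit, prefixDigit', e] at h2
    refine ⟨d / 6, by omega, ?_, ?_⟩ <;> omega
  · rintro ⟨n, hn, h1, h2⟩
    set F := ((1 - 2 * (σ : ℤ)) * u) >>> n + ((1 - 2 * (σ : ℤ)) * v) >>> n +
      ((1 - 2 * (σ : ℤ)) * w + σ) >>> n with hF
    -- The digit that stands for the prefix length n, the prefix sum F and the sign σ.
    refine ⟨6 * n + 2 * (F.toNat - 1) + σ, by omega, by omega, ?_⟩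
    have e : ((6 * n + 2 * (F.toNat - 1) + σ : ℕ) : ℤ) % 2 = σ := by omega
    have e2 : (6 * n + 2 * (F.toNat - 1) + σ) / 6 = n := by omega
    have e3 : ((6 * n + 2 * (F.toNat - 1) + σ : ℕ) : ℤ) / 2 % 3 + 1 = F := by omega
    simp only [prefixDigit, prefixDigit', e, e2, e3]
    omega

/-! ### Packing -/

/-- The number with the digits `D 0, …, D (K - 1)` in base `B`. -/
def pack (B : ℤ) : ℕ → (ℕ → ℤ) → ℤ
  | 0, _ => 0
  | K + 1, D => D 0 + B * pack B K fun e => D (e + 1)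

theorem pack_add (B : ℤ) (K : ℕ) (D D' : ℕ → ℤ) :
    pack B K (fun e => D e + D' e) = pack B K D + pack B K D' := by
  induction K generalizing D D' with
  | zero => simp [pack]
  | succ K ih => simp only [pack, ih]; ring

/-- The lowest digit is divisible by B and smaller than B in absolute value, hence zero; then B
cancels. Negative digits do no harm. -/
theorem pack_eq_zero_iff {B : ℤ} {K : ℕ} {D : ℕ → ℤ} (h : ∀ e < K, |D e| < B) :
    pack B K D = 0 ↔ ∀ e < K, D e = 0 := by
  induction K generalizing D with
  | zero => simp [pack]
  | succ K ih =>
    have ih' := ih (D := fun e => D (e + 1)) fun e he => h (e + 1) (by omega)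
    simp only [pack]
    constructor
    · intro h0
      have hd : B ∣ D 0 := ⟨-pack B K fun e => D (e + 1), by linarith⟩
      have h1 : D 0 = 0 := Int.eq_zero_of_abs_lt_dvd hd (h 0 (by omega))
      have hB : B ≠ 0 := by have := h 0 (by omega); have := abs_nonneg (D 0); omega
      rw [h1, zero_add] at h0
      have h2 := ih'.1 ((mul_eq_zero.1 h0).resolve_left hB)
      rintro (_ | e) he
      exacts [h1, h2 e (by omega)]
    · intro h0
      rw [h0 0 (by omega), ih'.2 fun e he => h0 (e + 1) (by omega)]; ring

theorem abs_pack_lt {B : ℤ} {K : ℕ} {D : ℕ → ℤ} (hB : 0 ≤ B) (h : ∀ e < K, |D e| < B) :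
    |pack B K D| < B ^ K := by
  induction K generalizing D with
  | zero => simp [pack]
  | succ K ih =>
    have ih' := ih (D := fun e => D (e + 1)) fun e he => h (e + 1) (by omega)
    simp only [pack]
    have h1 := abs_add_le (D 0) (B * pack B K fun e => D (e + 1))
    rw [abs_mul, abs_of_nonneg hB] at h1
    have h2 := h 0 (by omega)
    have h3 : B * |pack B K fun e => D (e + 1)| ≤ B * (B ^ K - 1) :=
      mul_le_mul_of_nonneg_left (by omega) hB
    rw [pow_succ]
    linarith

/-- Independent choices for all atoms combine into one number, whose base Q digits they are. -/
theorem exists_digits {Q : ℕ} (k : ℕ) (f : ℕ → ℕ) (hf : ∀ e < k, f e < Q) :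
    ∃ i < Q ^ k, ∀ e < k, i / Q ^ e % Q = f e := by
  induction k generalizing f with
  | zero => exact ⟨0, by simp, by simp⟩
  | succ k ih =>
    obtain ⟨i, hi, h⟩ := ih (fun e => f (e + 1)) fun e he => hf (e + 1) (by omega)
    have h0 := hf 0 (by omega)
    have hQ : 0 < Q := by omega
    refine ⟨f 0 + Q * i, ?_, ?_⟩
    · rw [pow_succ]
      have : Q * (i + 1) ≤ Q * Q ^ k := Nat.mul_le_mul_left _ hi
      rw [mul_comm (Q ^ k)]; rw [mul_add] at this; omega
    · rintro (_ | e) he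
      · simp [Nat.add_mul_mod_self_left, Nat.mod_eq_of_lt h0]
      · rw [pow_succ', ← Nat.div_div_eq_div_mul, Nat.add_mul_div_left _ _ hQ,
          Nat.div_eq_of_lt h0, zero_add]
        exact h e (by omega)

/-! ### Formulas -/

namespace LinFormula

variable {X : Type}

/-- The linear inequalities in a formula, from left to right. -/
def atoms : LinFormula X → List ((X → ℤ) × ℤ)
  | le c b => [(c, b)]
  | not φ => φ.atoms
  | and φ χ => φ.atoms ++ χ.atoms
  | or φ χ => φ.atoms ++ χ.atoms

/-- The truth value of the formula if `σ (o + e)` is the truth value of its atom number `e`. -/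
def bval : LinFormula X → ℕ → (ℕ → ℤ) → ℤ
  | le _ _, o, σ => σ o
  | not φ, o, σ => 1 - φ.bval o σ
  | and φ χ, o, σ => φ.bval o σ * χ.bval (o + φ.atoms.length) σ
  | or φ χ, o, σ => 1 - (1 - φ.bval o σ) * (1 - χ.bval (o + φ.atoms.length) σ)

theorem bval_eq_or (φ : LinFormula X) (o : ℕ) {σ : ℕ → ℤ} (hσ : ∀ e, σ e = 0 ∨ σ e = 1) :
    φ.bval o σ = 0 ∨ φ.bval o σ = 1 := by
  induction φ generalizing o with
  | le => exact hσ _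
  | not φ ih => rcases ih o with h | h <;> simp [bval, h]
  | and φ χ ih1 ih2 =>
    rcases ih1 o with h | h <;> rcases ih2 (o + φ.atoms.length) with h' | h' <;> simp [bval, h, h']
  | or φ χ ih1 ih2 =>
    rcases ih1 o with h | h <;> rcases ih2 (o + φ.atoms.length) with h' | h' <;> simp [bval, h, h']

/-- With truth values as the integers 0 and 1, a formula becomes a polynomial. It can thus be
evaluated by an expression without branching, and it fits into a digit of a code. -/
theorem bval_eq_one_iff [Fintype X] (φ : LinFormula X) (o : ℕ) {σ : ℕ → ℤ} (v : X → ℤ)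
    (hσ : ∀ e, σ e = 0 ∨ σ e = 1)
    (h : ∀ (e : ℕ) (he : e < φ.atoms.length),
      σ (o + e) = 1 ↔ ∑ x, φ.atoms[e].1 x * v x ≤ φ.atoms[e].2) :
    φ.bval o σ = 1 ↔ φ.Holds v := by
  have split : ∀ (o : ℕ) (φ χ : LinFormula X),
      (∀ (e : ℕ) (he : e < (φ.atoms ++ χ.atoms).length),
        σ (o + e) = 1 ↔ ∑ x, (φ.atoms ++ χ.atoms)[e].1 x * v x ≤ (φ.atoms ++ χ.atoms)[e].2) →
      (∀ (e : ℕ) (he : e < φ.atoms.length),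
        σ (o + e) = 1 ↔ ∑ x, φ.atoms[e].1 x * v x ≤ φ.atoms[e].2) ∧
      ∀ (e : ℕ) (he : e < χ.atoms.length),
        σ (o + φ.atoms.length + e) = 1 ↔ ∑ x, χ.atoms[e].1 x * v x ≤ χ.atoms[e].2 := by
    intro o φ χ h
    refine ⟨fun e he => ?_, fun e he => ?_⟩
    · have := h e (by simp; omega)
      rwa [List.getElem_append_left he] at this
    · have := h (φ.atoms.length + e) (by simp; omega)
      rw [List.getElem_append_right (by omega)] at this
      simpa [add_assoc] using this
  induction φ generalizing o with
  | le c b => simpa [bval, atoms, Holds] using h 0 (by simp [atoms])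
  | not φ ih =>
    have h1 := ih o h
    refine Iff.trans ?_ (not_congr h1)
    rcases φ.bval_eq_or o hσ with h | h <;> simp [bval, h]
  | and φ χ ih1 ih2 =>
    obtain ⟨h1, h2⟩ := split o φ χ h
    refine Iff.trans ?_ (and_congr (ih1 o h1) (ih2 _ h2))
    rcases φ.bval_eq_or o hσ with h | h <;>
      rcases χ.bval_eq_or (o + φ.atoms.length) hσ with h' | h' <;> simp [bval, h, h']
  | or φ χ ih1 ih2 =>
    obtain ⟨h1, h2⟩ := split o φ χ h
    refine Iff.trans ?_ (or_congr (ih1 o h1) (ih2 _ h2))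
    rcases φ.bval_eq_or o hσ with h | h <;>
      rcases χ.bval_eq_or (o + φ.atoms.length) hσ with h' | h' <;> simp [bval, h, h']

end LinFormula

/-! ### The encoding of a formula as an instance of 3-SUM -/

/-- The parameters of the encoding: `k` atoms, the number `Q` of choices for each atom, the base
`B` and an offset. -/
structure Coding (X : Type) where
  ψ : LinFormula X
  Q : ℕ
  B : ℤ
  off : ℤ

namespace Coding

variable {X : Type} (P : Coding X)

/-- The number of atoms. -/
def k : ℕ := P.ψ.atoms.length

/-- The choice for atom number `e`. -/
def dig (i e : ℕ) : ℕ := i / P.Q ^ e % P.Q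

/-- The truth value that is guessed for atom number `e`. -/
def sig (i e : ℕ) : ℤ := (P.dig i e : ℤ) % 2

/-- In the sum of three codes, the digits below k are the equations of the atoms. Digit k, to which
only the first code contributes, vanishes iff the guessed truth values satisfy the formula. Digits k
+ 1 and k + 2 become i - i' and i' - i'', which forces equal choices. -/
def digits₁ (i : ℕ) (u : ℕ → ℤ) (e : ℕ) : ℤ :=
  if e < P.k then prefixDigit (P.dig i e) (u e)
  else if e = P.k then 1 - P.ψ.bval 0 (P.sig i) else if e = P.k + 1 then i else 0

def digits₂ (i : ℕ) (u : ℕ → ℤ) (e : ℕ) : ℤ :=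
  if e < P.k then prefixDigit (P.dig i e) (u e)
  else if e = P.k then 0 else if e = P.k + 1 then -i else i

def digits₃ (i : ℕ) (u : ℕ → ℤ) (e : ℕ) : ℤ :=
  if e < P.k then prefixDigit' (P.dig i e) (u e)
  else if e = P.k then 0 else if e = P.k + 1 then 0 else -i

/-- The offset makes codes nonnegative, as array lookup by value, sorting and the dummies
presuppose; the target becomes 3 * off. -/
def code (D : ℕ → ℤ) : ℤ := P.off + pack P.B (P.k + 3) D

/-- The base is large enough for `L`-bit numbers `u e`, and so is the offset. -/
structure Good (L : ℕ) (H : ℤ) : Prop where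
  Q_eq : P.Q = 6 * L
  H_lt : H + 1 < 2 ^ L
  B_gt : 3 * H + 4 + P.Q ^ P.k < P.B
  off_eq : P.off = P.B ^ (P.k + 3)

variable {P} {L : ℕ} {H : ℤ}

theorem sig_eq_or (i e : ℕ) : P.sig i e = 0 ∨ P.sig i e = 1 := Int.emod_two_eq_zero_or_one _

theorem abs_digits₁_le {i : ℕ} (hi : i < P.Q ^ P.k) {u : ℕ → ℤ} (hu : ∀ e < P.k, |u e| ≤ H)
    (hH : 0 ≤ H) (e : ℕ) : |P.digits₁ i u e| ≤ H + P.Q ^ P.k := by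
  have hi' : (i : ℤ) + 1 ≤ P.Q ^ P.k := by exact_mod_cast hi
  unfold digits₁
  split_ifs with h1 h2 h3
  · linarith [(abs_prefixDigit_le (P.dig i e) (u e)).trans (hu e h1)]
  · rcases P.ψ.bval_eq_or 0 (sig_eq_or (P := P) i) with h | h <;> rw [h] <;> norm_num <;> omega
  · rw [abs_of_nonneg (by omega)]; omega
  · rw [abs_zero]; omega

theorem abs_digits₂_le {i : ℕ} (hi : i < P.Q ^ P.k) {u : ℕ → ℤ} (hu : ∀ e < P.k, |u e| ≤ H)
    (hH : 0 ≤ H) (e : ℕ) : |P.digits₂ i u e| ≤ H + P.Q ^ P.k := by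
  have hi' : (i : ℤ) + 1 ≤ P.Q ^ P.k := by exact_mod_cast hi
  unfold digits₂
  split_ifs with h1 h2 h3
  · linarith [(abs_prefixDigit_le (P.dig i e) (u e)).trans (hu e h1)]
  · rw [abs_zero]; omega
  · rw [abs_neg, abs_of_nonneg (by omega)]; omega
  · rw [abs_of_nonneg (by omega)]; omega

theorem abs_digits₃_le {i : ℕ} (hi : i < P.Q ^ P.k) {u : ℕ → ℤ} (hu : ∀ e < P.k, |u e| ≤ H)
    (hH : 0 ≤ H) (e : ℕ) : |P.digits₃ i u e| ≤ H + 4 + P.Q ^ P.k := by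
  have hi' : (i : ℤ) + 1 ≤ P.Q ^ P.k := by exact_mod_cast hi
  unfold digits₃
  split_ifs with h1 h2 h3
  · have := abs_prefixDigit'_le (P.dig i e) (u e)
    have := hu e h1
    omega
  · rw [abs_zero]; omega
  · rw [abs_zero]; omega
  · rw [abs_neg, abs_of_nonneg (by omega)]; omega

theorem Good.code_bounds (hP : P.Good L H) {D : ℕ → ℤ}
    (hH : 0 ≤ H) (hD : ∀ e, |D e| ≤ H + 4 + P.Q ^ P.k) :
    0 ≤ P.code D ∧ P.code D < 2 * P.off := by
  have h := hP.B_gt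
  have := abs_pack_lt (K := P.k + 3) (D := D) (B := P.B)
    (by have : (0 : ℤ) ≤ (P.Q : ℤ) ^ P.k := by positivity
        omega) fun e _ => (hD e).trans_lt (by omega)
  rw [← hP.off_eq, abs_lt] at this
  unfold code
  omega

/-- Three codes sum to `3 * off` iff they belong to the same choice `i`, and that choice is a
certificate for the formula. -/
theorem Good.code_sum_iff (hP : P.Good L H) (hH : 0 ≤ H) {i i' i'' : ℕ} (hi : i < P.Q ^ P.k)
    (hi' : i' < P.Q ^ P.k) (hi'' : i'' < P.Q ^ P.k) {u v w : ℕ → ℤ} (hu : ∀ e < P.k, |u e| ≤ H)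
    (hv : ∀ e < P.k, |v e| ≤ H) (hw : ∀ e < P.k, |w e| ≤ H) :
    P.code (P.digits₁ i u) + P.code (P.digits₂ i' v) + P.code (P.digits₃ i'' w) = 3 * P.off ↔
      i = i' ∧ i = i'' ∧ P.ψ.bval 0 (P.sig i) = 1 ∧ ∀ e < P.k, prefixDigit (P.dig i e) (u e) +
        prefixDigit (P.dig i e) (v e) + prefixDigit' (P.dig i e) (w e) = 0 := by
  have hB := hP.B_gt
  have l1 : (i : ℤ) + 1 ≤ P.Q ^ P.k := by exact_mod_cast hi
  have l2 : (i' : ℤ) + 1 ≤ P.Q ^ P.k := by exact_mod_cast hi'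
  have l3 : (i'' : ℤ) + 1 ≤ P.Q ^ P.k := by exact_mod_cast hi''
  have e0 : P.code (P.digits₁ i u) + P.code (P.digits₂ i' v) + P.code (P.digits₃ i'' w) =
      3 * P.off ↔ pack P.B (P.k + 3)
        (fun e => P.digits₁ i u e + P.digits₂ i' v e + P.digits₃ i'' w e) = 0 := by
    rw [pack_add, pack_add]; unfold code; constructor <;> intro h <;> linarith
  -- The base exceeds a sum of three digits, not only a single digit, so the equation splits digit
  -- by digit.
  rw [e0, pack_eq_zero_iff]
  · constructor
    · intro h
      have h2 := h (P.k + 1) (by omega)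
      have h3 := h (P.k + 2) (by omega)
      have h1 := h P.k (by omega)
      simp only [digits₁, digits₂, digits₃] at h1 h2 h3
      simp at h1 h2 h3
      obtain rfl : i = i' := by omega
      obtain rfl : i = i'' := by omega
      refine ⟨rfl, rfl, by omega, fun e he => ?_⟩
      have := h e (by omega)
      simpa [digits₁, digits₂, digits₃, he] using this
    · rintro ⟨rfl, rfl, h1, h2⟩ e he
      unfold digits₁ digits₂ digits₃
      split_ifs with h3 h4 h5
      · exact h2 e h3
      · rw [h1]; norm_num
      · ring
      · ring
  · intro e he
    unfold digits₁ digits₂ digits₃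
    split_ifs with h3 h4 h5
    · have a1 := (abs_prefixDigit_le (P.dig i e) (u e)).trans (hu e h3)
      have a2 := (abs_prefixDigit_le (P.dig i' e) (v e)).trans (hv e h3)
      have a3 := abs_prefixDigit'_le (P.dig i'' e) (w e)
      have a4 := hw e h3
      have := abs_add_three (prefixDigit (P.dig i e) (u e)) (prefixDigit (P.dig i' e) (v e))
        (prefixDigit' (P.dig i'' e) (w e))
      omega
    · rcases P.ψ.bval_eq_or 0 (sig_eq_or (P := P) i) with h | h <;> rw [h] <;> norm_num <;> omega
    · rw [abs_lt]; omega
    · rw [abs_lt]; omega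

/-- The formula holds iff some choice is a certificate. -/
theorem Good.holds_iff [Fintype X] (hP : P.Good L H) {u v w : ℕ → ℤ}
    (hu : ∀ e < P.k, |u e| ≤ H) (hv : ∀ e < P.k, |v e| ≤ H) (hw : ∀ e < P.k, |w e| ≤ H)
    (x : X → ℤ) (hx : ∀ (e : ℕ) (he : e < P.k),
      u e + v e + w e = ∑ y, P.ψ.atoms[e].1 y * x y - P.ψ.atoms[e].2) :
    (∃ i < P.Q ^ P.k, P.ψ.bval 0 (P.sig i) = 1 ∧ ∀ e < P.k, prefixDigit (P.dig i e) (u e) +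
        prefixDigit (P.dig i e) (v e) + prefixDigit' (P.dig i e) (w e) = 0) ↔ P.ψ.Holds x := by
  have hHL := hP.H_lt
  have key : ∀ e (he : e < P.k) (σ : ℕ), σ < 2 →
      ((∃ d < P.Q, d % 2 = σ ∧ prefixDigit d (u e) + prefixDigit d (v e) +
        prefixDigit' d (w e) = 0) ↔
      (σ = 1 ↔ ∑ y, P.ψ.atoms[e].1 y * x y ≤ P.ψ.atoms[e].2)) := by
    intro e he σ hσ
    have := hu e he
    have := hv e he
    have := hw e he
    rw [hP.Q_eq, exists_prefixDigit_iff (by omega) (by omega) (by omega) σ hσ, hx e he, sub_nonpos]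
  constructor
  · rintro ⟨i, hi, h1, h2⟩
    refine (P.ψ.bval_eq_one_iff 0 x (sig_eq_or i) fun e he => ?_).1 h1
    -- An atom exists here, so Q = 0 would leave no choice i < Q ^ k.
    have hQ : 0 < P.Q := by
      by_contra h0
      have : P.Q ^ P.k = 0 := by
        rw [show P.Q = 0 by omega]; exact zero_pow (Nat.ne_zero_of_lt he)
      omega
    rw [zero_add, ← (key e he (P.dig i e % 2) (Nat.mod_lt _ two_pos)).1
      ⟨P.dig i e, Nat.mod_lt _ hQ, rfl, h2 e he⟩]
    unfold sig; omega
  · intro h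
    have hex : ∀ e, ∃ d, ∀ he : e < P.k, d < P.Q ∧
        ((d : ℤ) % 2 = 1 ↔ ∑ y, P.ψ.atoms[e].1 y * x y ≤ P.ψ.atoms[e].2) ∧
        prefixDigit d (u e) + prefixDigit d (v e) + prefixDigit' d (w e) = 0 := by
      intro e
      by_cases he : e < P.k
      · by_cases ha : ∑ y, P.ψ.atoms[e].1 y * x y ≤ P.ψ.atoms[e].2
        · obtain ⟨d, h1, h2, h3⟩ := (key e he 1 (by norm_num)).2 (by simpa using ha)
          exact ⟨d, fun _ => ⟨h1, ⟨fun _ => ha, fun _ => by omega⟩, h3⟩⟩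
        · obtain ⟨d, h1, h2, h3⟩ := (key e he 0 (by norm_num)).2 (by simpa using ha)
          exact ⟨d, fun _ => ⟨h1, ⟨fun _ => by omega, fun h => absurd h ha⟩, h3⟩⟩
      · exact ⟨0, fun h => absurd h he⟩
    choose f hf using hex
    obtain ⟨i, hi, hd⟩ := exists_digits P.k f fun e he => (hf e he).1
    refine ⟨i, hi, (P.ψ.bval_eq_one_iff 0 x (sig_eq_or i) fun e he => ?_).2 h, fun e he => ?_⟩
    · rw [zero_add]; unfold sig dig; rw [hd e he]; exact (hf e he).2.1
    · unfold dig; rw [hd e he]; exact (hf e he).2.2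

end Coding

namespace WordRAM

/-! ### Expressions for the codes -/

namespace Ex

def sum (l : List Ex) : Ex := l.foldr (· + ·) (.const 0)

theorem eval_sum (s : State) (l : List Ex) : (sum l).eval s = (l.map (eval s)).sum := by
  induction l with
  | nil => rfl
  | cons a l ih => simp only [List.map_cons, List.sum_cons, ← ih]; rfl

theorem wf_sum {l : List Ex} (h : ∀ e ∈ l, e.Wf) : (sum l).Wf := by
  induction l with
  | nil => trivial
  | cons a l ih =>
    exact (wf_add _ _).2 ⟨h a (by simp), ih fun e he => h e (by simp [he])⟩

/-- `∑ j, c j * f j` -/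
def lin {d : ℕ} (c : Fin d → ℤ) (f : Fin d → Ex) : Ex := sum (List.ofFn fun j => .const (c j) * f j)

theorem eval_lin (s : State) {d : ℕ} (c : Fin d → ℤ) (f : Fin d → Ex) :
    (lin c f).eval s = ∑ j, c j * (f j).eval s := by
  rw [lin, eval_sum, List.map_ofFn, List.sum_ofFn]; rfl

theorem wf_lin {d : ℕ} {c : Fin d → ℤ} {f : Fin d → Ex} (h : ∀ j, (f j).Wf) : (lin c f).Wf := by
  refine wf_sum fun e he => ?_
  obtain ⟨j, rfl⟩ := (List.mem_ofFn' _ _).1 he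
  simp [h]

/-- `reg r ^ n` -/
def pow (r : ℕ) : ℕ → Ex
  | 0 => .const 1
  | n + 1 => pow r n * .reg r

theorem eval_pow (s : State) (r n : ℕ) : (pow r n).eval s = s.reg r ^ n := by
  induction n with
  | zero => simp [pow]
  | succ n ih => simp [pow, ih, pow_succ]

theorem wf_pow {r : ℕ} (hr : r < 100) (n : ℕ) : (pow r n).Wf := by
  induction n with
  | zero => trivial
  | succ n ih => simp [pow, ih, hr]

/-- The number of the choice in round `vZ` of the loop over choices and vectors of the list `q`. -/
def choice (q : ℕ) : Ex := .reg vZ / .reg q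

def dig (q e : ℕ) : Ex := choice q / pow vQ e % .reg vQ

/-- Coordinate number `j` of the vector in round `vZ`. -/
def coord (q d j : ℕ) : Ex := .load q (.reg vZ % .reg q * .const d + .const j)

def prefixDigit (d x : Ex) : Ex :=
  .op .shr ((.const 1 - .const 2 * (d % .const 2)) * x) (d / .const 6)

def prefixDigit' (d x : Ex) : Ex :=
  .op .shr ((.const 1 - .const 2 * (d % .const 2)) * x + d % .const 2) (d / .const 6) -
    (d / .const 2 % .const 3 + .const 1)

def bval {X : Type} : LinFormula X → ℕ → (ℕ → Ex) → Ex
  | .le _ _, o, σ => σ o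
  | .not φ, o, σ => .const 1 - bval φ o σ
  | .and φ χ, o, σ => bval φ o σ * bval χ (o + φ.atoms.length) σ
  | .or φ χ, o, σ => .const 1 - (.const 1 - bval φ o σ) *
      (.const 1 - bval χ (o + φ.atoms.length) σ)

def pack : ℕ → (ℕ → Ex) → Ex
  | 0, _ => .const 0
  | K + 1, D => D 0 + .reg vBase * pack K fun e => D (e + 1)

section
variable {s : State}

theorem eval_prefixDigit {d x : Ex} {n : ℕ} (hd : d.eval s = n) :
    (prefixDigit d x).eval s = _root_.prefixDigit n (x.eval s) := by
  have e : ((n : ℤ) / 6).toNat = n / 6 := by omega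
  simp [prefixDigit, _root_.prefixDigit, hd, e]

theorem eval_prefixDigit' {d x : Ex} {n : ℕ} (hd : d.eval s = n) :
    (prefixDigit' d x).eval s = _root_.prefixDigit' n (x.eval s) := by
  have e : ((n : ℤ) / 6).toNat = n / 6 := by omega
  simp [prefixDigit', _root_.prefixDigit', hd, e]

theorem eval_bval {X : Type} (φ : LinFormula X) (o : ℕ) {σ : ℕ → Ex} {f : ℕ → ℤ}
    (h : ∀ e, (σ e).eval s = f e) : (bval φ o σ).eval s = φ.bval o f := by
  induction φ generalizing o with
  | le => exact h o
  | not φ ih => simp [bval, LinFormula.bval, ih]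
  | and φ χ ih1 ih2 => simp [bval, LinFormula.bval, ih1, ih2]
  | or φ χ ih1 ih2 => simp [bval, LinFormula.bval, ih1, ih2]

theorem eval_pack (K : ℕ) {D : ℕ → Ex} {f : ℕ → ℤ} (h : ∀ e, (D e).eval s = f e) :
    (pack K D).eval s = _root_.pack (s.reg vBase) K f := by
  induction K generalizing D f with
  | zero => rfl
  | succ K ih =>
    simp only [pack, _root_.pack, eval_add, eval_mul, eval_reg, h, ih fun e => h (e + 1)]

theorem wf_prefixDigit {d x : Ex} (hd : d.Wf) (hx : x.Wf) : (prefixDigit d x).Wf := by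
  simp [prefixDigit, hd, hx]

theorem wf_prefixDigit' {d x : Ex} (hd : d.Wf) (hx : x.Wf) : (prefixDigit' d x).Wf := by
  simp [prefixDigit', hd, hx]

theorem wf_bval {X : Type} (φ : LinFormula X) (o : ℕ) {σ : ℕ → Ex} (h : ∀ e, (σ e).Wf) :
    (bval φ o σ).Wf := by
  induction φ generalizing o with
  | le => exact h o
  | not φ ih => simp [bval, ih]
  | and φ χ ih1 ih2 => simp [bval, ih1, ih2]
  | or φ χ ih1 ih2 => simp [bval, ih1, ih2]

theorem wf_pack (K : ℕ) {D : ℕ → Ex} (h : ∀ e, (D e).Wf) : (pack K D).Wf := by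
  induction K generalizing D with
  | zero => trivial
  | succ K ih => simp [pack, h, ih fun e => h (e + 1)]

theorem wf_choice {q : ℕ} (hq : q < 100) : (choice q).Wf := by simp [choice, hq]

theorem wf_dig {q : ℕ} (hq : q < 100) (e : ℕ) : (dig q e).Wf := by
  simp [dig, wf_choice hq, wf_pow]

theorem wf_coord {q : ℕ} (hq : q < 100) (d j : ℕ) : (coord q d j).Wf := by simp [coord, hq]

end

end Ex

end WordRAM

namespace FOPFormula

open WordRAM

variable (φ : FOPFormula)

/-- The coefficients and the bound of atom number `e`. -/
def atom (e : ℕ) : (Fin φ.d₁ ⊕ Fin φ.d₂ ⊕ Fin φ.d₃ ⊕ Fin φ.l → ℤ) × ℤ :=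
  φ.ψ.atoms.getD e (fun _ => 0, 0)

def lin₁ (x : Fin φ.d₁ → ℤ) (e : ℕ) : ℤ := ∑ j, (φ.atom e).1 (.inl j) * x j

def lin₂ (x : Fin φ.d₂ → ℤ) (e : ℕ) : ℤ := ∑ j, (φ.atom e).1 (.inr (.inl j)) * x j

/-- The free variables and the bound of the atom are charged to the third vector, so that the atom
reads lin₁ + lin₂ + lin₃ ≤ 0. -/
def lin₃ (x : Fin φ.d₃ → ℤ) (t : Fin φ.l → ℤ) (e : ℕ) : ℤ :=
  ∑ j, (φ.atom e).1 (.inr (.inr (.inl j))) * x j +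
    ∑ j, (φ.atom e).1 (.inr (.inr (.inr j))) * t j - (φ.atom e).2

theorem lin_add (x₁ : Fin φ.d₁ → ℤ) (x₂ : Fin φ.d₂ → ℤ) (x₃ : Fin φ.d₃ → ℤ) (t : Fin φ.l → ℤ)
    (e : ℕ) (he : e < φ.ψ.atoms.length) :
    φ.lin₁ x₁ e + φ.lin₂ x₂ e + φ.lin₃ x₃ t e =
      ∑ y, φ.ψ.atoms[e].1 y * Sum.elim x₁ (Sum.elim x₂ (Sum.elim x₃ t)) y - φ.ψ.atoms[e].2 := by
  simp only [lin₁, lin₂, lin₃, atom, List.getD_eq_getElem _ _ he, Fintype.sum_sum_type,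
    Sum.elim_inl, Sum.elim_inr]
  ring

/-- A bound on the numbers `lin` for vectors with coordinates bounded by `1`. -/
def norm : ℕ := ∑ e ∈ Finset.range φ.ψ.atoms.length, (∑ y, ((φ.atom e).1 y).natAbs + (φ.atom e).2.natAbs)

theorem sum_mul_le {d : ℕ} (c x : Fin d → ℤ) {U : ℤ} (hx : ∀ j, |x j| ≤ U) :
    |∑ j, c j * x j| ≤ (∑ j, |c j|) * U := by
  rw [Finset.sum_mul]
  refine (Finset.abs_sum_le_sum_abs _ _).trans (Finset.sum_le_sum fun j _ => ?_)
  rw [abs_mul]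
  exact mul_le_mul_of_nonneg_left (hx j) (abs_nonneg _)

theorem norm_le (e : ℕ) (he : e < φ.ψ.atoms.length) :
    ∑ j, |(φ.atom e).1 (.inl j)| + (∑ j, |(φ.atom e).1 (.inr (.inl j))| +
      (∑ j, |(φ.atom e).1 (.inr (.inr (.inl j)))| + ∑ j, |(φ.atom e).1 (.inr (.inr (.inr j)))|)) +
      |(φ.atom e).2| ≤ φ.norm := by
  have := Finset.single_le_sum (f := fun e => ∑ y, ((φ.atom e).1 y).natAbs + (φ.atom e).2.natAbs)
    (fun _ _ => Nat.zero_le _) (Finset.mem_range.2 he)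
  have h : ((∑ y, ((φ.atom e).1 y).natAbs + (φ.atom e).2.natAbs : ℕ) : ℤ) ≤ φ.norm := by
    exact_mod_cast this
  push_cast at h
  simpa [Fintype.sum_sum_type] using h

section bounds
variable {φ} {U : ℤ} (hU : 1 ≤ U) {e : ℕ} (he : e < φ.ψ.atoms.length)
include hU he

theorem abs_lin₁_le {x : Fin φ.d₁ → ℤ} (hx : ∀ j, |x j| ≤ U) : |φ.lin₁ x e| ≤ φ.norm * U := by
  have h := φ.norm_le e he
  refine (sum_mul_le _ _ hx).trans (mul_le_mul_of_nonneg_right ?_ (by omega))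
  have : ∀ {d : ℕ} (f : Fin d → ℤ), 0 ≤ ∑ j, |f j| := fun f =>
    Finset.sum_nonneg fun j _ => abs_nonneg _
  have h1 := this fun j => (φ.atom e).1 (.inr (.inl j))
  have h2 := this fun j => (φ.atom e).1 (.inr (.inr (.inl j)))
  have h3 := this fun j => (φ.atom e).1 (.inr (.inr (.inr j)))
  have h4 := abs_nonneg (φ.atom e).2
  linarith

theorem abs_lin₂_le {x : Fin φ.d₂ → ℤ} (hx : ∀ j, |x j| ≤ U) : |φ.lin₂ x e| ≤ φ.norm * U := by
  have h := φ.norm_le e he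
  refine (sum_mul_le _ _ hx).trans (mul_le_mul_of_nonneg_right ?_ (by omega))
  have : ∀ {d : ℕ} (f : Fin d → ℤ), 0 ≤ ∑ j, |f j| := fun f =>
    Finset.sum_nonneg fun j _ => abs_nonneg _
  have h1 := this fun j => (φ.atom e).1 (.inl j)
  have h2 := this fun j => (φ.atom e).1 (.inr (.inr (.inl j)))
  have h3 := this fun j => (φ.atom e).1 (.inr (.inr (.inr j)))
  have h4 := abs_nonneg (φ.atom e).2
  linarith

theorem abs_lin₃_le {x : Fin φ.d₃ → ℤ} {t : Fin φ.l → ℤ} (hx : ∀ j, |x j| ≤ U)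
    (ht : ∀ j, |t j| ≤ U) : |φ.lin₃ x t e| ≤ φ.norm * U := by
  have h := φ.norm_le e he
  have : ∀ {d : ℕ} (f : Fin d → ℤ), 0 ≤ ∑ j, |f j| := fun f =>
    Finset.sum_nonneg fun j _ => abs_nonneg _
  have h1 := this fun j => (φ.atom e).1 (.inl j)
  have h2 := this fun j => (φ.atom e).1 (.inr (.inl j))
  have h3 := sum_mul_le (fun j => (φ.atom e).1 (.inr (.inr (.inl j)))) x hx
  have h4 := sum_mul_le (fun j => (φ.atom e).1 (.inr (.inr (.inr j)))) t ht
  have h5 := abs_sub (∑ j, (φ.atom e).1 (.inr (.inr (.inl j))) * x j +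
    ∑ j, (φ.atom e).1 (.inr (.inr (.inr j))) * t j) (φ.atom e).2
  have h6 := abs_add_le (∑ j, (φ.atom e).1 (.inr (.inr (.inl j))) * x j)
    (∑ j, (φ.atom e).1 (.inr (.inr (.inr j))) * t j)
  have h7 : |(φ.atom e).2| ≤ |(φ.atom e).2| * U := le_mul_of_one_le_right (abs_nonneg _) hU
  have h8 := mul_le_mul_of_nonneg_right h (show (0 : ℤ) ≤ U by omega)
  have h9 : 0 ≤ (∑ j, |(φ.atom e).1 (.inl j)|) * U := mul_nonneg h1 (by omega)
  have h10 : 0 ≤ (∑ j, |(φ.atom e).1 (.inr (.inl j))|) * U := mul_nonneg h2 (by omega)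
  unfold lin₃
  simp only [add_mul] at h8
  linarith

end bounds

/-! ### Reading the input -/

theorem flatten_getD {d : ℕ} (A : List (Fin d → ℤ)) (p : ℕ) (hp : p < A.length) (j : Fin d) :
    (flatten A).getD (p * d + j) 0 = A[p] j := by
  induction A generalizing p with
  | nil => simp at hp
  | cons a A ih =>
    have e : flatten (a :: A) = List.ofFn a ++ flatten A := by simp [flatten]
    rw [e]
    rcases p with _ | p
    · rw [List.getD_append _ _ _ _ (by simp)]
      simp
    · rw [List.getD_append_right _ _ _ _ (by simp [add_mul]; omega)]
      rw [List.getElem_cons_succ, ← ih p (by simpa using hp)]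
      congr 1
      simp [add_mul]; omega

theorem arrayOf_flatten {d : ℕ} (A : List (Fin d → ℤ)) (p : ℕ) (hp : p < A.length) (j : Fin d) :
    arrayOf (flatten A) ((p : ℤ) * d + (j : ℕ)) = A[p] j := by
  rw [arrayOf, if_pos (by positivity), ← flatten_getD A p hp j]
  congr 1

theorem mem_flatten {d : ℕ} {A : List (Fin d → ℤ)} {x : Fin d → ℤ} (hx : x ∈ A) (j : Fin d) :
    x j ∈ flatten A :=
  List.mem_flatMap.2 ⟨x, hx, (List.mem_ofFn' _ _).2 ⟨j, rfl⟩⟩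

/-- The coding that belongs to the formula. -/
def coding (Q : ℕ) (B off : ℤ) : Coding (Fin φ.d₁ ⊕ Fin φ.d₂ ⊕ Fin φ.d₃ ⊕ Fin φ.l) :=
  ⟨φ.ψ, Q, B, off⟩

/-- The number of atoms. -/
def k : ℕ := φ.ψ.atoms.length

def linEx₁ (e : ℕ) : Ex := .lin (fun j => (φ.atom e).1 (.inl j)) fun j => .coord 0 φ.d₁ j

def linEx₂ (e : ℕ) : Ex := .lin (fun j => (φ.atom e).1 (.inr (.inl j))) fun j => .coord 1 φ.d₂ j

def linEx₃ (e : ℕ) : Ex :=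
  .lin (fun j => (φ.atom e).1 (.inr (.inr (.inl j)))) (fun j => .coord 2 φ.d₃ j) +
    .lin (fun j => (φ.atom e).1 (.inr (.inr (.inr j)))) (fun j => .load 3 (.const (j : ℕ))) -
    .const (φ.atom e).2

/-- The expressions for the codes of the three lists. -/
def codeEx₁ : Ex :=
  .reg vOff + .pack (φ.k + 3) fun e =>
    if e < φ.k then .prefixDigit (.dig 0 e) (φ.linEx₁ e)
    else if e = φ.k then .const 1 - .bval φ.ψ 0 fun e => .dig 0 e % .const 2
    else if e = φ.k + 1 then .choice 0 else .const 0

def codeEx₂ : Ex :=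
  .reg vOff + .pack (φ.k + 3) fun e =>
    if e < φ.k then .prefixDigit (.dig 1 e) (φ.linEx₂ e)
    else if e = φ.k then .const 0
    else if e = φ.k + 1 then .const 0 - .choice 1 else .choice 1

def codeEx₃ : Ex :=
  .reg vOff + .pack (φ.k + 3) fun e =>
    if e < φ.k then .prefixDigit' (.dig 2 e) (φ.linEx₃ e)
    else if e = φ.k then .const 0
    else if e = φ.k + 1 then .const 0 else .const 0 - .choice 2

theorem wf_codeEx₁ : φ.codeEx₁.Wf := by
  simp only [codeEx₁, Ex.wf_add, Ex.wf_reg]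
  refine ⟨by norm_num, Ex.wf_pack _ fun e => ?_⟩
  split_ifs
  · exact Ex.wf_prefixDigit (Ex.wf_dig (by norm_num) _)
      (Ex.wf_lin fun j => Ex.wf_coord (by norm_num) _ _)
  · exact (Ex.wf_sub _ _).2 ⟨trivial, Ex.wf_bval _ _ fun e => by
      simp [Ex.wf_dig (show 0 < 100 by norm_num)]⟩
  · exact Ex.wf_choice (by norm_num)
  · trivial

theorem wf_codeEx₂ : φ.codeEx₂.Wf := by
  simp only [codeEx₂, Ex.wf_add, Ex.wf_reg]
  refine ⟨by norm_num, Ex.wf_pack _ fun e => ?_⟩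
  split_ifs
  · exact Ex.wf_prefixDigit (Ex.wf_dig (by norm_num) _)
      (Ex.wf_lin fun j => Ex.wf_coord (by norm_num) _ _)
  · trivial
  · exact (Ex.wf_sub _ _).2 ⟨trivial, Ex.wf_choice (by norm_num)⟩
  · exact Ex.wf_choice (by norm_num)

theorem wf_codeEx₃ : φ.codeEx₃.Wf := by
  simp only [codeEx₃, Ex.wf_add, Ex.wf_reg]
  refine ⟨by norm_num, Ex.wf_pack _ fun e => ?_⟩
  split_ifs
  · refine Ex.wf_prefixDigit' (Ex.wf_dig (by norm_num) _) ?_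
    simp only [linEx₃, Ex.wf_sub, Ex.wf_add]
    exact ⟨⟨Ex.wf_lin fun j => Ex.wf_coord (by norm_num) _ _, Ex.wf_lin fun j => by simp⟩, trivial⟩
  · trivial
  · trivial
  · exact (Ex.wf_sub _ _).2 ⟨trivial, Ex.wf_choice (by norm_num)⟩

section eval
variable {φ} {s : State} {Q n z : ℕ} {B off : ℤ} (hQ : s.reg vQ = Q) (hB : s.reg vBase = B)
  (hoff : s.reg vOff = off) (hz : s.reg vZ = z)
include hQ hz

theorem eval_dig {q : ℕ} (hn : s.reg q = n) (e : ℕ) :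
    (Ex.dig q e).eval s = ((φ.coding Q B off).dig (z / n) e : ℕ) := by
  simp only [Ex.dig, Ex.choice, Ex.eval_mod, Ex.eval_div, Ex.eval_reg, Ex.eval_pow, hQ, hz, hn,
    Coding.dig, coding]
  push_cast; rfl

omit hQ in
theorem eval_choice {q : ℕ} (hn : s.reg q = n) : (Ex.choice q).eval s = (z / n : ℕ) := by
  simp [Ex.choice, hz, hn]

omit hQ in
theorem eval_coord {q d : ℕ} (hn : s.reg q = n) {A : List (Fin d → ℤ)}
    (hm : s.mem q = arrayOf (flatten A)) (hzn : z % n < A.length) (j : Fin d) :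
    (Ex.coord q d j).eval s = A[z % n] j := by
  have e : (z : ℤ) % n = (z % n : ℕ) := by push_cast; rfl
  simp only [Ex.coord, Ex.eval_load, Ex.eval_add, Ex.eval_mul, Ex.eval_mod, Ex.eval_reg,
    Ex.eval_const, hz, hn, hm, e]
  exact arrayOf_flatten A _ hzn j

include hB hoff

theorem eval_codeEx₁ {A : List (Fin φ.d₁ → ℤ)} (hn : s.reg 0 = n)
    (hm : s.mem 0 = arrayOf (flatten A)) (hzn : z % n < A.length) :
    φ.codeEx₁.eval s = (φ.coding Q B off).code
      ((φ.coding Q B off).digits₁ (z / n) (φ.lin₁ A[z % n])) := by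
  simp only [codeEx₁, Ex.eval_add, Ex.eval_reg, hoff, Coding.code]
  congr 1
  rw [Ex.eval_pack (f := (φ.coding Q B off).digits₁ (z / n) (φ.lin₁ A[z % n])), hB]
  · rfl
  · intro e
    show Ex.eval s (if e < φ.k then _ else _) = if e < φ.k then _ else if e = φ.k then _ else
      if e = φ.k + 1 then _ else _
    split_ifs
    · rw [Ex.eval_prefixDigit (eval_dig (φ := φ) (B := B) (off := off) hQ hz hn e)]
      congr 1
      simp only [linEx₁, Ex.eval_lin, eval_coord hz hn hm hzn]
      rfl
    · rw [Ex.eval_sub, Ex.eval_bval (f := (φ.coding Q B off).sig (z / n))]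
      · rfl
      · intro e
        rw [Ex.eval_mod, eval_dig (φ := φ) (B := B) (off := off) hQ hz hn e]
        rfl
    · exact eval_choice hz hn
    · rfl

theorem eval_codeEx₂ {A : List (Fin φ.d₂ → ℤ)} (hn : s.reg 1 = n)
    (hm : s.mem 1 = arrayOf (flatten A)) (hzn : z % n < A.length) :
    φ.codeEx₂.eval s = (φ.coding Q B off).code
      ((φ.coding Q B off).digits₂ (z / n) (φ.lin₂ A[z % n])) := by
  simp only [codeEx₂, Ex.eval_add, Ex.eval_reg, hoff, Coding.code]
  congr 1
  rw [Ex.eval_pack (f := (φ.coding Q B off).digits₂ (z / n) (φ.lin₂ A[z % n])), hB]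
  · rfl
  · intro e
    show Ex.eval s (if e < φ.k then _ else _) = if e < φ.k then _ else if e = φ.k then _ else
      if e = φ.k + 1 then _ else _
    split_ifs
    · rw [Ex.eval_prefixDigit (eval_dig (φ := φ) (B := B) (off := off) hQ hz hn e)]
      congr 1
      simp only [linEx₂, Ex.eval_lin, eval_coord hz hn hm hzn]
      rfl
    · rfl
    · rw [Ex.eval_sub, eval_choice hz hn]; simp
    · exact eval_choice hz hn

theorem eval_codeEx₃ {A : List (Fin φ.d₃ → ℤ)} {t : Fin φ.l → ℤ} (hn : s.reg 2 = n)
    (hm : s.mem 2 = arrayOf (flatten A)) (ht : s.mem 3 = arrayOf (List.ofFn t))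
    (hzn : z % n < A.length) :
    φ.codeEx₃.eval s = (φ.coding Q B off).code
      ((φ.coding Q B off).digits₃ (z / n) (φ.lin₃ A[z % n] t)) := by
  simp only [codeEx₃, Ex.eval_add, Ex.eval_reg, hoff, Coding.code]
  congr 1
  rw [Ex.eval_pack (f := (φ.coding Q B off).digits₃ (z / n) (φ.lin₃ A[z % n] t)), hB]
  · rfl
  · intro e
    show Ex.eval s (if e < φ.k then _ else _) = if e < φ.k then _ else if e = φ.k then _ else
      if e = φ.k + 1 then _ else _
    split_ifs
    · rw [Ex.eval_prefixDigit' (eval_dig (φ := φ) (B := B) (off := off) hQ hz hn e)]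
      congr 1
      have h3 : ∀ j : Fin φ.l, s.mem 3 ((j : ℕ) : ℤ) = t j := by
        intro j; rw [ht]; simp [arrayOf]
      simp only [linEx₃, Ex.eval_lin, Ex.eval_sub, Ex.eval_add, Ex.eval_load, Ex.eval_const,
        eval_coord hz hn hm hzn, h3]
      rfl
    · rfl
    · rfl
    · rw [Ex.eval_sub, eval_choice hz hn]; simp

end eval

end FOPFormula

namespace FOPFormula

open WordRAM

/-! ### The parameters of the algorithm -/

section parameters
variable (φ : FOPFormula) (c N : ℕ)

/-- The exponents here depend on the formula and on `c`, never on the instance. This one bounds the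
linear forms, see `lin_lt`. -/
def expLin : ℕ := c + φ.norm + 1

def bits : ℕ := Nat.log 2 N + 1

def numDigits : ℕ := 6 * (φ.expLin c * bits N)

def expChoices : ℕ := (φ.expLin c + 4) * φ.k

def numChoices : ℕ := φ.numDigits c N ^ φ.k

def expBase : ℕ := φ.expLin c + φ.expChoices c + 3

def codeBase : ℕ := N ^ φ.expBase c

def codeOff : ℕ := φ.codeBase c N ^ (φ.k + 3)

/-- The block size S balances (N / S)³ triples against N marks of cost S² each, which gives S^5 =
N². In this form the machine can find S by integer arithmetic. -/
theorem exists_pow_five_ge (N : ℕ) : ∃ s, N ^ 2 ≤ s ^ 5 := ⟨N, by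
  rcases N with _ | N
  · simp
  · exact Nat.pow_le_pow_right N.succ_pos (by norm_num)⟩

/-- The size of the blocks, `N ^ (2 / 5)` rounded up. -/
def blockSize : ℕ := Nat.find (exists_pow_five_ge N)

/-- Rounding up leaves room for all codes; dummies fill the last block. -/
def numBlocks : ℕ := N * φ.numChoices c N / blockSize N + 1

def listLen : ℕ := φ.numBlocks c N * blockSize N

def expCode : ℕ := φ.expBase c * (φ.k + 3) + φ.expChoices c + 3

def codeBound : ℕ := N ^ φ.expCode c

def codeBits : ℕ := φ.expCode c * bits N

/-- The exponent of the universe of the instances of 3-SUM. -/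
def expUniverse : ℕ := 5 * (φ.expCode c + 1)

variable {φ c N}

theorem lt_two_pow_bits : N < 2 ^ bits N := Nat.lt_pow_succ_log_self (by norm_num) N

theorem bits_le (hN : 2 ≤ N) : bits N ≤ N := by
  have := Nat.log_lt_self 2 (show N ≠ 0 by omega)
  unfold bits; omega

theorem le_blockSize : N ^ 2 ≤ blockSize N ^ 5 := Nat.find_spec (exists_pow_five_ge N)

theorem lt_blockSize {y : ℕ} (h : y < blockSize N) : y ^ 5 < N ^ 2 :=
  not_le.1 (Nat.find_min (exists_pow_five_ge N) h)

theorem blockSize_le (hN : 2 ≤ N) : blockSize N ≤ N :=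
  Nat.find_min' (exists_pow_five_ge N) (Nat.pow_le_pow_right (by omega) (by norm_num))

theorem two_le_blockSize (hN : 2 ≤ N) : 2 ≤ blockSize N := by
  by_contra h
  have h1 : blockSize N ^ 5 ≤ 1 ^ 5 := Nat.pow_le_pow_left (by omega) 5
  have h2 : 2 ^ 2 ≤ N ^ 2 := Nat.pow_le_pow_left hN 2
  have := le_blockSize (N := N)
  omega

/-- Converts bounds polynomial in N into bounds polynomial in the block size, which is the size in
which a call of 3-SUM measures its universe. -/
theorem le_blockSize_pow (hN : 2 ≤ N) (e : ℕ) : N ^ e ≤ blockSize N ^ (5 * e) := by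
  rw [pow_mul]
  refine Nat.pow_le_pow_left (le_trans ?_ le_blockSize) e
  nlinarith

theorem const_le_pow (hN : 2 ≤ N) (a : ℕ) : a ≤ N ^ a :=
  (Nat.lt_two_pow_self).le.trans (Nat.pow_le_pow_left hN a)

theorem pow_lt_two_pow_bits (e : ℕ) (h : e ≠ 0) : N ^ e < 2 ^ (e * bits N) := by
  rw [mul_comm, pow_mul]
  exact Nat.pow_lt_pow_left lt_two_pow_bits h

theorem lin_lt (hN : 2 ≤ N) : φ.norm * N ^ c + 1 < N ^ φ.expLin c := by
  have h1 : φ.norm + 1 ≤ N ^ φ.norm := Nat.lt_pow_self (by omega)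
  have h2 : 0 < N ^ c := by positivity
  have e : N ^ φ.expLin c = N ^ φ.norm * N ^ c * N := by rw [expLin]; ring
  have h3 : (φ.norm + 1) * N ^ c ≤ N ^ φ.norm * N ^ c := Nat.mul_le_mul_right _ h1
  have h4 := Nat.mul_le_mul_left (N ^ φ.norm * N ^ c) hN
  rw [e]
  rw [add_mul] at h3
  omega

theorem numDigits_le (hN : 2 ≤ N) : φ.numDigits c N ≤ N ^ (φ.expLin c + 4) := by
  have h1 : 6 ≤ N ^ 3 := le_trans (by norm_num) (Nat.pow_le_pow_left hN 3)
  calc φ.numDigits c N ≤ N ^ 3 * (N ^ φ.expLin c * N) :=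
        Nat.mul_le_mul h1 (Nat.mul_le_mul (const_le_pow hN _) (bits_le hN))
    _ = _ := by ring

theorem numChoices_le (hN : 2 ≤ N) : φ.numChoices c N ≤ N ^ φ.expChoices c := by
  rw [numChoices, expChoices, pow_mul]
  exact Nat.pow_le_pow_left (numDigits_le hN) _

theorem codeBase_gt (hN : 2 ≤ N) :
    3 * (φ.norm * N ^ c) + 4 + φ.numChoices c N < φ.codeBase c N := by
  have h1 := lin_lt (φ := φ) (c := c) hN
  have h2 := numChoices_le (φ := φ) (c := c) hN
  have h3 : 2 ^ 3 ≤ N ^ 3 := Nat.pow_le_pow_left hN 3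
  have h4 : 0 < N ^ φ.expChoices c := by positivity
  have e : φ.codeBase c N = N ^ φ.expLin c * N ^ φ.expChoices c * N ^ 3 := by
    rw [codeBase, expBase]; ring
  rw [e]
  generalize N ^ φ.expLin c = X at *
  generalize N ^ φ.expChoices c = Y at *
  have h5 : X * Y * 2 ^ 3 ≤ X * Y * N ^ 3 := Nat.mul_le_mul_left _ h3
  have h6 : X ≤ X * Y := Nat.le_mul_of_pos_right _ h4
  have h7 : Y ≤ X * Y := Nat.le_mul_of_pos_left _ (by omega)
  omega

theorem codeOff_pos (hN : 2 ≤ N) : 0 < φ.codeOff c N := by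
  unfold codeOff codeBase; positivity

theorem good_coding (hN : 2 ≤ N) :
    (φ.coding (φ.numDigits c N) (φ.codeBase c N) (φ.codeOff c N)).Good (φ.expLin c * bits N)
      (φ.norm * N ^ c : ℕ) where
  Q_eq := rfl
  H_lt := by
    have h := (lin_lt (φ := φ) (c := c) hN).trans
      (pow_lt_two_pow_bits (N := N) (φ.expLin c) (by simp [expLin]))
    exact_mod_cast h
  B_gt := by
    have h := codeBase_gt (φ := φ) (c := c) hN
    show 3 * ((φ.norm * N ^ c : ℕ) : ℤ) + 4 + (φ.numDigits c N : ℤ) ^ φ.k < (φ.codeBase c N : ℕ)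
    exact_mod_cast h
  off_eq := by
    show ((φ.codeOff c N : ℕ) : ℤ) = (φ.codeBase c N : ℤ) ^ (φ.k + 3)
    simp [codeOff]

theorem le_listLen {j : ℕ} (h : j ≤ N) : φ.numChoices c N * j ≤ φ.listLen c N := by
  rcases Nat.eq_zero_or_pos (blockSize N) with h0 | h0
  · have := le_blockSize (N := N)
    rw [h0] at this
    have : N = 0 := by simpa using this
    simp [show j = 0 by omega]
  · have h1 : N * φ.numChoices c N ≤ φ.listLen c N :=
      ((Nat.div_lt_iff_lt_mul h0).1 (Nat.lt_succ_self _)).le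
    exact (Nat.mul_le_mul_left _ h).trans (by rwa [mul_comm])

theorem listLen_le : φ.listLen c N ≤ N * φ.numChoices c N + blockSize N := by
  rw [listLen, numBlocks, add_mul, one_mul]
  exact Nat.add_le_add_right (Nat.div_mul_le_self _ _) _

/-- The dummies start at 4 * off, above all genuine codes, which are below 2 * off, and above the
target 3 * off. There is one possible dummy for each position of the list. -/
theorem codes_le (hN : 2 ≤ N) : 4 * φ.codeOff c N + φ.listLen c N ≤ φ.codeBound c N := by
  have h1 := listLen_le (φ := φ) (c := c) (N := N)
  have h2 := numChoices_le (φ := φ) (c := c) hN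
  have h3 := blockSize_le hN
  have h4 : 0 < N ^ φ.expChoices c := by positivity
  have h5 := codeOff_pos (φ := φ) (c := c) hN
  have e : φ.codeBound c N = φ.codeOff c N * N ^ φ.expChoices c * N ^ 3 := by
    rw [codeBound, expCode, codeOff, codeBase]; ring
  rw [e]
  generalize φ.codeOff c N = Z at *
  generalize N ^ φ.expChoices c = Y at *
  have h6 : N * φ.numChoices c N ≤ N * Y := Nat.mul_le_mul_left _ h2
  have h7 : 1 ≤ Z * Y := Nat.mul_pos h5 h4
  have h8 : Z ≤ Z * Y := Nat.le_mul_of_pos_right _ h4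
  have h9 : Y ≤ Z * Y := Nat.le_mul_of_pos_left _ h5
  have h10 : N * Y ≤ N * (Z * Y) := Nat.mul_le_mul_left _ h9
  have h11 : N * 1 ≤ N * (Z * Y) := Nat.mul_le_mul_left _ h7
  have h12 : 4 * N ≤ N ^ 3 := by nlinarith [Nat.mul_le_mul hN hN]
  have h13 : Z * Y * (4 * N) ≤ Z * Y * N ^ 3 := Nat.mul_le_mul_left _ h12
  nlinarith

/-- The factor 2 leaves room for the dummies V + u and for the third block shifted by T. -/
theorem universe_le (hN : 2 ≤ N) : 2 * φ.codeBound c N ≤ blockSize N ^ φ.expUniverse c := by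
  refine le_trans ?_ (le_blockSize_pow hN _)
  rw [codeBound, pow_succ, mul_comm]
  exact Nat.mul_le_mul_left _ hN

theorem codeBound_lt : φ.codeBound c N < 2 ^ φ.codeBits c N :=
  pow_lt_two_pow_bits _ (by simp [expCode])

end parameters

/-! ### The codes of an instance -/

section codes
variable {φ : FOPFormula} (c N : ℕ) (I : φ.Input)

variable (φ) in
abbrev cod : Coding (Fin φ.d₁ ⊕ Fin φ.d₂ ⊕ Fin φ.d₃ ⊕ Fin φ.l) :=
  φ.coding (φ.numDigits c N) (φ.codeBase c N) (φ.codeOff c N)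

def code₁ (z : ℕ) : ℤ := (cod φ c N).code ((cod φ c N).digits₁ (z / I.A₁.length)
  (φ.lin₁ (I.A₁.getD (z % I.A₁.length) 0)))

def code₂ (z : ℕ) : ℤ := (cod φ c N).code ((cod φ c N).digits₂ (z / I.A₂.length)
  (φ.lin₂ (I.A₂.getD (z % I.A₂.length) 0)))

def code₃ (z : ℕ) : ℤ := (cod φ c N).code ((cod φ c N).digits₃ (z / I.A₃.length)
  (φ.lin₃ (I.A₃.getD (z % I.A₃.length) 0) I.t))

/-- All coordinates are bounded by `N ^ c`. -/
structure Small : Prop where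
  fst : ∀ x ∈ I.A₁, ∀ j, |x j| ≤ ((N ^ c : ℕ) : ℤ)
  snd : ∀ x ∈ I.A₂, ∀ j, |x j| ≤ ((N ^ c : ℕ) : ℤ)
  thd : ∀ x ∈ I.A₃, ∀ j, |x j| ≤ ((N ^ c : ℕ) : ℤ)
  free : ∀ j, |I.t j| ≤ ((N ^ c : ℕ) : ℤ)

variable {c N I}

theorem abs_getD_le {d : ℕ} {A : List (Fin d → ℤ)} {U : ℕ} (h : ∀ x ∈ A, ∀ j, |x j| ≤ (U : ℤ))
    (p : ℕ) (j : Fin d) : |A.getD p 0 j| ≤ (U : ℤ) := by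
  by_cases hp : p < A.length
  · rw [List.getD_eq_getElem _ _ hp]; exact h _ (List.getElem_mem hp) j
  · rw [List.getD_eq_default _ _ (by omega)]; simp

section small
variable (hN : 2 ≤ N) (hI : Small c N I)
include hN hI

theorem Small.lin₁_le (p : ℕ) (e : ℕ) (he : e < φ.k) :
    |φ.lin₁ (I.A₁.getD p 0) e| ≤ ((φ.norm * N ^ c : ℕ) : ℤ) := by
  have h1 : 1 ≤ N ^ c := Nat.one_le_pow _ _ (by omega)
  push_cast
  exact_mod_cast abs_lin₁_le (U := (N ^ c : ℕ)) (by exact_mod_cast h1) he (abs_getD_le hI.fst p)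

theorem Small.lin₂_le (p : ℕ) (e : ℕ) (he : e < φ.k) :
    |φ.lin₂ (I.A₂.getD p 0) e| ≤ ((φ.norm * N ^ c : ℕ) : ℤ) := by
  have h1 : 1 ≤ N ^ c := Nat.one_le_pow _ _ (by omega)
  push_cast
  exact_mod_cast abs_lin₂_le (U := (N ^ c : ℕ)) (by exact_mod_cast h1) he (abs_getD_le hI.snd p)

theorem Small.lin₃_le (p : ℕ) (e : ℕ) (he : e < φ.k) :
    |φ.lin₃ (I.A₃.getD p 0) I.t e| ≤ ((φ.norm * N ^ c : ℕ) : ℤ) := by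
  have h1 : 1 ≤ N ^ c := Nat.one_le_pow _ _ (by omega)
  push_cast
  exact_mod_cast abs_lin₃_le (U := (N ^ c : ℕ)) (by exact_mod_cast h1) he
    (abs_getD_le hI.thd p) hI.free

theorem Small.code₁_bounds {z : ℕ} (hz : z < φ.numChoices c N * I.A₁.length) :
    0 ≤ code₁ c N I z ∧ code₁ c N I z < 2 * φ.codeOff c N := by
  refine (good_coding (φ := φ) (c := c) hN).code_bounds (by positivity) fun e => ?_
  have := Coding.abs_digits₁_le (P := cod φ c N) (Nat.div_lt_of_lt_mul (by rwa [mul_comm] at hz))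
    (hI.lin₁_le hN (z % I.A₁.length)) (by positivity) e
  linarith

theorem Small.code₂_bounds {z : ℕ} (hz : z < φ.numChoices c N * I.A₂.length) :
    0 ≤ code₂ c N I z ∧ code₂ c N I z < 2 * φ.codeOff c N := by
  refine (good_coding (φ := φ) (c := c) hN).code_bounds (by positivity) fun e => ?_
  have := Coding.abs_digits₂_le (P := cod φ c N) (Nat.div_lt_of_lt_mul (by rwa [mul_comm] at hz))
    (hI.lin₂_le hN (z % I.A₂.length)) (by positivity) e
  linarith

theorem Small.code₃_bounds {z : ℕ} (hz : z < φ.numChoices c N * I.A₃.length) :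
    0 ≤ code₃ c N I z ∧ code₃ c N I z < 2 * φ.codeOff c N :=
  (good_coding (φ := φ) (c := c) hN).code_bounds (by positivity) fun e => Coding.abs_digits₃_le (P := cod φ c N)
    (Nat.div_lt_of_lt_mul (by rwa [mul_comm] at hz)) (hI.lin₃_le hN _) (by positivity) e

/-- The reduction to the sums of codes. -/
theorem Small.answer_iff :
    (∀ p < I.A₁.length, ∃ z < φ.numChoices c N * I.A₁.length, z % I.A₁.length = p ∧
      ∃ z' < φ.numChoices c N * I.A₂.length, ∃ z'' < φ.numChoices c N * I.A₃.length,
        code₁ c N I z + code₂ c N I z' + code₃ c N I z'' = 3 * φ.codeOff c N) ↔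
    ∀ x₁ ∈ I.A₁, ∃ x₂ ∈ I.A₂, ∃ x₃ ∈ I.A₃, φ.Holds x₁ x₂ x₃ I.t := by
  have hG := good_coding (φ := φ) (c := c) hN
  have hdiv : ∀ {z n : ℕ}, z < φ.numChoices c N * n → z / n < φ.numChoices c N := fun h =>
    Nat.div_lt_of_lt_mul (by rwa [mul_comm] at h)
  have hpos : ∀ {z n : ℕ}, z < φ.numChoices c N * n → 0 < n := fun {z n} h => by
    rcases Nat.eq_zero_or_pos n with rfl | h'
    · simp at h
    · exact h'
  -- The loop index i * n + p stands for the choice i and the vector number p.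
  have hmk : ∀ {i p n : ℕ}, i < φ.numChoices c N → p < n →
      i * n + p < φ.numChoices c N * n ∧ (i * n + p) / n = i ∧ (i * n + p) % n = p := by
    intro i p n hi hp
    refine ⟨?_, ?_, ?_⟩
    · have : (i + 1) * n ≤ φ.numChoices c N * n := Nat.mul_le_mul_right _ hi
      rw [add_mul] at this; omega
    · rw [mul_comm, Nat.mul_add_div (by omega), Nat.div_eq_of_lt hp, add_zero]
    · rw [mul_comm, Nat.mul_add_mod, Nat.mod_eq_of_lt hp]
  have hiff : ∀ p p' p'' : ℕ,
      _ ↔ φ.Holds (I.A₁.getD p 0) (I.A₂.getD p' 0) (I.A₃.getD p'' 0) I.t := fun p p' p'' =>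
    hG.holds_iff (hI.lin₁_le hN p) (hI.lin₂_le hN p') (hI.lin₃_le hN p'') _
      fun e he => φ.lin_add _ _ _ _ e he
  have hsum : ∀ {i i' i'' : ℕ} (hi : i < φ.numChoices c N) (hi' : i' < φ.numChoices c N)
      (hi'' : i'' < φ.numChoices c N) (p p' p'' : ℕ), _ := fun hi hi' hi'' p p' p'' =>
    hG.code_sum_iff (by positivity) hi hi' hi'' (hI.lin₁_le hN p) (hI.lin₂_le hN p')
      (hI.lin₃_le hN p'')
  constructor
  · intro h x₁ hx₁
    obtain ⟨p, hp, rfl⟩ := List.getElem_of_mem hx₁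
    obtain ⟨z, hz, rfl, z', hz', z'', hz'', he⟩ := h p hp
    have hp' := Nat.mod_lt z' (hpos hz')
    have hp'' := Nat.mod_lt z'' (hpos hz'')
    obtain ⟨-, -, h1⟩ := (hsum (hdiv hz) (hdiv hz') (hdiv hz'') _ _ _).1 he
    have := (hiff _ _ _).1 ⟨_, hdiv hz, h1⟩
    rw [List.getD_eq_getElem _ _ hp, List.getD_eq_getElem _ _ hp',
      List.getD_eq_getElem _ _ hp''] at this
    exact ⟨_, List.getElem_mem hp', _, List.getElem_mem hp'', this⟩
  · intro h p hp
    obtain ⟨x₂, hx₂, x₃, hx₃, hh⟩ := h _ (List.getElem_mem hp)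
    obtain ⟨p', hp', rfl⟩ := List.getElem_of_mem hx₂
    obtain ⟨p'', hp'', rfl⟩ := List.getElem_of_mem hx₃
    rw [← List.getD_eq_getElem _ 0 hp, ← List.getD_eq_getElem _ 0 hp',
      ← List.getD_eq_getElem _ 0 hp''] at hh
    obtain ⟨i, hi, h1⟩ := (hiff _ _ _).2 hh
    obtain ⟨a1, a2, a3⟩ := hmk (i := i) hi hp
    obtain ⟨b1, b2, b3⟩ := hmk (i := i) hi hp'
    obtain ⟨c1, c2, c3⟩ := hmk (i := i) hi hp''
    refine ⟨_, a1, a3, _, b1, _, c1, ?_⟩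
    rw [code₁, code₂, code₃, a2, a3, b2, b3, c2, c3]
    exact (hsum hi hi hi p p' p'').2 ⟨rfl, rfl, h1⟩

end small

end codes

end FOPFormula

namespace WordRAM

variable {M : Bounds} {τ : ℕ} {s : State} {Q : ℕ → State → Prop}

theorem wp_set {r : ℕ} {e : Ex} {v : ℕ} (hv : e.eval s = v) (he : e.Wf := by simp)
    (hd : e.deg ≤ M.D := by exact M.le_D (by simp)) (hvB : (v : ℤ) ≤ M.B)
    (h : Q (τ + (e.cost + 2)) (s.setReg r v)) : wp M (.assign r e) τ s Q := by
  refine wp_assign he hd (fun _ => ?_) (by rwa [hv])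
  rw [hv, abs_of_nonneg (by positivity)]
  exact hvB

/-! ### Searching for a parameter -/

/-- `reg r :=` the least number for which `e₁ < e₂` fails. -/
def search (r : ℕ) (e₁ e₂ : Ex) : Cmd :=
  .assign r (.const 0) ;;
  .forLoop vZ vN (.ifLt e₁ e₂ (.assign r (.reg r + .const 1)) .skip)

/-- The test succeeds exactly below the threshold x, so N conditional increments stop at x. Linear
time is affordable here. -/
theorem wp_search {r : ℕ} {e₁ e₂ : Ex} {N x : ℕ} (hN : s.reg vN = N) (hx : x ≤ N)
    (h : ∀ t : State, t.reg vN = N → ∀ y ≤ x, t.reg r = y → (e₁.eval t < e₂.eval t ↔ y < x))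
    (hr : r < 100 := by norm_num) (hrZ : r ≠ vZ := by norm_num) (hrN : r ≠ vN := by norm_num)
    (he₁ : e₁.Wf := by simp) (he₂ : e₂.Wf := by simp)
    (hd₁ : e₁.deg ≤ M.D := by exact M.le_D (by simp))
    (hd₂ : e₂.deg ≤ M.D := by exact M.le_D (by simp)) :
    wp M (search r e₁ e₂) τ s fun τ' t =>
      τ' ≤ τ + (N * (e₁.cost + e₂.cost + 14) + 7) ∧ t.reg r = x := by
  refine wp_seq (wp_assign (hv := fun _ => by simp) (h := ?_))
  refine wp_forLoop_uniform N (e₁.cost + e₂.cost + 7) (fun j t => t.reg r = (min j x : ℕ))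
    (hki := by simp [hrZ]) (hkn := by simp [hrN]) (hN := ?_) (h0 := ?_) (hstep := ?_)
    (hQ := ?_)
  · simpa [Ne.symm hrN] using hN
  · simp [hrZ]
  · intro j hj τ' t hb hF htj hI
    have htN : t.reg vN = N := by
      rw [hF.reg _ (by norm_num) (by simp [hrN])]; simpa [Ne.symm hrN] using hN
    have hlt := h t htN _ (min_le_right j x) hI
    refine wp_ifLt he₁ he₂ hd₁ hd₂ (fun hc => ?_) fun hc => wp_skip ?_
    · rw [hlt] at hc
      refine wp_assign (he := by simpa using hr) (hv := fun _ => ?_) (h := ?_)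
      · have h1 : ((min j x : ℕ) : ℤ) + 1 ≤ N := by omega
        have h2 := hb.1 vN (by norm_num)
        rw [htN] at h2
        have h3 := le_of_abs_le h2
        simp only [Ex.eval_add, Ex.eval_reg, Ex.eval_const, hI]
        rw [abs_of_nonneg (by omega)]; omega
      · refine ⟨by simp; omega, ?_⟩
        simp only [Ex.eval_add, Ex.eval_reg, Ex.eval_const, hI, State.reg_setReg, if_neg hrZ,
          if_true]
        omega
    · rw [hlt] at hc
      refine ⟨by omega, ?_⟩
      simp only [State.reg_setReg, if_neg hrZ, hI]
      omega
  · intro τ' t hb hF h1 h2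
    refine ⟨?_, ?_⟩
    · simp only [Ex.cost_const] at h1
      linarith
    · rw [h2, min_eq_right hx]

/-! ### Sorted lists of codes -/

/-- From cell `row` on, array `10 + q` holds `m` increasing numbers `a u` below `V`; these are the
numbers `F z` with `z < tot`, and numbers that are at least `dum`. -/
structure SortedCodes (t : State) (q m : ℕ) (row V dum : ℤ) (F : ℕ → ℤ) (tot : ℕ)
    (a : ℕ → ℤ) : Prop where
  holds : ∀ u < m, t.mem (10 + q) (row + u) = a u
  strict : StrictBelow m V a
  complete : ∀ z < tot, ∃ u < m, a u = F z
  sound : ∀ u < m, (∃ z < tot, a u = F z) ∨ dum ≤ a u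

def sortedCodes (q : ℕ) (f : Ex) : Cmd := gen q f ;; sortList q

theorem wp_sortedCodes {q : ℕ} (hq : q < 3) {f : Ex} (hfW : f.Wf) (hfD : f.deg ≤ M.D)
    {F : ℕ → ℤ} {tot m L : ℕ} (htot : s.reg vLam * s.reg q = tot) (hm : s.reg vM = m)
    (htm : tot ≤ m) {dum V : ℤ} (hd : 0 ≤ dum) (hdum : s.reg vDum = dum) (hmd : m ≤ dum)
    (hL : s.reg vLL = L) (hV : dum + m ≤ V) (hVB : V ≤ M.B) (hVL : V ≤ 2 ^ L)
    (hseen : ∀ z, s.mem (20 + q) z = 0)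
    (hf : ∀ t, M.Bdd t → Frame (gen q f) s t →
      ∀ z : ℕ, z < tot → t.reg vZ = z → f.eval t = F z)
    (hF0 : ∀ z < tot, 0 ≤ F z) (hFd : ∀ z < tot, F z < dum) :
    wp M (sortedCodes q f) τ s fun τ' t =>
      τ' ≤ τ + (m * (f.cost + 64) + L * (m * 154 + 27) + 34) ∧
      ∃ a, SortedCodes t q m (L * m : ℕ) V dum F tot a := by
  refine wp_seq_of (wp_gen hq hfW hfD htot hm htm hd hdum (by omega) hseen hf hF0 hFd) ?_
  rintro τ' t hb hF ⟨h1, l, h2, h3, h4, h5, h6⟩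
  -- From m ≤ dum and dum + m ≤ V ≤ B follows 2 * m ≤ B, which sorting needs.
  refine wp_mono (wp_sortList hq (L := L) (m := m) ?_ ?_ (by omega) h3 h4) ?_
  · rw [hF.reg _ (by norm_num) (by simp [gen, genBody, padBody]), hL]
  · rw [hF.reg _ (by norm_num) (by simp [gen, genBody, padBody]), hm]
  rintro τ'' u _ _ ⟨g1, g2⟩
  have hlen : (radixIter l L).length = m := by rw [(radixIter_perm l L).length_eq, h3]
  have hbd : ∀ x ∈ l, 0 ≤ x ∧ x < V := by
    intro x hx
    rcases h6 x hx with ⟨z, hz, rfl⟩ | h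
    · have := hF0 z hz; have := hFd z hz; omega
    · omega
  have hst := radixIter_strict h2 fun x hx => ⟨(hbd x hx).1, (hbd x hx).2.trans_le hVL⟩
  have hget : ∀ u (hu : u < m), (radixIter l L).getD u 0 = (radixIter l L)[u]'(by omega) :=
    fun u hu => List.getD_eq_getElem _ _ _
  have hmem : ∀ u < m, (radixIter l L).getD u 0 ∈ l := fun u hu => by
    rw [hget u hu]; exact (radixIter_perm l L).mem_iff.1 (List.getElem_mem _)
  refine ⟨?_, fun u => (radixIter l L).getD u 0, ?_, ?_, ?_, ?_⟩
  · have := Nat.mul_le_mul_right (f.cost + 37) htm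
    linarith
  · intro u hu
    rw [hget u hu, ← g2 u (by omega)]; push_cast; rfl
  · refine ⟨fun u v huv hv => ?_, fun u hu => (hbd _ (hmem u hu)).1,
      fun u hu => (hbd _ (hmem u hu)).2⟩
    rw [hget u (by omega), hget v hv]
    exact List.pairwise_iff_getElem.1 hst _ _ _ _ huv
  · intro z hz
    obtain ⟨u, hu, e⟩ := List.getElem_of_mem ((radixIter_perm l L).mem_iff.2 (h5 z hz))
    exact ⟨u, by omega, by rw [hget u (by omega), e]⟩
  · intro u hu
    rcases h6 _ (hmem u hu) with ⟨z, hz, h⟩ | h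
    exacts [Or.inl ⟨z, hz, h.symm⟩, Or.inr h.1]

/-! ### The final check -/

/-- Mark in array `40` the vectors of the first list one of whose codes `f` is marked. -/
def checkBody (f : Ex) : Cmd :=
  .ifLt (.const 0) (.load 30 f) (.put 40 (.reg vZ % .reg 0) (.const 1)) .skip

/-- Put `1` into register `0` iff all vectors of the first list are marked. -/
def check (f : Ex) : Cmd :=
  .assign vTot (.reg vLam * .reg 0) ;; .forLoop vZ vTot (checkBody f) ;;
  .assign vFlag (.const 1) ;;
  .forLoop vI 0 (.ifLt (.load 40 (.reg vI)) (.const 1) (.assign vFlag (.const 0)) .skip) ;;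
  .assign 0 (.reg vFlag)

/-- Codes are recomputed, not remembered: several vectors may share a code that the sorted list
holds only once, so the mark is looked up for every choice and every vector. -/
theorem wp_check {f : Ex} (hfW : f.Wf) (hfD : f.deg + 1 ≤ M.D) {F : ℕ → ℤ} {tot n : ℕ}
    (hn : s.reg 0 = n) (htot : s.reg vLam * s.reg 0 = tot) (htB : (tot : ℤ) ≤ M.B)
    (hok : ∀ z, s.mem 40 z = 0)
    (hf : ∀ t : State, (∀ r ≤ 18, t.reg r = s.reg r) → (∀ m ≤ 3, t.mem m = s.mem m) →
      ∀ z : ℕ, z < tot → t.reg vZ = z → f.eval t = F z) :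
    wp M (check f) τ s fun τ' t =>
      τ' ≤ τ + (tot * (f.cost + 18) + n * 15 + 30) ∧
      (t.reg 0 = 1 ↔ ∀ p < n, ∃ z < tot, z % n = p ∧ 0 < s.mem 30 (F z)) := by
  refine wp_seq (wp_set (v := tot) (by simpa using htot) (hvB := htB) (h := ?_))
  refine wp_seq_of (R := fun τ' t => τ' ≤ τ + 7 + (tot * (f.cost + 18) + 4) ∧
      ∀ p : ℕ, (t.mem 40 p = 1 ∧ ∃ z < tot, z % n = p ∧ 0 < s.mem 30 (F z)) ∨
        (t.mem 40 p = 0 ∧ ¬ ∃ z < tot, z % n = p ∧ 0 < s.mem 30 (F z)))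
    (wp_forLoop_uniform tot (f.cost + 11) (fun j t =>
      ∀ p : ℕ, (t.mem 40 p = 1 ∧ ∃ z < j, z % n = p ∧ 0 < s.mem 30 (F z)) ∨
        (t.mem 40 p = 0 ∧ ¬ ∃ z < j, z % n = p ∧ 0 < s.mem 30 (F z)))
    (hki := by simp [checkBody]) (hkn := by simp [checkBody]) (hN := by simp) (h0 := ?_)
    (hstep := ?_) (hQ := ?_)) ?_
  · intro p; right; simpa using hok p
  · intro j hj τ' t hb hF htj hI
    have e := hf t (fun r hr => by
      rw [hF.reg r (by omega) (by simp [checkBody, show r < 100 by omega]; omega)]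
      simp [show r ≠ vTot by omega]) (fun m hm => by
      rw [hF.mem m (by simp [checkBody]; omega)]; rfl) j hj htj
    have e0 : t.reg 0 = n := by
      rw [hF.reg _ (by norm_num) (by simp [checkBody])]; simpa using hn
    have e30 : t.mem 30 = s.mem 30 := by
      rw [hF.mem _ (by simp [checkBody])]; rfl
    have hm : ∀ p, ((∃ z < j + 1, z % n = p ∧ 0 < s.mem 30 (F z)) ↔
        (∃ z < j, z % n = p ∧ 0 < s.mem 30 (F z)) ∨ j % n = p ∧ 0 < s.mem 30 (F j)) := by
      intro p
      constructor
      · rintro ⟨z, hz, h⟩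
        rcases Nat.lt_succ_iff_lt_or_eq.1 hz with h' | rfl
        exacts [Or.inl ⟨z, h', h⟩, Or.inr h]
      · rintro (⟨z, hz, h⟩ | h)
        exacts [⟨z, by omega, h⟩, ⟨j, by omega, h⟩]
    refine wp_ifLt (by simp) (by simp [hfW]) (M.le_D (by simp)) (by simpa using hfD)
      (fun hc => ?_) fun hc => wp_skip ?_
    · simp only [Ex.eval_const, Ex.eval_load, e, e30] at hc
      refine wp_put (hv := fun _ _ => ?_) (h := ?_)
      · have := M.two_le; simp; omega
      refine ⟨by simp; omega, fun p => ?_⟩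
      have ez : ((j : ℤ) % n) = ((j % n : ℕ) : ℤ) := by push_cast; rfl
      simp only [Ex.eval_mod, Ex.eval_reg, htj, e0, ez, Ex.eval_const, State.mem_setReg,
        State.mem_setMem, true_and, Nat.cast_inj, hm]
      by_cases hp : p = j % n
      · left; simp [hp, hc]
      · simp only [hp, if_false, Ne.symm hp, false_and, or_false]; exact hI p
    · simp only [Ex.eval_const, Ex.eval_load, e, e30] at hc
      refine ⟨by simp; omega, fun p => ?_⟩
      simp only [State.mem_setReg, hm, hc, and_false, or_false]
      exact hI p
  · intro τ' t _ _ h1 h2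
    refine ⟨?_, h2⟩
    simp only [Ex.cost_mul, Ex.cost_reg] at h1
    linarith
  rintro τ1 t1 hb1 hFr1 ⟨h1, h2⟩
  have e0 : t1.reg 0 = n := by
    rw [hFr1.reg _ (by norm_num) (by simp [checkBody])]; simpa using hn
  refine wp_seq (wp_set (v := 1) (by simp) (hvB := by have := M.two_le; omega) (h := ?_))
  refine wp_seq_of (R := fun τ' t => τ' ≤ τ1 + 3 + (n * 15 + 4) ∧
      ((t.reg vFlag = 1 ∧ ∀ p < n, ∃ z < tot, z % n = p ∧ 0 < s.mem 30 (F z)) ∨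
        (t.reg vFlag = 0 ∧ ¬ ∀ p < n, ∃ z < tot, z % n = p ∧ 0 < s.mem 30 (F z))))
    (wp_forLoop_uniform n 8 (fun j t =>
      ((t.reg vFlag = 1 ∧ ∀ p < j, ∃ z < tot, z % n = p ∧ 0 < s.mem 30 (F z)) ∨
        (t.reg vFlag = 0 ∧ ¬ ∀ p < j, ∃ z < tot, z % n = p ∧ 0 < s.mem 30 (F z))))
    (hki := by simp) (hkn := by simp) (hN := by simpa using e0) (h0 := ?_)
    (hstep := ?_) (hQ := ?_)) ?_
  · left; simp
  · intro j hj τ' t hb hF htj hI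
    have e40 : t.mem 40 = t1.mem 40 := by
      rw [hF.mem _ (by simp)]; rfl
    have hm : (∀ p < j + 1, ∃ z < tot, z % n = p ∧ 0 < s.mem 30 (F z)) ↔
        (∀ p < j, ∃ z < tot, z % n = p ∧ 0 < s.mem 30 (F z)) ∧
          ∃ z < tot, z % n = j ∧ 0 < s.mem 30 (F z) := by
      constructor
      · exact fun h => ⟨fun p hp => h p (by omega), h j (by omega)⟩
      · rintro ⟨h, h'⟩ p hp
        rcases Nat.lt_succ_iff_lt_or_eq.1 hp with h'' | rfl
        exacts [h p h'', h']
    refine wp_ifLt (hp := fun hc => ?_) (hq := fun hc => wp_skip ?_)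
    · simp only [Ex.eval_load, Ex.eval_reg, htj, e40, Ex.eval_const] at hc
      have hno := (h2 j).resolve_left fun h => by rw [h.1] at hc; omega
      refine wp_assign (hv := fun _ => by simp) (h := ?_)
      refine ⟨by simp, Or.inr ⟨by simp, ?_⟩⟩
      rw [hm]; exact fun h => hno.2 h.2
    · simp only [Ex.eval_load, Ex.eval_reg, htj, e40, Ex.eval_const] at hc
      have hyes := (h2 j).resolve_right fun h => by rw [h.1] at hc; omega
      refine ⟨by simp, ?_⟩
      simp only [hm, hyes.2, and_true]
      simpa using hI
  · intro τ' t _ _ h3 h4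
    refine ⟨?_, h4⟩
    simp only [Ex.cost_const] at h3
    linarith
  rintro τ2 t2 hb2 hFr2 ⟨h3, h4⟩
  refine wp_assign (hv := fun h => by simpa using h.1 vFlag (by norm_num)) (h := ?_)
  refine ⟨by simp; omega, ?_⟩
  simp only [Ex.eval_reg, State.reg_setReg, if_true]
  rcases h4 with ⟨h4, h5⟩ | ⟨h4, h5⟩
  · exact iff_of_true h4 h5
  · exact iff_of_false (by rw [h4]; norm_num) h5

end WordRAM

/-! ### Powers as expressions, and the size of the instance -/

namespace WordRAM

theorem Ex.deg_pow (r n : ℕ) : (Ex.pow r n).deg = 2 * n + 1 := by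
  induction n with
  | zero => rfl
  | succ n ih => rw [Ex.pow, Ex.deg_mul, ih, Ex.deg_reg]; ring

theorem Ex.cost_pow (r n : ℕ) : (Ex.pow r n).cost = 3 * n + 1 := by
  induction n with
  | zero => rfl
  | succ n ih => rw [Ex.pow, Ex.cost_mul, ih, Ex.cost_reg]; ring

/-- Put `2` plus the maximum of the registers `0`, `1`, `2` into `reg vN`. -/
def setSize : Cmd :=
  .assign vN (.reg 0) ;;
  .ifLt (.reg vN) (.reg 1) (.assign vN (.reg 1)) .skip ;;
  .ifLt (.reg vN) (.reg 2) (.assign vN (.reg 2)) .skip ;;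
  .assign vN (.reg vN + .const 2)

theorem wp_setMax {M : Bounds} {τ : ℕ} {s : State} {r : ℕ} (hr : r < 3) {x y : ℕ}
    (hx : s.reg vN = x) (hy : s.reg r = y) :
    wp M (.ifLt (.reg vN) (.reg r) (.assign vN (.reg r)) .skip) τ s fun τ' t =>
      τ' ≤ τ + 9 ∧ t.reg vN = (max x y : ℕ) := by
  refine wp_ifLt (he₂ := by simp; omega) (hp := fun hc => ?_) (hq := fun hc => wp_skip ?_)
  · refine wp_assign (he := by simp; omega)
      (hv := fun h => by simpa using h.1 r (by omega)) (h := ?_)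
    simp only [Ex.eval_reg, hx, hy] at hc ⊢
    exact ⟨by simp, by simp; omega⟩
  · simp only [Ex.eval_reg, hx, hy] at hc ⊢
    exact ⟨by simp, by omega⟩

theorem wp_setSize {M : Bounds} {τ : ℕ} {s : State} {x y z : ℕ} (hx : s.reg 0 = x)
    (hy : s.reg 1 = y) (hz : s.reg 2 = z) (hB : ((max x (max y z) + 2 : ℕ) : ℤ) ≤ M.B) :
    wp M setSize τ s fun τ' t => τ' ≤ τ + 28 ∧ t.reg vN = (max x (max y z) + 2 : ℕ) := by
  refine wp_seq (wp_set (v := x) (by simpa using hx) (hvB := by omega) (h := ?_))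
  refine wp_seq_of (wp_setMax (x := x) (y := y) (by norm_num) (by simp) (by simpa using hy)) ?_
  rintro τ1 t1 _ hF1 ⟨h1, h2⟩
  refine wp_seq_of (wp_setMax (x := max x y) (y := z) (by norm_num) h2 ?_) ?_
  · rw [hF1.reg _ (by norm_num) (by simp)]; simpa using hz
  rintro τ2 t2 _ hF2 ⟨h3, h4⟩
  refine wp_set (v := max x (max y z) + 2) ?_ (hvB := hB) (h := ?_)
  · simp only [Ex.eval_add, Ex.eval_reg, Ex.eval_const, h4]; push_cast; omega
  · simp only [Ex.cost_reg, Ex.cost_add, Ex.cost_const] at *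
    exact ⟨by omega, by simp⟩

end WordRAM

/-! ### Computing the parameters -/

namespace FOPFormula

open WordRAM

variable (φ : FOPFormula) (c N : ℕ)

/-- The parameters of the algorithm are at most `B`. -/
structure Fits (B : ℕ) : Prop where
  size : N ≤ B
  digits : φ.numDigits c N ≤ B
  choices : φ.numChoices c N ≤ B
  base : φ.codeBase c N ≤ B
  blocks : φ.numBlocks c N ^ 3 ≤ B
  bits : φ.codeBits c N ≤ B
  rows : φ.codeBits c N * φ.listLen c N + φ.listLen c N ≤ B
  code : φ.codeBound c N ≤ B

def setParams : Cmd :=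
  .assign vQ (.const (6 * φ.expLin c : ℕ) * .reg vLg) ;;
  .assign vLam (.pow vQ φ.k) ;;
  .assign vBase (.pow vN (φ.expBase c)) ;;
  .assign vOff (.pow vBase (φ.k + 3)) ;;
  .assign vG (.reg vN * .reg vLam / .reg vS + .const 1) ;;
  .assign vM (.reg vG * .reg vS) ;;
  .assign vV (.pow vN (φ.expCode c)) ;;
  .assign vLL (.const (φ.expCode c : ℕ) * .reg vLg) ;;
  .assign vT (.const 3 * .reg vOff) ;;
  .assign vDum (.const 4 * .reg vOff) ;;
  .assign vRow (.reg vLL * .reg vM) ;;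
  .assign vGGG (.pow vG 3)

/-- The registers hold the parameters. -/
structure Ready (s : State) : Prop where
  choices : s.reg vLam = φ.numChoices c N
  digits : s.reg vQ = φ.numDigits c N
  base : s.reg vBase = φ.codeBase c N
  off : s.reg vOff = φ.codeOff c N
  size : s.reg vS = blockSize N
  blocks : s.reg vG = φ.numBlocks c N
  len : s.reg vM = φ.listLen c N
  bound : s.reg vV = φ.codeBound c N
  bits : s.reg vLL = φ.codeBits c N
  target : s.reg vT = 3 * φ.codeOff c N
  dummy : s.reg vDum = 4 * φ.codeOff c N
  row : s.reg vRow = (φ.codeBits c N * φ.listLen c N : ℕ)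
  cube : s.reg vGGG = (φ.numBlocks c N ^ 3 : ℕ)

variable {φ c N}

theorem Ready.congr {s t : State} (h : φ.Ready c N s)
    (ht : ∀ r, 6 ≤ r → r ≤ 18 → t.reg r = s.reg r) : φ.Ready c N t := by
  obtain ⟨h1, h2, h3, h4, h5, h6, h7, h8, h9, h10, h11, h12, h13⟩ := h
  constructor <;> rwa [ht _ (by norm_num) (by norm_num)]

variable (φ c) in
/-- A bound on the degrees of the expressions in the algorithm. -/
def degree : ℕ := 50 + 6 * φ.expLin c + 2 * φ.expBase c + 4 * φ.k + 2 * φ.expCode c +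
  φ.codeEx₁.deg + φ.codeEx₂.deg + φ.codeEx₃.deg

variable {M : Bounds} {τ : ℕ} {s : State}

theorem wp_setParams (hN : 2 ≤ N) (hB : φ.Fits c N M.B) (hD : φ.degree c ≤ M.D)
    (h1 : s.reg vN = N) (h2 : s.reg vLg = bits N) (h3 : s.reg vS = blockSize N) :
    wp M (φ.setParams c) τ s fun τ' t =>
      τ' ≤ τ + (6 * φ.k + 3 * φ.expBase c + 3 * φ.expCode c + 150) ∧ φ.Ready c N t := by
  have hcodes := codes_le (φ := φ) (c := c) hN
  have hcode := hB.code
  have hgle : φ.numBlocks c N ≤ φ.numBlocks c N ^ 3 := Nat.le_self_pow (by norm_num) _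
  unfold degree at hD
  refine wp_seq (wp_set (v := φ.numDigits c N) ?_ (hd := ?_) (hvB := ?_) (h := ?_))
  · simp [h2, numDigits]; ring
  · simp; omega
  · exact_mod_cast hB.digits
  refine wp_seq (wp_set (v := φ.numChoices c N) ?_ (he := Ex.wf_pow (by norm_num) _) (hd := ?_)
    (hvB := ?_) (h := ?_))
  · simp [Ex.eval_pow, numChoices]
  · rw [Ex.deg_pow]; omega
  · exact_mod_cast hB.choices
  refine wp_seq (wp_set (v := φ.codeBase c N) ?_ (he := Ex.wf_pow (by norm_num) _) (hd := ?_)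
    (hvB := ?_) (h := ?_))
  · simp [Ex.eval_pow, codeBase, h1]
  · rw [Ex.deg_pow]; omega
  · exact_mod_cast hB.base
  refine wp_seq (wp_set (v := φ.codeOff c N) ?_ (he := Ex.wf_pow (by norm_num) _) (hd := ?_)
    (hvB := by omega) (h := ?_))
  · simp [Ex.eval_pow, codeOff]
  · rw [Ex.deg_pow]; omega
  refine wp_seq (wp_set (v := φ.numBlocks c N) ?_ (hvB := ?_) (h := ?_))
  · simp [h1, h3, numBlocks]
  · exact_mod_cast hgle.trans hB.blocks
  refine wp_seq (wp_set (v := φ.listLen c N) ?_ (hvB := by omega) (h := ?_))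
  · simp [h3, listLen]
  refine wp_seq (wp_set (v := φ.codeBound c N) ?_ (he := Ex.wf_pow (by norm_num) _) (hd := ?_)
    (hvB := by omega) (h := ?_))
  · simp [Ex.eval_pow, codeBound, h1]
  · rw [Ex.deg_pow]; omega
  refine wp_seq (wp_set (v := φ.codeBits c N) ?_ (hd := ?_) (hvB := ?_) (h := ?_))
  · simp [codeBits, h2]
  · simp; omega
  · exact_mod_cast hB.bits
  refine wp_seq (wp_set (v := 3 * φ.codeOff c N) ?_ (hvB := by omega) (h := ?_))
  · simp
  refine wp_seq (wp_set (v := 4 * φ.codeOff c N) ?_ (hvB := by omega) (h := ?_))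
  · simp
  refine wp_seq (wp_set (v := φ.codeBits c N * φ.listLen c N) ?_ (hvB := ?_) (h := ?_))
  · simp
  · have := hB.rows; omega
  refine wp_set (v := φ.numBlocks c N ^ 3) ?_ (he := Ex.wf_pow (by norm_num) _)
    (hd := M.le_D (by rw [Ex.deg_pow]; norm_num)) (hvB := ?_) (h := ?_)
  · simp [Ex.eval_pow]
  · exact_mod_cast hB.blocks
  refine ⟨?_, ?_⟩
  · simp only [Ex.cost_pow, Ex.cost_mul, Ex.cost_const, Ex.cost_reg, Ex.cost_add, Ex.cost_div]
    omega
  · constructor <;> simp [h3]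

variable (φ c) in
/-- Compute all parameters. -/
def setup : Cmd :=
  setSize ;; search vLg (.const 0) (.op .shr (.reg vN) (.reg vLg)) ;;
  search vS (.pow vS 5) (.reg vN * .reg vN) ;; φ.setParams c

theorem wp_setup {x y z : ℕ} (hx : s.reg 0 = x) (hy : s.reg 1 = y) (hz : s.reg 2 = z)
    (hxyz : max x (max y z) + 2 = N) (hB : φ.Fits c N M.B) (hD : φ.degree c ≤ M.D) :
    wp M (φ.setup c) τ s fun τ' t =>
      τ' ≤ τ + (N * 60 + 6 * φ.k + 3 * φ.expBase c + 3 * φ.expCode c + 200) ∧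
      φ.Ready c N t := by
  have hN : 2 ≤ N := by omega
  have hNB := hB.size
  refine wp_seq_of (wp_setSize hx hy hz (by rw [hxyz]; exact_mod_cast hNB)) ?_
  rw [hxyz]
  rintro τ1 t1 _ hF1 ⟨h1, h2⟩
  -- `bits N` is the least y with N >>> y = 0; likewise, in the second search, the block size is the
  -- least y with y ^ 5 ≥ N ^ 2.
  refine wp_seq_of (wp_search (x := bits N) h2 (bits_le hN) ?_) ?_
  · intro t ht y hy hty
    simp only [Ex.eval_const, Ex.eval_shr, Ex.eval_reg, ht, hty, Int.shiftRight_eq_div_pow,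
      Int.toNat_natCast]
    have e : (0 : ℤ) < (N : ℤ) / ((2 ^ y : ℕ) : ℤ) ↔ 0 < N / 2 ^ y := by
      rw [← Int.natCast_div]; omega
    rw [e, Nat.div_pos_iff, bits, Nat.lt_succ_iff, Nat.le_log_iff_pow_le (by norm_num) (by omega)]
    exact ⟨fun h => h.2, fun h => ⟨by positivity, h⟩⟩
  rintro τ2 t2 _ hF2 ⟨h3, h4⟩
  have h2' : t2.reg vN = N := by rw [hF2.reg _ (by norm_num) (by simp [search]), h2]
  refine wp_seq_of (wp_search (x := blockSize N) h2' (blockSize_le hN) ?_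
    (he₁ := Ex.wf_pow (by norm_num) _) (hd₁ := M.le_D (by rw [Ex.deg_pow]; norm_num))) ?_
  · intro t ht y hy hty
    simp only [Ex.eval_pow, Ex.eval_mul, Ex.eval_reg, ht, hty]
    rw [← sq]
    have e : (y : ℤ) ^ 5 < (N : ℤ) ^ 2 ↔ y ^ 5 < N ^ 2 := by
      exact_mod_cast Iff.rfl
    rw [e]
    refine ⟨fun h => ?_, lt_blockSize⟩
    by_contra hc
    have := Nat.pow_le_pow_left (not_lt.1 hc) 5
    have := le_blockSize (N := N)
    omega
  rintro τ3 t3 _ hF3 ⟨h5, h6⟩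
  refine wp_mono (wp_setParams hN hB hD ?_ ?_ h6) ?_
  · rw [hF3.reg _ (by norm_num) (by simp [search]), h2']
  · rw [hF3.reg _ (by norm_num) (by simp [search]), h4]
  rintro τ4 t4 _ _ ⟨h7, h8⟩
  refine ⟨?_, h8⟩
  simp only [Ex.cost_pow, Ex.cost_mul, Ex.cost_const, Ex.cost_reg, Ex.cost_shr] at *
  omega

theorem keeps_setup {r : ℕ} (hr : r < 3) : (φ.setup c).Keeps r := by
  interval_cases r <;> simp [setup, setSize, search, setParams]

theorem keepsMem_setup (m : ℕ) : (φ.setup c).KeepsMem m := by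
  simp [setup, setSize, search, setParams]

/-! ### The algorithm -/

variable (φ c) in
/-- The algorithm for the formula, given a program `p` for 3-SUM. -/
def algorithm (p : Cmd) : Cmd :=
  φ.setup c ;; sortedCodes 0 φ.codeEx₁ ;; sortedCodes 1 φ.codeEx₂ ;; sortedCodes 2 φ.codeEx₃ ;;
  core p ;; check φ.codeEx₁

variable (φ c) in
/-- A bound on the running time of the algorithm, if `p` takes time `t₀` on the blocks. -/
def runningTime (p : Cmd) (N t₀ : ℕ) : ℕ :=
  (N * 60 + 6 * φ.k + 3 * φ.expBase c + 3 * φ.expCode c + 200) +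
  (φ.listLen c N * (φ.codeEx₁.cost + φ.codeEx₂.cost + φ.codeEx₃.cost + 192) +
    3 * (φ.codeBits c N * (φ.listLen c N * 154 + 27)) + 102) +
  (φ.numBlocks c N ^ 3 * 150 +
    4 * φ.numBlocks c N ^ 2 * (blockSize N * 77 + 3 * t₀ + p.regBound + 30) +
    φ.listLen c N * (blockSize N * (blockSize N * 37 + 11) + 4) + 4) +
  (φ.listLen c N * (φ.codeEx₁.cost + 18) + N * 15 + 30)

end FOPFormula

/-! ### What the phases preserve, and the harmlessness of dummies -/

namespace WordRAM

section
variable {q r m : ℕ} {f : Ex}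

theorem keeps_sortedCodes (hr : r < 100) (h : r ≤ 18 ∨ 24 < r) : (sortedCodes q f).Keeps r := by
  simp [sortedCodes, gen, genBody, padBody, sortList, scanBody, hr]
  omega

theorem keepsMem_sortedCodes (h : m ≠ 10 + q) (h' : m ≠ 20 + q) :
    (sortedCodes q f).KeepsMem m := by
  simp [sortedCodes, gen, genBody, padBody, sortList, scanBody, h.symm, h'.symm]

theorem SortedCodes.congr {s t : State} {q m : ℕ} {row V dum : ℤ} {F : ℕ → ℤ} {tot : ℕ}
    {a : ℕ → ℤ} (h : SortedCodes s q m row V dum F tot a) (ht : t.mem (10 + q) = s.mem (10 + q)) :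
    SortedCodes t q m row V dum F tot a :=
  ⟨by rw [ht]; exact h.holds, h.strict, h.complete, h.sound⟩

/-- Dummies do not take part in solutions. -/
theorem SortedCodes.exists_iff {s : State} {m : ℕ} {row V dum T : ℤ} {F F' F'' : ℕ → ℤ}
    {tot tot' tot'' : ℕ} {a b c : ℕ → ℤ} (ha : SortedCodes s 0 m row V dum F tot a)
    (hb : SortedCodes s 1 m row V dum F' tot' b) (hc : SortedCodes s 2 m row V dum F'' tot'' c)
    (hT : T < dum) {H : ℤ → ℤ} (hH : ∀ u < m, 0 < H (a u) ↔
      ∃ v < m, ∃ w < m, a u + b v + c w = T) {z : ℕ} (hz : z < tot) :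
    0 < H (F z) ↔ ∃ z' < tot', ∃ z'' < tot'', F z + F' z' + F'' z'' = T := by
  obtain ⟨u, hu, e⟩ := ha.complete z hz
  rw [← e, hH u hu]
  constructor
  · rintro ⟨v, hv, w, hw, h⟩
    have h1 := ha.strict.nonneg u hu
    have h2 := hb.strict.nonneg v hv
    have h3 := hc.strict.nonneg w hw
    -- All entries are nonnegative, so a single dummy would already exceed T.
    obtain ⟨z', hz', e'⟩ := (hb.sound v hv).resolve_right (by omega)
    obtain ⟨z'', hz'', e''⟩ := (hc.sound w hw).resolve_right (by omega)
    exact ⟨z', hz', z'', hz'', by rw [← e', ← e'', h]⟩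
  · rintro ⟨z', hz', z'', hz'', h⟩
    obtain ⟨v, hv, e'⟩ := hb.complete z' hz'
    obtain ⟨w, hw, e''⟩ := hc.complete z'' hz''
    exact ⟨v, hv, w, hw, by rw [e', e'', h]⟩

theorem keeps_core {p : Cmd} (hr : r < 100) (h : r < 19) : (core p).Keeps r := by
  simp [core, coreBody, handle, buildBody, markLoop, markBody, hr]
  omega

theorem keepsMem_core {p : Cmd} (hm : m < 100) (h : m ≠ 30) : (core p).KeepsMem m := by
  simp [core, coreBody, handle, buildBody, markLoop, markBody, h.symm, Cmd.keepsMem_call hm]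
  omega

end

end WordRAM

/-! ### Correctness and running time of the algorithm -/

namespace FOPFormula

open WordRAM

variable {φ : FOPFormula} {c N : ℕ}

theorem listLen_le_codeOff (hN : 2 ≤ N) : φ.listLen c N ≤ 4 * φ.codeOff c N := by
  have h1 := listLen_le (φ := φ) (c := c) (N := N)
  have h2 := Nat.mul_le_mul_left N (numChoices_le (φ := φ) (c := c) hN)
  have h3 := blockSize_le hN
  have h4 : 0 < N ^ φ.expChoices c := by positivity
  have h5 : N * N ^ φ.expChoices c ≤ φ.codeBase c N := by
    rw [← pow_succ', codeBase]
    exact Nat.pow_le_pow_right (by omega) (by unfold expBase; omega)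
  have h6 : φ.codeBase c N ≤ φ.codeOff c N := Nat.le_self_pow (by omega) _
  have h7 : N ≤ N * N ^ φ.expChoices c := Nat.le_mul_of_pos_right _ h4
  omega

/-- The registers hold the parameters and the lengths of the lists, and the input arrays hold the
input. -/
structure Loaded (c N : ℕ) (I : φ.Input) (s : State) : Prop where
  ready : φ.Ready c N s
  fst : s.reg 0 = I.A₁.length
  snd : s.reg 1 = I.A₂.length
  thd : s.reg 2 = I.A₃.length
  arr₁ : s.mem 0 = arrayOf (flatten I.A₁)
  arr₂ : s.mem 1 = arrayOf (flatten I.A₂)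
  arr₃ : s.mem 2 = arrayOf (flatten I.A₃)
  free : s.mem 3 = arrayOf (List.ofFn I.t)

variable {I : φ.Input}

theorem Loaded.congr {s t : State} (h : Loaded c N I s)
    (hr : ∀ r ≤ 18, t.reg r = s.reg r) (hm : ∀ m ≤ 3, t.mem m = s.mem m) : Loaded c N I t := by
  obtain ⟨h1, h2, h3, h4, h5, h6, h7, h8⟩ := h
  refine ⟨h1.congr fun r _ h => hr r h, ?_, ?_, ?_, ?_, ?_, ?_, ?_⟩
  · rwa [hr _ (by norm_num)]
  · rwa [hr _ (by norm_num)]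
  · rwa [hr _ (by norm_num)]
  · rwa [hm _ (by norm_num)]
  · rwa [hm _ (by norm_num)]
  · rwa [hm _ (by norm_num)]
  · rwa [hm _ (by norm_num)]

theorem mod_lt_of_lt_mul {z l n : ℕ} (h : z < l * n) : z % n < n := by
  refine Nat.mod_lt _ ?_
  rcases Nat.eq_zero_or_pos n with rfl | h'
  · simp at h
  · exact h'

section
variable {s : State} (h : Loaded c N I s) {z : ℕ} (hz : s.reg vZ = z)
include h hz

theorem Loaded.eval₁ (hlt : z < φ.numChoices c N * I.A₁.length) :
    φ.codeEx₁.eval s = code₁ c N I z := by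
  have hm := mod_lt_of_lt_mul hlt
  rw [code₁, List.getD_eq_getElem _ _ hm]
  exact eval_codeEx₁ h.ready.digits h.ready.base h.ready.off hz h.fst h.arr₁ hm

theorem Loaded.eval₂ (hlt : z < φ.numChoices c N * I.A₂.length) :
    φ.codeEx₂.eval s = code₂ c N I z := by
  have hm := mod_lt_of_lt_mul hlt
  rw [code₂, List.getD_eq_getElem _ _ hm]
  exact eval_codeEx₂ h.ready.digits h.ready.base h.ready.off hz h.snd h.arr₂ hm

theorem Loaded.eval₃ (hlt : z < φ.numChoices c N * I.A₃.length) :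
    φ.codeEx₃.eval s = code₃ c N I z := by
  have hm := mod_lt_of_lt_mul hlt
  rw [code₃, List.getD_eq_getElem _ _ hm]
  exact eval_codeEx₃ h.ready.digits h.ready.base h.ready.off hz h.thd h.arr₃ h.free hm

end

variable {M : Bounds} {τ : ℕ} {s : State}

theorem Loaded.sortedCodes {q : ℕ} (hq : q < 3) {f : Ex} (hfW : f.Wf) {F : ℕ → ℤ} {n : ℕ}
    (hN : 2 ≤ N) (hn : n ≤ N) (hs : Loaded c N I s) (hB : φ.Fits c N M.B) (hfD : f.deg ≤ M.D)
    (hqn : s.reg q = n) (hseen : ∀ z, s.mem (20 + q) z = 0)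
    (hf : ∀ t, Loaded c N I t → ∀ z : ℕ, z < φ.numChoices c N * n → t.reg vZ = z → f.eval t = F z)
    (hF : ∀ z < φ.numChoices c N * n, 0 ≤ F z ∧ F z < 2 * φ.codeOff c N) :
    wp M (sortedCodes q f) τ s fun τ' t =>
      τ' ≤ τ + (φ.listLen c N * (f.cost + 64) +
        φ.codeBits c N * (φ.listLen c N * 154 + 27) + 34) ∧
      Loaded c N I t ∧
      ∃ a, SortedCodes t q (φ.listLen c N) (φ.codeBits c N * φ.listLen c N : ℕ)
        (φ.codeBound c N) (4 * φ.codeOff c N) F (φ.numChoices c N * n) a := by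
  have hcodes := codes_le (φ := φ) (c := c) hN
  have hcode := hB.code
  have hoff := codeOff_pos (φ := φ) (c := c) hN
  have hlen : φ.listLen c N ≤ 4 * φ.codeOff c N := listLen_le_codeOff hN
  refine wp_mono (wp_sortedCodes hq hfW hfD (F := F) (tot := φ.numChoices c N * n) ?_
    hs.ready.len (le_listLen hn) (by positivity) hs.ready.dummy (by exact_mod_cast hlen)
    hs.ready.bits (V := φ.codeBound c N) (by exact_mod_cast hcodes) (by exact_mod_cast hcode)
    (by exact_mod_cast codeBound_lt.le) hseen ?_ (fun z hz => (hF z hz).1)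
    fun z hz => (hF z hz).2.trans (by omega)) ?_
  · rw [hs.ready.choices, hqn]; push_cast; rfl
  · intro t _ hFr z hz hzt
    refine hf t (hs.congr (fun r hr => hFr.reg r (by omega) ?_) fun m hm => hFr.mem m ?_) z hz hzt
    · simp [gen, genBody, padBody, show r < 100 by omega]; omega
    · simp [gen, genBody, padBody]; omega
  · rintro τ' t _ hFr ⟨h1, h2⟩
    refine ⟨h1, hs.congr (fun r hr => hFr.reg r (by omega) ?_) fun m hm => hFr.mem m ?_, h2⟩
    · exact keeps_sortedCodes (by omega) (by omega)
    · exact keepsMem_sortedCodes (by omega) (by omega)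

theorem wp_algorithm {p : Cmd} {W' t₀ : ℕ}
    (hp : SolvesAt p W' (blockSize N) (blockSize N ^ φ.expUniverse c) t₀)
    (hIN : φ.forallExistsExists.size I + 2 = N) (hI : Small c N I) (hB : φ.Fits c N M.B)
    (hD : φ.degree c ≤ M.D) (hW' : W' ≤ M.B) (hU : blockSize N ^ φ.expUniverse c ≤ M.B) :
    wp M (φ.algorithm c p) 0
      (inputState (φ.forallExistsExists.counts I) (φ.forallExistsExists.arrays I)) fun τ t =>
      τ ≤ φ.runningTime c p N t₀ ∧ (t.reg 0 = 1 ↔ φ.forallExistsExists.answer I) := by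
  have hN : 2 ≤ N := by omega
  have hmax : max I.A₁.length (max I.A₂.length I.A₃.length) + 2 = N := hIN
  have hcodes := codes_le (φ := φ) (c := c) hN
  have hoff := codeOff_pos (φ := φ) (c := c) hN
  have huniv := universe_le (φ := φ) (c := c) hN
  have hD' := hD
  unfold degree at hD'
  set s₀ := inputState (φ.forallExistsExists.counts I) (φ.forallExistsExists.arrays I) with hs₀
  have hempty : ∀ m, 4 ≤ m → ∀ z, s₀.mem m z = 0 := by
    intro m hm z
    have e : (φ.forallExistsExists.arrays I).getD m [] = [] :=
      List.getD_eq_default _ _ (by simpa [forallExistsExists] using hm)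
    show arrayOf ((φ.forallExistsExists.arrays I).getD m []) z = 0
    rw [e]; simp [arrayOf]
  refine wp_seq_of (wp_setup (x := I.A₁.length) (y := I.A₂.length) (z := I.A₃.length) rfl rfl rfl
    hmax hB hD) ?_
  rintro τ0 t0 - hF0 ⟨h0, r0⟩
  have m0 : ∀ m, t0.mem m = s₀.mem m := fun m => hF0.mem m (keepsMem_setup m)
  have l0 : Loaded c N I t0 := by
    refine ⟨r0, ?_, ?_, ?_, m0 0, m0 1, m0 2, m0 3⟩
    · exact hF0.reg 0 (by norm_num) (keeps_setup (by norm_num))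
    · exact hF0.reg 1 (by norm_num) (keeps_setup (by norm_num))
    · exact hF0.reg 2 (by norm_num) (keeps_setup (by norm_num))
  refine wp_seq_of (l0.sortedCodes (q := 0) (by norm_num) φ.wf_codeEx₁ hN (by omega) hB
    (by omega) l0.fst ?_ (fun t ht z hz hzt => ht.eval₁ hzt hz) fun z hz => hI.code₁_bounds hN hz)
    ?_
  · intro z; rw [m0]; exact hempty _ (by norm_num) z
  rintro τ1 t1 - hF1 ⟨h1, l1, a, ha⟩
  have m1 : ∀ m, m ≠ 10 → m ≠ 20 → t1.mem m = s₀.mem m := fun m h h' =>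
    (hF1.mem m (keepsMem_sortedCodes h h')).trans (m0 m)
  refine wp_seq_of (l1.sortedCodes (q := 1) (by norm_num) φ.wf_codeEx₂ hN (by omega) hB
    (by omega) l1.snd ?_ (fun t ht z hz hzt => ht.eval₂ hzt hz) fun z hz => hI.code₂_bounds hN hz)
    ?_
  · intro z; rw [m1 _ (by norm_num) (by norm_num)]; exact hempty _ (by norm_num) z
  rintro τ2 t2 - hF2 ⟨h2, l2, b, hb⟩
  have m2 : ∀ m, m ≠ 11 → m ≠ 21 → t2.mem m = t1.mem m := fun m h h' =>
    hF2.mem m (keepsMem_sortedCodes h h')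
  refine wp_seq_of (l2.sortedCodes (q := 2) (by norm_num) φ.wf_codeEx₃ hN (by omega) hB
    (by omega) l2.thd ?_ (fun t ht z hz hzt => ht.eval₃ hzt hz) fun z hz => hI.code₃_bounds hN hz)
    ?_
  · intro z; rw [m2 _ (by norm_num) (by norm_num), m1 _ (by norm_num) (by norm_num)]
    exact hempty _ (by norm_num) z
  rintro τ3 t3 - hF3 ⟨h3, l3, d, hd⟩
  have m3 : ∀ m, m ≠ 12 → m ≠ 22 → t3.mem m = t2.mem m := fun m h h' =>
    hF3.mem m (keepsMem_sortedCodes h h')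
  -- The earlier phases write only to arrays 10 to 12 and 20 to 22, so the mark tables 30 and 40 and
  -- the memory of the subroutine are still zero.
  have m3' : ∀ m, 4 ≤ m → m < 10 ∨ 22 < m → ∀ z, t3.mem m z = 0 := fun m h h' z => by
    rw [m3 m (by omega) (by omega), m2 m (by omega) (by omega), m1 m (by omega) (by omega)]
    exact hempty m h z
  have ha3 := (ha.congr (m2 _ (by norm_num) (by norm_num))).congr (m3 _ (by norm_num) (by norm_num))
  have hb3 := hb.congr (m3 _ (by norm_num) (by norm_num))
  have hsorted : SortedInput t3 (blockSize N) (φ.numBlocks c N)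
      (φ.codeBits c N * φ.listLen c N : ℕ) (φ.codeBound c N) (3 * φ.codeOff c N) a b d :=
    ⟨l3.ready.size, l3.ready.blocks, l3.ready.cube, l3.ready.row, l3.ready.bound, l3.ready.target,
      ha3.holds, hb3.holds, hd.holds⟩
  have hs1 := two_le_blockSize hN
  have hs2 := blockSize_le hN
  have hNV : N ≤ φ.codeBound c N := Nat.le_self_pow (by simp [expCode]) _
  -- Addresses of the subroutine are words, since B g³ + g³ ≤ B² + B ≤ B³ ≤ W.
  have hBW : (M.B : ℤ) * (φ.numBlocks c N ^ 3 : ℕ) + (φ.numBlocks c N ^ 3 : ℕ) ≤ M.W := by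
    have h1 := M.B_pow_le (M.le_D (show 3 ≤ 40 by norm_num))
    have h2 : ((φ.numBlocks c N ^ 3 : ℕ) : ℤ) ≤ M.B := by exact_mod_cast hB.blocks
    have h3 : (2 : ℤ) ≤ M.B := by exact_mod_cast M.two_le
    have h4 := mul_le_mul_of_nonneg_left h2 (show (0 : ℤ) ≤ M.B by omega)
    have h5 := mul_le_mul_of_nonneg_left h3 (show (0 : ℤ) ≤ M.B by omega)
    have h6 := mul_le_mul_of_nonneg_left h3 (mul_self_nonneg (M.B : ℤ))
    have e : (M.B : ℤ) ^ 3 = M.B * M.B * M.B := by ring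
    linarith
  refine wp_seq_of (wp_core hp (by omega) (V' := M.B) (by exact_mod_cast hW')
    (by exact_mod_cast hU) le_rfl hBW hsorted (m3' 30 (by norm_num) (by norm_num))
    (fun m hm => m3' m (by omega) (by omega)) (by omega) (by positivity) ?_ ?_ (by positivity) ?_
    ha3.strict hb3.strict hd.strict) ?_
  · exact_mod_cast (show φ.codeBound c N + blockSize N ≤ _ by omega)
  · exact_mod_cast (show 3 * φ.codeOff c N + φ.codeBound c N ≤ _ by omega)
  · exact_mod_cast hB.rows
  rintro τ4 t4 - hF4 ⟨h4, hits⟩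
  have l4 : Loaded c N I t4 := l3.congr
    (fun r hr => hF4.reg r (by omega) (keeps_core (by omega) (by omega)))
    fun m hm => hF4.mem m (keepsMem_core (by omega) (by omega))
  refine wp_mono (wp_check φ.wf_codeEx₁ (by omega) (F := code₁ c N I) (n := I.A₁.length)
    (tot := φ.numChoices c N * I.A₁.length) l4.fst ?_ ?_ ?_ ?_) ?_
  · rw [l4.ready.choices, l4.fst]; push_cast; rfl
  · have := le_listLen (φ := φ) (c := c) (N := N) (j := I.A₁.length) (by omega)
    have := hB.code
    omega
  · intro z
    rw [hF4.mem 40 (keepsMem_core (by norm_num) (by norm_num))]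
    exact m3' 40 (by norm_num) (by norm_num) z
  · exact fun t hr hm z hz hzt => (l4.congr hr hm).eval₁ hzt hz
  · rintro τ5 t5 - - ⟨h5, h6⟩
    refine ⟨?_, ?_⟩
    · have e : φ.numBlocks c N * blockSize N = φ.listLen c N := rfl
      have := Nat.mul_le_mul_right (φ.codeEx₁.cost + 18)
        (le_listLen (φ := φ) (c := c) (N := N) (j := I.A₁.length) (by omega))
      rw [e] at h4
      unfold runningTime
      have : I.A₁.length * 15 ≤ N * 15 := by omega
      linarith
    · rw [h6]
      refine Iff.trans ?_ (hI.answer_iff hN)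
      refine forall₂_congr fun p hp => exists_congr fun z => and_congr_right fun hz =>
        and_congr_right fun hzp => ?_
      exact ha3.exists_iff hb3 hd (by omega) hits hz

end FOPFormula


section asymptotics

open Filter Asymptotics

/-! ### Growth rates -/

/-- `f` grows at most like the power with exponent `e`. -/
def GrowsLike (f : ℕ → ℝ) (e : ℝ) : Prop := f =O[atTop] fun N : ℕ => (N : ℝ) ^ e

namespace GrowsLike

variable {f g : ℕ → ℝ} {d e : ℝ}

theorem mono (h : GrowsLike f d) (hde : d ≤ e) : GrowsLike f e := by
  refine h.trans (IsBigO.of_bound 1 ?_)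
  filter_upwards [eventually_ge_atTop 1] with N hN
  have : (1 : ℝ) ≤ N := by exact_mod_cast hN
  rw [one_mul, Real.norm_of_nonneg (by positivity), Real.norm_of_nonneg (by positivity)]
  exact Real.rpow_le_rpow_of_exponent_le this hde

theorem add (hf : GrowsLike f e) (hg : GrowsLike g e) : GrowsLike (fun N => f N + g N) e :=
  IsBigO.add hf hg

theorem mul (hf : GrowsLike f d) (hg : GrowsLike g e) :
    GrowsLike (fun N => f N * g N) (d + e) := by
  refine (IsBigO.mul hf hg).congr' .rfl ?_
  filter_upwards [eventually_gt_atTop 0] with N hN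
  rw [Real.rpow_add (by exact_mod_cast hN)]

theorem const (a : ℝ) (he : 0 ≤ e) : GrowsLike (fun _ => a) e := by
  refine mono (d := 0) ?_ he
  simpa [GrowsLike] using isBigO_const_const a (one_ne_zero (α := ℝ)) atTop

theorem pow (hf : GrowsLike f e) (k : ℕ) : GrowsLike (fun N => f N ^ k) (k * e) := by
  refine (IsBigO.pow hf k).congr' .rfl (Eventually.of_forall fun N => ?_)
  show ((N : ℝ) ^ e) ^ k = (N : ℝ) ^ (k * e)
  rw [← Real.rpow_natCast, ← Real.rpow_mul (by positivity), mul_comm]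

theorem of_le {f g : ℕ → ℝ} (hg : GrowsLike g e) (h0 : ∀ N, 0 ≤ f N) (h : ∀ N, 2 ≤ N → f N ≤ g N) :
    GrowsLike f e := by
  refine IsBigO.trans (IsBigO.of_bound 1 ?_) hg
  filter_upwards [eventually_ge_atTop 2] with N hN
  rw [one_mul, Real.norm_of_nonneg (h0 N)]
  exact (h N hN).trans (le_abs_self _)

theorem id : GrowsLike (fun N => (N : ℝ)) 1 := by
  simpa [GrowsLike] using isBigO_refl (fun N : ℕ => (N : ℝ)) atTop

theorem rpow (e : ℝ) : GrowsLike (fun N => (N : ℝ) ^ e) e := isBigO_refl _ _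

end GrowsLike

namespace FOPFormula

open WordRAM

variable (φ : FOPFormula) (c : ℕ)

/-- The logarithm is below every positive power, so the polylogarithmic overhead of the encoding can
be absorbed into the saving. -/
theorem growsLike_bits {e : ℝ} (he : 0 < e) : GrowsLike (fun N => (bits N : ℝ)) e := by
  have h1 : GrowsLike (fun N => Real.log N) e :=
    ((isLittleO_log_rpow_atTop he).comp_tendsto tendsto_natCast_atTop_atTop).isBigO
  refine GrowsLike.of_le (g := fun N => Real.log N * (Real.log 2)⁻¹ + 1)
    (((h1.mul (.const _ le_rfl)).mono (by simp)).add (.const _ he.le)) (fun _ => by positivity)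
    fun N hN => ?_
  unfold bits
  push_cast
  gcongr
  have := Real.natLog_le_logb N 2
  rwa [Real.logb, div_eq_mul_inv] at this

theorem growsLike_numChoices {e : ℝ} (he : 0 < e) :
    GrowsLike (fun N => (φ.numChoices c N : ℝ)) e := by
  -- Dividing by k + 1 instead of k also covers formulas with k = 0.
  have hk : 0 < e / (φ.k + 1) := by positivity
  have h := (((GrowsLike.const (6 * φ.expLin c : ℝ) le_rfl).mul (growsLike_bits hk)).pow φ.k)
  refine (h.mono (e := e) ?_).of_le (fun _ => by positivity) fun N _ => ?_
  · rw [zero_add, mul_div_assoc', div_le_iff₀ (by positivity)]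
    nlinarith
  · simp only [numChoices, numDigits]; push_cast; rw [mul_assoc]

theorem growsLike_codeBits {e : ℝ} (he : 0 < e) :
    GrowsLike (fun N => (φ.codeBits c N : ℝ)) e := by
  have h := (GrowsLike.const (φ.expCode c : ℝ) le_rfl).mul (growsLike_bits he)
  refine (h.mono (by simp)).of_le (fun _ => by positivity) fun N _ => ?_
  simp [codeBits]

theorem rpow_le_blockSize (N : ℕ) : (N : ℝ) ^ (2 / 5 : ℝ) ≤ blockSize N := by
  have h : (N : ℝ) ^ 2 ≤ (blockSize N : ℝ) ^ 5 := by exact_mod_cast le_blockSize (N := N)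
  have e : ((N : ℝ) ^ (2 / 5 : ℝ)) ^ 5 = (N : ℝ) ^ 2 := by
    rw [← Real.rpow_natCast, ← Real.rpow_mul (by positivity), ← Real.rpow_natCast]
    norm_num
  exact le_of_pow_le_pow_left₀ (by norm_num) (by positivity) (e.trans_le h)

theorem blockSize_le_rpow (N : ℕ) : (blockSize N : ℝ) ≤ (N : ℝ) ^ (2 / 5 : ℝ) + 1 := by
  rcases Nat.eq_zero_or_pos (blockSize N) with h0 | h0
  · rw [h0]; push_cast; positivity
  have h : ((blockSize N - 1 : ℕ) : ℝ) ^ 5 ≤ (N : ℝ) ^ 2 := by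
    exact_mod_cast (lt_blockSize (N := N) (y := blockSize N - 1) (by omega)).le
  have e : ((N : ℝ) ^ (2 / 5 : ℝ)) ^ 5 = (N : ℝ) ^ 2 := by
    rw [← Real.rpow_natCast, ← Real.rpow_mul (by positivity), ← Real.rpow_natCast]
    norm_num
  have := le_of_pow_le_pow_left₀ (by norm_num) (by positivity) (h.trans_eq e.symm)
  rw [Nat.cast_sub h0] at this
  push_cast at this
  linarith

theorem growsLike_blockSize : GrowsLike (fun N => (blockSize N : ℝ)) (2 / 5) :=
  ((GrowsLike.rpow (2 / 5)).add (.const 1 (by norm_num))).of_le (fun _ => by positivity)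
    fun N _ => blockSize_le_rpow N

theorem tendsto_blockSize : Tendsto blockSize atTop atTop := by
  rw [← tendsto_natCast_atTop_iff (R := ℝ)]
  exact tendsto_atTop_mono rpow_le_blockSize
    ((tendsto_rpow_atTop (by norm_num)).comp tendsto_natCast_atTop_atTop)

theorem growsLike_numBlocks {e : ℝ} (he : 0 < e) :
    GrowsLike (fun N => (φ.numBlocks c N : ℝ)) (3 / 5 + e) := by
  refine (((GrowsLike.rpow (3 / 5)).mul (φ.growsLike_numChoices c he)).add
    (.const 1 (by positivity))).of_le (fun _ => by positivity) fun N hN => ?_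
  have hN0 : (0 : ℝ) < N := by exact_mod_cast (by omega : 0 < N)
  have hs := rpow_le_blockSize N
  have hp : (0 : ℝ) < (N : ℝ) ^ (2 / 5 : ℝ) := by positivity
  unfold numBlocks
  push_cast
  gcongr
  refine Nat.cast_div_le.trans ?_
  rw [div_le_iff₀ (hp.trans_le hs)]
  have e1 : (N : ℝ) = (N : ℝ) ^ (3 / 5 : ℝ) * (N : ℝ) ^ (2 / 5 : ℝ) := by
    rw [← Real.rpow_add hN0]; norm_num
  calc ((N * φ.numChoices c N : ℕ) : ℝ)
      = (N : ℝ) ^ (3 / 5 : ℝ) * φ.numChoices c N * (N : ℝ) ^ (2 / 5 : ℝ) := by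
        push_cast; nth_rewrite 1 [e1]; ring
    _ ≤ _ := by gcongr

theorem growsLike_listLen {e : ℝ} (he : 0 < e) :
    GrowsLike (fun N => (φ.listLen c N : ℝ)) (1 + e) :=
  (((φ.growsLike_numBlocks c he).mul growsLike_blockSize).mono (by linarith)).of_le
    (fun _ => by positivity) fun N _ => by simp [listLen]

/-- With η = ε / 30 for polylogarithmic factors, the triples contribute 9/5 + 3η, the calls 2 (3/5 +
η) + 2/5 (2 - ε) = 2 - ε/3, and the quadratic searches 9/5 + η. All of these are at most 2 - ε/5
because ε ≤ 1/2. -/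
theorem growsLike_runningTime {ε : ℝ} (hε : 0 < ε) (hε1 : ε ≤ 1 / 2) (p : Cmd) {t : ℕ → ℕ}
    (ht : (fun n => (t n : ℝ)) =O[atTop] fun n : ℕ => (n : ℝ) ^ (2 - ε)) :
    GrowsLike (fun N => (φ.runningTime c p N (t (blockSize N)) : ℝ)) (2 - ε / 5) := by
  have hη : 0 < ε / 30 := by positivity
  have hm := φ.growsLike_listLen c hη
  have hg := φ.growsLike_numBlocks c hη
  have hL := φ.growsLike_codeBits c hη
  have hs := growsLike_blockSize
  have hN := GrowsLike.id
  have htime : GrowsLike (fun N => (t (blockSize N) : ℝ)) (2 / 5 * (2 - ε)) := by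
    -- The bound on `t` is only asymptotic, so it matters that the block size tends to infinity.
    refine (ht.comp_tendsto tendsto_blockSize).trans ?_
    have h := IsBigO.rpow (r := 2 - ε) (by linarith) (Eventually.of_forall fun N : ℕ =>
      show (0 : ℝ) ≤ (N : ℝ) ^ (2 / 5 : ℝ) by positivity) hs
    refine h.congr_right fun N => ?_
    rw [← Real.rpow_mul (by positivity)]
  have hc : ∀ a : ℝ, GrowsLike (fun _ => a) 0 := fun a => .const a le_rfl
  have hC : ∀ a : ℝ, GrowsLike (fun _ => a) (2 - ε / 5) := fun a => .const a (by linarith)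
  have hC1 : ∀ a : ℝ, GrowsLike (fun _ => a) (1 + ε / 30) := fun a => .const a (by linarith)
  have hCt : ∀ a : ℝ, GrowsLike (fun _ => a) (2 / 5 * (2 - ε)) := fun a => .const a (by linarith)
  have hCs : ∀ a : ℝ, GrowsLike (fun _ => a) (2 / 5) := fun a => .const a (by norm_num)
  have hCss : ∀ a : ℝ, GrowsLike (fun _ => a) (2 / 5 + 2 / 5) := fun a => .const a (by norm_num)
  simp only [runningTime]
  push_cast
  refine .add (.add (.add ?_ ?_) ?_) ?_
  · exact ((((hN.mul (hc _)).mono (by linarith)).add (hC _)).add (hC _)).add (hC _) |>.add (hC _)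
  · exact (((hm.mul (hc _)).mono (by linarith)).add
      (((hc _).mul (hL.mul (((hm.mul (hc _)).mono (by linarith)).add (hC1 _)))).mono
        (by linarith))).add (hC _)
  · refine .add (.add (.add ?_ ?_) ?_) (hC _)
    · exact ((hg.pow 3).mul (hc _)).mono (by push_cast; linarith)
    · refine .mono (((hc _).mul (hg.pow 2)).mul (e := 2 / 5 * (2 - ε)) ?_) (by push_cast; linarith)
      exact ((((hs.mul (hc _)).mono (by linarith)).add
        (((hc _).mul htime).mono (by linarith))).add (hCt _)).add (hCt _)
    · refine .mono (hm.mul (e := 2 / 5 + 2 / 5) (.add ?_ (hCss _))) (by linarith)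
      exact hs.mul (((hs.mul (hc _)).mono (by linarith)).add (hCs _))
  · exact (((hm.mul (hc _)).mono (by linarith)).add ((hN.mul (hc _)).mono (by linarith))).add (hC _)

end FOPFormula

theorem GrowsLike.comp_add_two {f : ℕ → ℝ} {e : ℝ} (he : 0 ≤ e) (h : GrowsLike f e) :
    GrowsLike (fun n => f (n + 2)) e := by
  refine (h.comp_tendsto (tendsto_add_atTop_nat 2)).trans (IsBigO.of_bound (2 ^ e) ?_)
  filter_upwards [eventually_ge_atTop 2] with n hn
  have hn' : (2 : ℝ) ≤ n := by exact_mod_cast hn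
  rw [Function.comp_apply, Real.norm_of_nonneg (by positivity), Real.norm_of_nonneg (by positivity),
    ← Real.mul_rpow (by norm_num) (by positivity)]
  refine Real.rpow_le_rpow (by positivity) ?_ he
  push_cast; linarith

/-! ### All numbers fit into words -/

namespace FOPFormula

open WordRAM

variable (φ : FOPFormula) (c C' : ℕ)

/-- The exponent of the bound on all numbers in the algorithm. -/
def expBound : ℕ := (φ.expLin c + 4) + φ.expChoices c + φ.expBase c + 3 * (φ.expChoices c + 2) +
  (2 * φ.expCode c + 2) + φ.expUniverse c + 2 * C' + c + 1

variable {φ c C'} {N : ℕ}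

/-- `expBound` is a sum in which each parameter finds its own exponent, so it dominates all of them
at once. -/
theorem fits (hN : 2 ≤ N) : φ.Fits c N (N ^ φ.expBound c C') := by
  have hpow : ∀ {x e : ℕ}, x ≤ N ^ e → e ≤ φ.expBound c C' → x ≤ N ^ φ.expBound c C' :=
    fun h h' => h.trans (Nat.pow_le_pow_right (by omega) h')
  have hΛ := numChoices_le (φ := φ) (c := c) hN
  have hbits := bits_le hN
  have hL : φ.codeBits c N + 1 ≤ N ^ (φ.expCode c + 2) := by
    have h1 : φ.codeBits c N ≤ N ^ φ.expCode c * N :=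
      Nat.mul_le_mul (const_le_pow hN _) hbits
    have h2 : 0 < N ^ φ.expCode c * N := by positivity
    have h3 : N ^ (φ.expCode c + 2) = N ^ φ.expCode c * N * N := by ring
    have h4 := Nat.mul_le_mul_left (N ^ φ.expCode c * N) hN
    omega
  refine ⟨?_, ?_, ?_, ?_, ?_, ?_, ?_, ?_⟩
  · exact hpow (e := 1) (by simp) (by unfold expBound; omega)
  · exact hpow (numDigits_le hN) (by unfold expBound; omega)
  · exact hpow hΛ (by unfold expBound; omega)
  · exact hpow le_rfl (by unfold expBound; omega)
  · refine hpow (e := (φ.expChoices c + 2) * 3) ?_ (by unfold expBound; omega)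
    rw [pow_mul]
    refine Nat.pow_le_pow_left ?_ 3
    have h1 : N * φ.numChoices c N / blockSize N ≤ N * N ^ φ.expChoices c :=
      (Nat.div_le_self _ _).trans (Nat.mul_le_mul_left _ hΛ)
    have h2 : 0 < N * N ^ φ.expChoices c := by positivity
    have h3 : N ^ (φ.expChoices c + 2) = N * N ^ φ.expChoices c * N := by ring
    have h4 := Nat.mul_le_mul_left (N * N ^ φ.expChoices c) hN
    unfold numBlocks
    omega
  · exact hpow ((Nat.le_succ _).trans hL) (by unfold expBound; omega)
  · have h1 := codes_le (φ := φ) (c := c) hN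
    have h2 := Nat.mul_le_mul hL (show φ.listLen c N ≤ N ^ φ.expCode c by
      unfold codeBound at h1; omega)
    rw [← pow_add, add_mul, one_mul] at h2
    exact hpow h2 (by unfold expBound; omega)
  · exact hpow le_rfl (by unfold expBound; omega)

theorem small_of_inUniverse {I : φ.Input}
    (h : φ.forallExistsExists.InUniverse I (φ.forallExistsExists.size I ^ c))
    (hN : φ.forallExistsExists.size I ≤ N) : Small c N I := by
  have hle : ((φ.forallExistsExists.size I ^ c : ℕ) : ℤ) ≤ ((N ^ c : ℕ) : ℤ) := by
    exact_mod_cast Nat.pow_le_pow_left hN c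
  have key : ∀ l ∈ φ.forallExistsExists.arrays I, ∀ x ∈ l, |x| ≤ ((N ^ c : ℕ) : ℤ) :=
    fun l hl x hx => (h l hl x hx).trans hle
  simp only [forallExistsExists, List.mem_cons, List.not_mem_nil, or_false, forall_eq_or_imp,
    forall_eq] at key
  obtain ⟨h1, h2, h3, h4⟩ := key
  exact ⟨fun x hx j => h1 _ (mem_flatten hx j), fun x hx j => h2 _ (mem_flatten hx j),
    fun x hx j => h3 _ (mem_flatten hx j), fun j => h4 _ ((List.mem_ofFn' _ _).2 ⟨j, rfl⟩)⟩

end FOPFormula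

theorem WordRAM.abs_arrayOf_le {l : List ℤ} {B : ℤ} (hB : 0 ≤ B) (h : ∀ x ∈ l, |x| ≤ B) (z : ℤ) :
    |arrayOf l z| ≤ B := by
  unfold arrayOf
  split_ifs
  · by_cases hz : z.toNat < l.length
    · rw [List.getD_eq_getElem _ _ hz]; exact h _ (List.getElem_mem hz)
    · rw [List.getD_eq_default _ _ (by omega)]; simpa
  · simpa

theorem DecisionProblem.bdd_inputState {P : DecisionProblem} {I : P.Instance} {U : ℕ}
    (h : P.InUniverse I U) {M : WordRAM.Bounds} (hU : U ≤ M.B) (hc : ∀ n ∈ P.counts I, n ≤ M.B) :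
    M.Bdd (WordRAM.inputState (P.counts I) (P.arrays I)) := by
  refine ⟨fun r _ => ?_, fun m _ z => ?_⟩
  · show |(((P.counts I).getD r 0 : ℕ) : ℤ)| ≤ _
    by_cases hr : r < (P.counts I).length
    · rw [List.getD_eq_getElem _ _ hr]
      have := hc _ (List.getElem_mem hr)
      rw [abs_of_nonneg (by positivity)]; exact_mod_cast this
    · rw [List.getD_eq_default _ _ (by omega)]; simp
  · refine WordRAM.abs_arrayOf_le (by positivity) (fun x hx => ?_) z
    by_cases hm : m < (P.arrays I).length
    · rw [List.getD_eq_getElem _ _ hm] at hx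
      exact (h _ (List.getElem_mem hm) x hx).trans (by exact_mod_cast hU)
    · rw [List.getD_eq_default _ _ (by omega)] at hx; simp at hx

end asymptotics

/-- If 3-SUM can be solved in time `O(n ^ (2 - ε))` for some `ε > 0`, then every problem in
`FOP_ℤ(∀∃∃)` can be solved in time `O(n ^ (2 - εP))` for some `εP > 0`. -/
theorem mainTheorem8
    (h : ∃ ε : ℝ, 0 < ε ∧
      threeSum.SolvableInTime (fun n : ℕ => (n : ℝ) ^ (2 - ε))) :
    ∀ φ : FOPFormula, ∃ εP : ℝ, 0 < εP ∧
      φ.forallExistsExists.SolvableInTime (fun n : ℕ => (n : ℝ) ^ (2 - εP)) := by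
  obtain ⟨ε, hε, hsol⟩ := h
  intro φ
  -- A smaller saving is still valid, and 1/2 keeps the terms near N^(9/5) below the bound.
  set δ := min ε (1 / 2) with hδ
  have hδ0 : 0 < δ := lt_min hε (by norm_num)
  have hδ1 : δ ≤ 1 / 2 := min_le_right _ _
  refine ⟨δ / 5, by positivity, fun c => ?_⟩
  -- The universe exponent is known before any instance, so one program `p` serves all of them; its
  -- word exponent C' then enters the bound `B`.
  obtain ⟨p, C', t, ht, hp⟩ := hsol (φ.expUniverse c)
  have ht' : (fun n => (t n : ℝ)) =O[Filter.atTop] fun n : ℕ => (n : ℝ) ^ (2 - δ) :=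
    GrowsLike.mono ht (by have := min_le_left ε (1 / 2); linarith)
  refine ⟨φ.algorithm c p, φ.expBound c C' * φ.degree c,
    fun n => φ.runningTime c p (n + 2) (t (FOPFormula.blockSize (n + 2))),
    (φ.growsLike_runningTime c hδ0 hδ1 p ht').comp_add_two (by linarith), fun I hI => ?_⟩
  set N := φ.forallExistsExists.size I + 2 with hN
  have hN2 : 2 ≤ N := by omega
  have hfit : φ.Fits c N (N ^ φ.expBound c C') := FOPFormula.fits hN2
  have hpow : ∀ {x e : ℕ}, x ≤ N ^ e → e ≤ φ.expBound c C' → x ≤ N ^ φ.expBound c C' :=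
    fun h h' => h.trans (Nat.pow_le_pow_right (by omega) h')
  have hs := FOPFormula.blockSize_le hN2
  -- The word bound B ^ degree is a power of size + 2, as the definition of solvability requires.
  let M : WordRAM.Bounds := ⟨N ^ (φ.expBound c C' * φ.degree c), N ^ φ.expBound c C', φ.degree c,
    hN2.trans hfit.size, by rw [← pow_mul], by unfold FOPFormula.degree; omega⟩
  have hsolves : WordRAM.SolvesAt p ((FOPFormula.blockSize N + 2) ^ C') (FOPFormula.blockSize N)
      (FOPFormula.blockSize N ^ φ.expUniverse c) (t (FOPFormula.blockSize N)) := by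
    rintro J hJ hJU
    have := hp J (by rw [show threeSum.size J = FOPFormula.blockSize N from hJ]; exact hJU)
    rw [show threeSum.size J = FOPFormula.blockSize N from hJ] at this
    rw [← hJ] at this ⊢
    exact this
  have hwp := FOPFormula.wp_algorithm (M := M) hsolves hN.symm
    (FOPFormula.small_of_inUniverse hI (by omega)) hfit le_rfl
    (by
      -- The factor 2 comes from S + 2 ≤ N + 2 ≤ N².
      refine hpow (e := 2 * C') ?_ (by unfold FOPFormula.expBound; omega)
      rw [pow_mul]
      exact Nat.pow_le_pow_left (by nlinarith) C')
    (hpow (Nat.pow_le_pow_left hs _) (by unfold FOPFormula.expBound; omega))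
  have hbdd : M.Bdd (WordRAM.inputState (φ.forallExistsExists.counts I)
      (φ.forallExistsExists.arrays I)) := by
    refine DecisionProblem.bdd_inputState hI
      (hpow (Nat.pow_le_pow_left (by omega) c) (by unfold FOPFormula.expBound; omega))
      fun n hn => le_trans ?_ hfit.size
    have hmax : max I.A₁.length (max I.A₂.length I.A₃.length) + 2 = N := rfl
    simp only [FOPFormula.forallExistsExists, List.mem_cons, List.not_mem_nil, or_false] at hn
    omega
  obtain ⟨τ, s, u, h1, h2, -, -, h3, h4⟩ := hwp hbdd _ (WordRAM.State.Agree.refl _)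
  exact ⟨τ, s, h1, by simpa using h3, by rw [h2.1 0 (by norm_num)]; exact h4⟩
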